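/- **Setting.** Let $\eta=\mathrm{diag}(1,-1,-1,-1)$ be the metric of Minkowski space $\mathbb M=\mathbb R^4$; Greek indices run over $0,\dots,3$, are raised and lowered with $\eta$, and repeated indices are summed. Let $e_I$ ($I=\emptyset,0,\dots,0123$) be the standard basis of the complex exterior algebra $\bigwedge_*\mathbb C^4$, let $\gamma_\alpha\psi=e_\alpha\wedge\psi-\iota_\alpha\psi$, where $\iota_\alpha$ is the antiderivation with $\iota_\alpha e_\beta=\eta_{\alpha\beta}$, and let $\hat\eta$ be the extension of $\eta$ to a Hermitian form on $\bigwedge_*\mathbb C^4$: $\hat\eta_{IJ}=\det(\eta_{\alpha_i\beta_j})$ for $I=\alpha_1\cdots\alpha_k$, $J=\beta_1\cdots\beta_k$, and $\hat\eta_{IJ}=0$ if $|I|\ne|J|$. For a multi-index $I=\alpha_1\cdots\alpha_k$, let $\Theta_I$ be the unique $16\times16$ matrix that commutes with all $\gamma_\alpha$ and satisfies $\Theta_Ie_\emptyset=e_{\alpha_1}\wedge\cdots\wedge e_{\alpha_k}$; put $\mathcal J=\Theta_{0123}$ and $e^{\zeta\mathcal J}=\cos\zeta+\sin\zeta\,\mathcal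 J$. Both $\epsilon_{\alpha\beta\rho\sigma}$ and $\epsilon^{\alpha\beta\rho\sigma}$ denote the Levi-Civita symbol with $\epsilon_{0123}=\epsilon^{0123}=1$. A *force tensor* is a collection $\theta=(\theta_0,\dots,\theta_3)$ of $16\times16$ matrices with $\theta_\alpha^\dagger\hat\eta+\hat\eta\theta_\alpha=0$ and $[\gamma^\alpha,\theta_\beta]=0$. For a smooth field $\theta$ of force tensors and a smooth field $\psi:\mathbb M\to\bigwedge_*\mathbb C^4$, with $\omega=\sqrt{-\det\eta}=1$ and real constants $m,\tau$, put $$\Omega_{\alpha\beta}=\partial_\alpha\theta_\beta-\partial_\beta\theta_\alpha+[\theta_\alpha,\theta_\beta],\qquad L_V=\tfrac12\omega\,\mathrm{tr}(\Omega_{\alpha\beta}\Omega^{\alpha\beta})+c.c.,$$ $$L_K=\bigl(\tfrac12\psi^\dagger\hat\eta D\psi+c.c.-m\psi^\dagger\hat\eta\psi\bigr)\omega,\qquad D\psi=\gamma^\alpha(\partial_\alpha\psi+\theta_\alpha\psi),\qquad L=L_K-\tau L_V .$$ A field is *stationary* for $L$ if, with $\psi$ fixed, the derivative at $\varepsilon=0$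 of $\int_KL$ along $q+\varepsilon\delta$ vanishes for every smooth compactly supported variation $\delta$ of the same algebraic type as the field $q$ (same symmetries and contraction conditions) and every compact $K\supseteq\operatorname{supp}\delta$. **Claim.** Let $\zeta$ be a real constant. Let $(E^\beta_I)_\alpha=\delta^\beta_\alpha\Theta_I$. For each of the following six types of smooth real field on $\mathbb M$, the given $\theta$ is at every point a force tensor, $L_V$ has the given value, and, if $\tau\ne0$ (and, in cases 1–5, $\cos2\zeta\ne0$), the field is stationary for $L$ if and only if the given field equation holds everywhere on $\mathbb M$ for all values of the free indices. 1. *Scalar* $\phi$; $\theta=\phi(\cos\zeta+i\sin\zeta\,\mathcal J)E^\alpha_\alpha$, i.e. $\theta_\alpha=\phi(\cos\zeta+i\sin\zeta\mathcal J)\Theta_\alpha$. $$L_V=-96\cos2\zeta\,[(\partial^\alpha\phi)(\partial_\alpha\phi)+8\cos2\zeta\,\phi^4],$$ $$\partial_\alpha\partial^\alpha\phi-16\cos2\zeta\,\phi^3=\tfrac1{192\tau\cos2\zeta}\psi^\dagger\hat\eta\gamma^\alpha(\cos\zeta+i\sin\zeta\,\mathcal J)\Theta_\alpha\psi .$$ 2.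 *Vector of the first type* $B^\alpha$; $\theta=B^\alpha e^{\zeta\mathcal J}E^\beta_{\beta\alpha}$, i.e. $\theta_\alpha=B^\beta e^{\zeta\mathcal J}\Theta_{\alpha\beta}$. $$\begin{aligned}L_V=&-384(B_\alpha B^\alpha)^2\cos4\zeta-256(B^\alpha B_\alpha\partial_\beta B^\beta-B^\alpha B_\beta\partial_\alpha B^\beta)\cos3\zeta\\&-32[2(\partial_\alpha B^\beta)(\partial^\alpha B_\beta)+(\partial_\alpha B^\alpha)^2]\cos2\zeta-32\epsilon_{\alpha\beta\rho\sigma}(\partial^\alpha B^\beta)(\partial^\rho B^\sigma)\sin2\zeta .\end{aligned}$$ Here $\epsilon_{\alpha\beta\rho\sigma}(\partial^\alpha B^\beta)(\partial^\rho B^\sigma)=\partial^\alpha(\epsilon_{\alpha\beta\rho\sigma}B^\beta\partial^\rho B^\sigma)$ is a divergence, and every $B$ is stationary for it. The field equation is $$\begin{aligned}&\partial_\beta\partial^\beta B_\alpha+\tfrac12\partial_\alpha\partial_\beta B^\beta+\tfrac{6\cos3\zeta}{\cos2\zeta}(B_\beta\partial_\alpha B^\beta-B_\alpha\partial_\beta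 B^\beta)-\tfrac{12\cos4\zeta}{\cos2\zeta}(B_\beta B^\beta)B_\alpha\\&\quad=\tfrac1{128\tau\cos2\zeta}\psi^\dagger\hat\eta\gamma^\beta e^{\zeta\mathcal J}\Theta_{\beta\alpha}\psi .\end{aligned}$$ 3. *Vector of the second type* $A^\alpha$; $\theta=A^\alpha e^{\zeta\mathcal J}\,i\eta_{\alpha\beta}E^\beta_\emptyset$, i.e. $\theta_\alpha=iA_\alpha e^{\zeta\mathcal J}$. $$L_V=-32\cos2\zeta\,[(\partial_\alpha A^\beta)(\partial^\alpha A_\beta)-(\partial_\alpha A^\beta)(\partial_\beta A^\alpha)],\qquad \partial_\beta\partial^\beta A_\alpha-\partial_\alpha\partial_\beta A^\beta=\tfrac i{64\tau\cos2\zeta}\psi^\dagger\hat\eta\gamma_\alpha e^{\zeta\mathcal J}\psi .$$ 4. *Antisymmetric tensor* $W^{\alpha\beta}=-W^{\beta\alpha}$; $\theta=W^{\alpha\beta}(\cos\zeta+i\sin\zeta\,\mathcal J)\mathcal JE^\mu_{\mu\alpha\beta}$, i.e. $\theta_\alpha=-iW^{\rho\sigma}(\sin\zeta+i\cos\zeta\,\mathcal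 J)\Theta_{\alpha\rho\sigma}$. $$\begin{aligned}L_V=&\,1024\cos^22\zeta\,[W^{\alpha\beta}W_{\beta\rho}W^{\rho\sigma}W_{\sigma\alpha}-(W^{\alpha\beta}W_{\alpha\beta})^2]\\&+64\cos2\zeta\,[(\partial_\alpha W^{\rho\sigma})(\partial^\alpha W_{\rho\sigma})+2(\partial_\beta W^{\alpha\beta})(\partial^\sigma W_{\alpha\sigma})],\end{aligned}$$ $$\begin{aligned}&\partial_\mu\partial^\mu W_{\alpha\beta}-\partial_\alpha\partial^\sigma W_{\beta\sigma}+\partial_\beta\partial^\sigma W_{\alpha\sigma}+32\cos2\zeta\,[W_{\alpha\rho}W^{\rho\sigma}W_{\sigma\beta}+(W^{\rho\sigma}W_{\rho\sigma})W_{\alpha\beta}]\\&\quad=\tfrac i{128\tau\cos2\zeta}\psi^\dagger\hat\eta\gamma^\nu(\sin\zeta+i\cos\zeta\,\mathcal J)\Theta_{\nu\alpha\beta}\psi .\end{aligned}$$ 5. *Symmetric contraction-free tensor* $S^{\alpha\beta}=S^{\beta\alpha}$, $S^\alpha_\alpha=0$; $\theta=S^{\alpha\beta}(\cos\zeta+i\sin\zeta\,\mathcal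 J)\tfrac12(\eta_{\alpha\mu}E^\mu_\beta+\eta_{\beta\mu}E^\mu_\alpha)$, i.e. $\theta_\alpha=\eta_{\alpha\beta}S^{\beta\mu}(\cos\zeta+i\sin\zeta\,\mathcal J)\Theta_\mu$. $$\begin{aligned}L_V=&\,64\cos^22\zeta\,[S^{\alpha\beta}S_{\beta\rho}S^{\rho\sigma}S_{\sigma\alpha}-(S^{\alpha\beta}S_{\alpha\beta})^2]\\&-32\cos2\zeta\,[(\partial_\alpha S^{\beta\rho})(\partial^\alpha S_{\beta\rho})-(\partial^\alpha S^{\beta\rho})(\partial_\beta S_{\alpha\rho})],\end{aligned}$$ $$\begin{aligned}&\partial_\mu\partial^\mu S_{\alpha\beta}-\tfrac12\partial_\alpha\partial^\mu S_{\mu\beta}-\tfrac12\partial_\beta\partial^\mu S_{\mu\alpha}+\tfrac14\eta_{\alpha\beta}\partial_\mu\partial_\nu S^{\mu\nu}\\&\quad+4\cos2\zeta\,[S_{\alpha\mu}S^{\mu\nu}S_{\nu\beta}-(S^{\mu\nu}S_{\mu\nu})S_{\alpha\beta}-\tfrac14\eta_{\alpha\beta}S_\mu^\nu S_\nu^\sigma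 S_\sigma^\mu]\\&=\tfrac1{128\tau\cos2\zeta}\psi^\dagger\hat\eta(\cos\zeta+i\sin\zeta\,\mathcal J)(\gamma_\alpha\Theta_\beta+\gamma_\beta\Theta_\alpha-\tfrac12\eta_{\alpha\beta}\gamma^\mu\Theta_\mu)\psi .\end{aligned}$$ 6. *Fierz tensor* $F^{\alpha\rho\sigma}=-F^{\alpha\sigma\rho}$, $\eta_{\alpha\rho}F^{\alpha\rho\sigma}=0$, $\epsilon_{\alpha\rho\sigma\tau}F^{\alpha\rho\sigma}=0$; $\theta=F^{\alpha\rho\sigma}\eta_{\alpha\beta}E^\beta_{\rho\sigma}$, i.e. $\theta_\alpha=\eta_{\alpha\beta}F^{\beta\rho\sigma}\Theta_{\rho\sigma}$. $$L_V=-32F_{\alpha\beta\rho\sigma}F^{\alpha\beta\rho\sigma},\qquad F_{\alpha\beta\rho\sigma}=\partial_\alpha F_{\beta\rho\sigma}-\partial_\beta F_{\alpha\rho\sigma}+4({F_{\alpha\rho}}^\nu F_{\beta\nu\sigma}-{F_{\beta\rho}}^\nu F_{\alpha\nu\sigma}),$$ and the field equation is $P(\xi)_{\alpha\rho\sigma}=P(\chi)_{\alpha\rho\sigma}$,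 where $$P(\xi)_{\alpha\rho\sigma}=\xi_{\alpha\rho\sigma}-\tfrac13\eta_{\alpha\rho}{\xi^\beta}_{\beta\sigma}+\tfrac13\eta_{\alpha\sigma}{\xi^\beta}_{\beta\rho}-\tfrac16\epsilon_{\alpha\rho\sigma\omega}\epsilon^{\lambda\mu\nu\omega}\xi_{\lambda\mu\nu},$$ $\xi_{\alpha\rho\sigma}=\tfrac12(\tilde\xi_{\alpha\rho\sigma}-\tilde\xi_{\alpha\sigma\rho})$, $\chi_{\alpha\rho\sigma}=\tfrac1{128\tau}\psi^\dagger\hat\eta\gamma_\alpha\Theta_{\rho\sigma}\psi$ and $$\begin{aligned}\tilde\xi_{\alpha\rho\sigma}=&\,8(2{F^{\beta\nu}}_\rho\partial_\beta F_{\alpha\sigma\nu}+{F^{\beta\nu}}_\rho\partial_\alpha F_{\beta\nu\sigma}+{F_{\alpha\rho}}^\nu\partial_\beta{F^\beta}_{\sigma\nu})\\&-32(F_{\beta\rho\mu}{F_\alpha}^{\mu\nu}{F^\beta}_{\nu\sigma}-F_{\beta\rho\mu}F^{\beta\mu\nu}F_{\alpha\nu\sigma})+\partial_\beta\partial^\beta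 F_{\alpha\rho\sigma}-\partial_\beta\partial_\alpha{F^\beta}_{\rho\sigma}.\end{aligned}$$ -/

import Mathlib

open MeasureTheory
open scoped ContDiff Matrix

noncomputable section

namespace ForceField

/-! Minkowski space, the exterior algebra, gamma and theta matrices -/

/-- Minkowski space, with its linear coordinates `x 0, x 1, x 2, x 3`. -/
abbrev Spacetime := Fin 4 → ℝ

/-- Increasing multi-indices, labelling the basis `e_I` of the complex exterior algebra. -/
abbrev MultiIndex := Finset (Fin 4)

/-- Values of a field `ψ = ψ^I e_I`. -/
abbrev Spinor := MultiIndex → ℂ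

/-- Complex 16 by 16 matrices. -/
abbrev Mat := Matrix MultiIndex MultiIndex ℂ

/-- `sg α = η_{αα} = η^{αα}`. As `η` is diagonal, raising or lowering an index `α` multiplies a
component by `sg α`. -/
def sg : Fin 4 → ℤ := ![1, -1, -1, -1]

/-- The Minkowski metric `diag (1, -1, -1, -1)`. -/
def eta : Matrix (Fin 4) (Fin 4) ℤ := Matrix.diagonal sg

/-- The number of indices in `I` that precede `α`. -/
def pos (α : Fin 4) (I : MultiIndex) : ℕ := (I.filter (· < α)).card

/-- The matrix of `e_α ∧ ·`. -/
def wedgeZ (α : Fin 4) : Matrix MultiIndex MultiIndex ℤ :=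
  Matrix.of fun K I => if α ∉ I ∧ K = insert α I then (-1) ^ pos α I else 0

/-- The matrix of the interior product `ι_α`, the antiderivation with `ι_α e_β = η_{αβ}`. -/
def iotaZ (α : Fin 4) : Matrix MultiIndex MultiIndex ℤ :=
  Matrix.of fun K I => ∑ β ∈ I, if K = I.erase β then (-1) ^ pos β I * eta α β else 0

/-- `γ_α = e_α ∧ · - ι_α`. -/
def gammaZ (α : Fin 4) : Matrix MultiIndex MultiIndex ℤ := wedgeZ α - iotaZ α

/-- The basis vector `e_∅`. -/
def vacuum : MultiIndex → ℤ := Pi.single ∅ 1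

/-- `e_I = e_{α₁} ∧ ⋯ ∧ e_{α_k}` for an arbitrary multi-index `I = α₁⋯α_k`. -/
def basisVec (I : List (Fin 4)) : MultiIndex → ℤ := I.foldr (fun α v => wedgeZ α *ᵥ v) vacuum

/-- The indices of `J` in increasing order. -/
def idxList (J : MultiIndex) : List (Fin 4) := (List.finRange 4).filter (· ∈ J)

/-- `γ_J = γ_{α₁} ⋯ γ_{α_k}` for an increasing multi-index `J = α₁⋯α_k`. -/
def gammaProdZ (J : MultiIndex) : Matrix MultiIndex MultiIndex ℤ :=
  ((idxList J).map gammaZ).prod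

/-- The matrix with columns `Θ_I e_J = γ_J e_I`. -/
def thetaZ (I : List (Fin 4)) : Matrix MultiIndex MultiIndex ℤ :=
  Matrix.of fun K J => (gammaProdZ J *ᵥ basisVec I) K

/-- The gamma matrix `γ_α`. -/
def gamma (α : Fin 4) : Mat := (gammaZ α).map (Int.cast : ℤ → ℂ)

/-- `γ^α = η^{αβ} γ_β`. -/
def gammaUp (α : Fin 4) : Mat := (sg α : ℂ) • gamma α

/-- The theta matrix `Θ_I`; by `eq_theta_iff` below it is the unique matrix that commutes with the
gamma matrices and satisfies `Θ_I e_∅ = e_I`. -/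
def theta (I : List (Fin 4)) : Mat := (thetaZ I).map (Int.cast : ℤ → ℂ)

/-- The secondary complex structure `𝒥 = Θ_{0123}`. -/
def calJ : Mat := theta [0, 1, 2, 3]

/-- The Hermitian metric on the exterior algebra: `η̂_{IJ} = det (η_{α_i β_j})` if
`I = α₁⋯α_k`, `J = β₁⋯β_k`, and `η̂_{IJ} = 0` if the lengths differ. -/
def etaHat : Mat :=
  Matrix.of fun I J =>
    if h : I.card = J.card then
      ((Matrix.det (Matrix.of fun i j : Fin J.card =>
        eta (I.orderEmbOfFin h i) (J.orderEmbOfFin rfl j)) : ℤ) : ℂ)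
    else 0

/-! The characterization of `Θ_I` -/

/-- `γ_α e_I = gcoef α I • e_{I ∆ α}`. -/
def gcoef (α : Fin 4) (I : MultiIndex) : ℤ :=
  if α ∈ I then -((-1) ^ pos α I * sg α) else (-1) ^ pos α I

/-- Coefficients of right multiplication by `e_α` in the Clifford algebra. -/
def rcoef (α : Fin 4) (I : MultiIndex) : ℤ :=
  (-1) ^ I.card * if α ∈ I then (-1) ^ pos α I * sg α else (-1) ^ pos α I

def rightZ (α : Fin 4) : Matrix MultiIndex MultiIndex ℤ :=
  Matrix.of fun K I => if K = symmDiff I {α} then rcoef α I else 0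

set_option maxRecDepth 10000 in
theorem gammaZ_apply : ∀ (α : Fin 4) (K I : MultiIndex),
    gammaZ α K I = if K = symmDiff I {α} then gcoef α I else 0 := by
  have h : ∀ (α : Fin 4) (I K : MultiIndex), wedgeZ α K I - iotaZ α K I
      = if K = symmDiff I {α} then gcoef α I else 0 := by
    decide +kernel
  exact fun α K I => h α I K

set_option maxRecDepth 10000 in
theorem gcoef_rcoef : ∀ (α β : Fin 4) (I : MultiIndex),
    gcoef α (symmDiff I {β}) * rcoef β I = rcoef β (symmDiff I {α}) * gcoef α I := by
  decide +kernel

set_option maxRecDepth 10000 in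
theorem rcoef_mul_self : ∀ (α : Fin 4) (I : MultiIndex), α ∉ I →
    rcoef α I * rcoef α I = 1 ∧ symmDiff I {α} = insert α I := by
  decide +kernel

theorem gammaZ_mulVec_single (α : Fin 4) (I : MultiIndex) (c : ℤ) :
    gammaZ α *ᵥ Pi.single I c = Pi.single (symmDiff I {α}) (gcoef α I * c) := by
  ext K
  simp [gammaZ_apply, Pi.single_apply]

theorem rightZ_mulVec_single (α : Fin 4) (I : MultiIndex) (c : ℤ) :
    rightZ α *ᵥ Pi.single I c = Pi.single (symmDiff I {α}) (rcoef α I * c) := by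
  ext K
  simp [rightZ, Pi.single_apply]

theorem mat_ext_single {A B : Matrix MultiIndex MultiIndex ℤ}
    (h : ∀ I, A *ᵥ Pi.single I 1 = B *ᵥ Pi.single I 1) : A = B := by
  ext K I
  simpa using congrFun (h I) K

theorem gammaZ_commute_rightZ (α β : Fin 4) : Commute (gammaZ α) (rightZ β) := by
  refine mat_ext_single fun I => ?_
  rw [← Matrix.mulVec_mulVec, ← Matrix.mulVec_mulVec, gammaZ_mulVec_single,
    rightZ_mulVec_single, gammaZ_mulVec_single, rightZ_mulVec_single, symmDiff_right_comm]
  simp [gcoef_rcoef]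

theorem exists_commutant_single (J : MultiIndex) :
    ∃ T : Matrix MultiIndex MultiIndex ℤ,
      (∀ α, Commute (gammaZ α) T) ∧ T *ᵥ vacuum = Pi.single J 1 := by
  induction J using Finset.induction_on with
  | empty => exact ⟨1, fun α => Commute.one_right _, by rw [Matrix.one_mulVec]; rfl⟩
  | insert a s ha ih =>
    obtain ⟨T, hT, hv⟩ := ih
    obtain ⟨h1, h2⟩ := rcoef_mul_self a s ha
    refine ⟨rcoef a s • (rightZ a * T), fun α =>
      ((gammaZ_commute_rightZ α a).mul_right (hT α)).smul_right _, ?_⟩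
    rw [Matrix.smul_mulVec, ← Matrix.mulVec_mulVec, hv, rightZ_mulVec_single, h2]
    simp [← Pi.single_smul, h1]

theorem exists_commutant (v : MultiIndex → ℤ) :
    ∃ T : Matrix MultiIndex MultiIndex ℤ,
      (∀ α, Commute (gammaZ α) T) ∧ T *ᵥ vacuum = v := by
  choose T hT hv using exists_commutant_single
  refine ⟨∑ J, v J • T J, fun α =>
    Commute.sum_right _ _ _ fun J _ => (hT J α).smul_right _, ?_⟩
  rw [Matrix.sum_mulVec]
  have h : ∀ J, (v J • T J) *ᵥ vacuum = Pi.single J (v J) := by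
    intro J
    rw [Matrix.smul_mulVec, hv, ← Pi.single_smul, smul_eq_mul, mul_one]
  simp only [h]
  exact Finset.univ_sum_single v

set_option maxRecDepth 10000 in
theorem fold_gcoef : ∀ J : MultiIndex,
    (idxList J).foldr (fun α p => (symmDiff p.1 {α}, gcoef α p.1 * p.2)) ((∅ : MultiIndex), (1 : ℤ))
      = (J, 1) := by
  decide +kernel

theorem gammaProdZ_vacuum (J : MultiIndex) : gammaProdZ J *ᵥ vacuum = Pi.single J 1 := by
  have key : ∀ L : List (Fin 4), (L.map gammaZ).prod *ᵥ vacuum =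
      (fun p : MultiIndex × ℤ => (Pi.single p.1 p.2 : MultiIndex → ℤ))
        (L.foldr (fun α p => (symmDiff p.1 {α}, gcoef α p.1 * p.2)) ((∅ : MultiIndex), (1 : ℤ))) := by
    intro L
    induction L with
    | nil => rw [List.map_nil, List.prod_nil, Matrix.one_mulVec]; rfl
    | cons a L ih =>
      rw [List.map_cons, List.prod_cons, ← Matrix.mulVec_mulVec, ih]
      simp only [List.foldr_cons, gammaZ_mulVec_single]
  rw [gammaProdZ, key, fold_gcoef]

theorem gammaProdZ_commute {T : Matrix MultiIndex MultiIndex ℤ}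
    (hT : ∀ α, Commute (gammaZ α) T) (J : MultiIndex) : Commute (gammaProdZ J) T := by
  refine Commute.list_prod_left _ _ fun x hx => ?_
  obtain ⟨α, -, rfl⟩ := List.mem_map.1 hx
  exact hT α

theorem eq_thetaZ {T : Matrix MultiIndex MultiIndex ℤ} {I : List (Fin 4)}
    (hT : ∀ α, Commute (gammaZ α) T) (hv : T *ᵥ vacuum = basisVec I) : T = thetaZ I := by
  ext K J
  have h := congrArg (fun M => (M *ᵥ vacuum) K) (gammaProdZ_commute hT J).eq
  simp only [← Matrix.mulVec_mulVec, hv, gammaProdZ_vacuum] at h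
  simpa [thetaZ] using h.symm

theorem thetaZ_spec (I : List (Fin 4)) :
    (∀ α, Commute (gammaZ α) (thetaZ I)) ∧ thetaZ I *ᵥ vacuum = basisVec I := by
  obtain ⟨T, hT, hv⟩ := exists_commutant (basisVec I)
  rw [← eq_thetaZ hT hv]
  exact ⟨hT, hv⟩

/-- `Θ_I` is the unique matrix that commutes with the gamma matrices and maps `e_∅` to `e_I`. -/
theorem eq_theta_iff (I : List (Fin 4)) (T : Mat) :
    T = theta I ↔ (∀ α, gamma α * T = T * gamma α) ∧
      T *ᵥ (fun K => (vacuum K : ℂ)) = fun K => (basisVec I K : ℂ) := by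
  have hmv : ∀ (A : Matrix MultiIndex MultiIndex ℤ) (v : MultiIndex → ℤ),
      A.map (Int.cast : ℤ → ℂ) *ᵥ (fun K => (v K : ℂ)) = fun K => ((A *ᵥ v) K : ℂ) := by
    intro A v
    ext K
    simp [Matrix.mulVec, dotProduct]
  have hmul : ∀ A B : Matrix MultiIndex MultiIndex ℤ,
      (A * B).map (Int.cast : ℤ → ℂ) = A.map Int.cast * B.map Int.cast := by
    intro A B
    ext K J
    simp [Matrix.mul_apply]
  constructor
  · rintro rfl
    obtain ⟨h1, h2⟩ := thetaZ_spec I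
    refine ⟨fun α => ?_, ?_⟩
    · rw [gamma, theta, ← hmul, ← hmul, (h1 α).eq]
    · rw [theta, hmv, h2]
  · rintro ⟨h1, h2⟩
    have hprod : ∀ L : List (Fin 4),
        (L.map gammaZ).prod.map (Int.cast : ℤ → ℂ) * T
          = T * (L.map gammaZ).prod.map (Int.cast : ℤ → ℂ) := by
      intro L
      induction L with
      | nil => simp [Matrix.map_one]
      | cons a L ih =>
        rw [List.map_cons, List.prod_cons, hmul, Matrix.mul_assoc, ih, ← Matrix.mul_assoc,
          ← Matrix.mul_assoc]
        exact congrArg (· * _) (h1 a)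
    ext K J
    have h := congrArg (fun M => (M *ᵥ (fun K => (vacuum K : ℂ))) K) (hprod (idxList J))
    simp only [← Matrix.mulVec_mulVec, h2, hmv] at h
    have h3 := gammaProdZ_vacuum J
    rw [gammaProdZ] at h3
    rw [h3] at h
    have h4 : (fun L => ((Pi.single J 1 : MultiIndex → ℤ) L : ℂ)) = Pi.single J 1 := by
      ext L
      by_cases hL : L = J <;> simp [hL]
    rw [h4] at h
    simpa [theta, thetaZ, gammaProdZ] using h.symm

/-- In the basis `e_I` the extended metric is diagonal. -/
theorem etaHat_eq_diagonal :
    etaHat = Matrix.diagonal fun I : MultiIndex => ((∏ α ∈ I, sg α : ℤ) : ℂ) := by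
  ext I J
  by_cases hIJ : I = J
  · subst hIJ
    have : (Matrix.of fun i j : Fin I.card =>
        eta (I.orderEmbOfFin rfl i) (I.orderEmbOfFin rfl j))
        = Matrix.diagonal fun i => sg (I.orderEmbOfFin rfl i) := by
      ext i j
      simp [eta, Matrix.diagonal_apply]
    rw [Matrix.diagonal_apply_eq, etaHat, Matrix.of_apply, dif_pos rfl, this, Matrix.det_diagonal]
    congr 1
    have h2 : Finset.univ.map (I.orderEmbOfFin rfl).toEmbedding = I := by simp
    conv_rhs => rw [← h2]
    rw [Finset.prod_map]
    rfl
  · rw [Matrix.diagonal_apply_ne _ hIJ, etaHat, Matrix.of_apply]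
    split_ifs with h
    · obtain ⟨a, haI, haJ⟩ : ∃ a ∈ I, a ∉ J := by
        by_contra hcon
        push Not at hcon
        exact hIJ (Finset.eq_of_subset_of_card_le hcon h.ge)
      obtain ⟨i, hi⟩ : ∃ i, I.orderEmbOfFin h i = a := by
        have : a ∈ Set.range (I.orderEmbOfFin h) := by simpa using haI
        exact this
      rw [Matrix.det_eq_zero_of_row_eq_zero i]
      · simp
      · intro j
        have : a ≠ J.orderEmbOfFin rfl j := fun hc =>
          haJ (hc ▸ Finset.orderEmbOfFin_mem J rfl j)
        simp [eta, hi, this]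
    · rfl

/-- The Levi-Civita symbol with `eps 0 1 2 3 = 1`, used with lower and with upper indices. -/
def eps (α β ρ σ : Fin 4) : ℤ :=
  Matrix.det (Matrix.of fun i j : Fin 4 => if ![α, β, ρ, σ] i = j then (1 : ℤ) else 0)

/-! Force tensors -/

/-- The two conditions that define a force tensor `θ` in flat spacetime:
`θ_α^† η̂ + η̂ θ_α = 0` and `[γ^α, θ_β] = 0`. -/
def IsForceTensor (θ : Fin 4 → Mat) : Prop :=
  (∀ α, (θ α)ᴴ * etaHat + etaHat * θ α = 0) ∧
    ∀ α β, gammaUp α * θ β - θ β * gammaUp α = 0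

/-- The collection `E^β_I` with components `δ_α^β Θ_I`. -/
def basisTensor (β : Fin 4) (I : List (Fin 4)) : Fin 4 → Mat :=
  fun α => if α = β then theta I else 0

/-- A matrix acting component-wise on a collection of four matrices. -/
def matAct (A : Mat) (θ : Fin 4 → Mat) : Fin 4 → Mat := fun α => A * θ α

/-- `e^{ζ𝒥} = cos ζ + sin ζ 𝒥`. -/
def expJ (ζ : ℝ) : Mat := (Real.cos ζ : ℂ) • 1 + (Real.sin ζ : ℂ) • calJ

/-- `cos ζ + i sin ζ 𝒥`. -/
def expIJ (ζ : ℝ) : Mat := (Real.cos ζ : ℂ) • 1 + (Complex.I * (Real.sin ζ : ℂ)) • calJ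

/-- `u = E^α_α`. -/
def uTensor : Fin 4 → Mat := ∑ α, basisTensor α [α]

/-- `v_α = E^β_{βα}`. -/
def vTensor (α : Fin 4) : Fin 4 → Mat := ∑ β, basisTensor β [β, α]

/-- `w_α = i η_{αβ} E^β_∅`. -/
def wTensor (α : Fin 4) : Fin 4 → Mat :=
  Complex.I • ∑ β, (eta α β : ℂ) • basisTensor β []

/-- `w_{αβ} = E^μ_{μαβ}`. -/
def wTensor2 (α β : Fin 4) : Fin 4 → Mat := ∑ μ, basisTensor μ [μ, α, β]

/-- `v_{αβ} = 𝒥 w_{αβ}`. -/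
def vTensor2 (α β : Fin 4) : Fin 4 → Mat := matAct calJ (wTensor2 α β)

/-- `u_{αβ} = (η_{αμ} E^μ_β + η_{βμ} E^μ_α) / 2`. -/
def uTensor2 (α β : Fin 4) : Fin 4 → Mat :=
  (1 / 2 : ℂ) • ∑ μ, ((eta α μ : ℂ) • basisTensor μ [β] + (eta β μ : ℂ) • basisTensor μ [α])

/-- `u_{αρσ} = η_{αβ} E^β_{ρσ}`. -/
def uTensor3 (α ρ σ : Fin 4) : Fin 4 → Mat :=
  ∑ β, (eta α β : ℂ) • basisTensor β [ρ, σ]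

/-- `U = φ (cos ζ + i sin ζ 𝒥) u`: the summand `(1 + i𝒥)𝟙`. -/
def scalarForce (ζ φ : ℝ) : Fin 4 → Mat := (φ : ℂ) • matAct (expIJ ζ) uTensor

/-- `F = B^α e^{ζ𝒥} v_α`: the summand `(1 + 𝒥)𝟜`. -/
def vectorForce (ζ : ℝ) (B : Fin 4 → ℝ) : Fin 4 → Mat :=
  ∑ α, (B α : ℂ) • matAct (expJ ζ) (vTensor α)

/-- `M = A^α e^{ζ𝒥} w_α`: the summand `i(1 + 𝒥)𝟜''`. -/
def imVectorForce (ζ : ℝ) (A : Fin 4 → ℝ) : Fin 4 → Mat :=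
  ∑ α, (A α : ℂ) • matAct (expJ ζ) (wTensor α)

/-- `H = W^{αβ} (cos ζ + i sin ζ 𝒥) v_{αβ}`: the summand `(1 + i𝒥)𝟞`. -/
def antisymForce (ζ : ℝ) (W : Fin 4 → Fin 4 → ℝ) : Fin 4 → Mat :=
  ∑ α, ∑ β, (W α β : ℂ) • matAct (expIJ ζ) (vTensor2 α β)

/-- `N = S^{αβ} (cos ζ + i sin ζ 𝒥) u_{αβ}`: the summand `(1 + i𝒥)𝟡`. -/
def symForce (ζ : ℝ) (S : Fin 4 → Fin 4 → ℝ) : Fin 4 → Mat :=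
  ∑ α, ∑ β, (S α β : ℂ) • matAct (expIJ ζ) (uTensor2 α β)

/-- `X = F^{αρσ} u_{αρσ}`: the sixteen-dimensional summand. -/
def fierzForce (F : Fin 4 → Fin 4 → Fin 4 → ℝ) : Fin 4 → Mat :=
  ∑ α, ∑ ρ, ∑ σ, (F α ρ σ : ℂ) • uTensor3 α ρ σ

/-- Antisymmetric tensors `W^{αβ}`. -/
def Antisym : Set (Fin 4 → Fin 4 → ℝ) := {W | ∀ α β, W α β = -W β α}

/-- Symmetric contraction-free tensors `S^{αβ}`. -/
def SymTraceless : Set (Fin 4 → Fin 4 → ℝ) :=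
  {S | (∀ α β, S α β = S β α) ∧ ∑ α, ∑ β, (eta α β : ℝ) * S α β = 0}

/-- Fierz tensors `F^{αρσ}`. -/
def Fierz : Set (Fin 4 → Fin 4 → Fin 4 → ℝ) :=
  {F | (∀ α ρ σ, F α ρ σ = -F α σ ρ) ∧
    (∀ σ, ∑ α, ∑ ρ, (eta α ρ : ℝ) * F α ρ σ = 0) ∧
    ∀ τ, ∑ α, ∑ ρ, ∑ σ, (eps α ρ σ τ : ℝ) * F α ρ σ = 0}

/-! Derivatives, Lagrangians and variation -/

/-- The partial derivative `∂_α f`. -/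
def pd {E : Type*} [NormedAddCommGroup E] [NormedSpace ℝ E] (α : Fin 4) (f : Spacetime → E)
    (x : Spacetime) : E :=
  fderiv ℝ f x (Pi.single α 1)

/-- `∂^α f = η^{αβ} ∂_β f` for a real function `f`. -/
def pdU (α : Fin 4) (f : Spacetime → ℝ) (x : Spacetime) : ℝ := (sg α : ℝ) * pd α f x

/-- `∂_α ∂^α f`. -/
def box (f : Spacetime → ℝ) (x : Spacetime) : ℝ := ∑ α, pd α (pdU α f) x

/-- The entry-wise partial derivative of a matrix-valued function. -/
def pdMat (α : Fin 4) (C : Spacetime → Mat) (x : Spacetime) : Mat :=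
  Matrix.of fun I J => pd α (fun y => C y I J) x

/-- `ω = √(-det η)`. -/
def omega : ℝ := Real.sqrt (-((Matrix.det eta : ℤ) : ℝ))

/-- `ψ^† η̂ φ`. -/
def herm (ψ φ : Spinor) : ℂ := star ψ ⬝ᵥ (etaHat *ᵥ φ)

/-- `D ψ = γ^α ∇_α ψ` with `∇_α ψ = ∂_α ψ + θ_α ψ`. -/
def diracD (θ : Spacetime → Fin 4 → Mat) (ψ : Spacetime → Spinor) (x : Spacetime) : Spinor :=
  ∑ α, gammaUp α *ᵥ (pd α ψ x + θ x α *ᵥ ψ x)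

/-- The Dirac Lagrangian `L_K = (½ ψ^† η̂ Dψ + c.c. - m ψ^† η̂ ψ) ω`. -/
def LK (m : ℝ) (θ : Spacetime → Fin 4 → Mat) (ψ : Spacetime → Spinor) (x : Spacetime) : ℂ :=
  ((1 / 2) * herm (ψ x) (diracD θ ψ x) + star ((1 / 2) * herm (ψ x) (diracD θ ψ x))
    - m * herm (ψ x) (ψ x)) * omega

/-- The curvature `Ω_{αβ} = ∂_α θ_β - ∂_β θ_α + θ_α θ_β - θ_β θ_α`. -/
def curvature (θ : Spacetime → Fin 4 → Mat) (α β : Fin 4) (x : Spacetime) : Mat :=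
  pdMat α (fun y => θ y β) x - pdMat β (fun y => θ y α) x + θ x α * θ x β - θ x β * θ x α

/-- `½ ω tr (Ω_{αβ} Ω^{αβ})`. -/
def halfTrace (θ : Spacetime → Fin 4 → Mat) (x : Spacetime) : ℂ :=
  (1 / 2) * omega * ∑ α, ∑ β,
    Matrix.trace (curvature θ α β x * (((sg α : ℂ) * (sg β : ℂ)) • curvature θ α β x))

/-- The curvature Lagrangian `L_V = ½ ω tr (Ω_{αβ} Ω^{αβ}) + c.c.` -/
def LV (θ : Spacetime → Fin 4 → Mat) (x : Spacetime) : ℂ :=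
  halfTrace θ x + star (halfTrace θ x)

/-- The total Lagrangian `L = L_K - τ L_V`. -/
def Ltot (m τ : ℝ) (ψ : Spacetime → Spinor) (θ : Spacetime → Fin 4 → Mat) (x : Spacetime) : ℂ :=
  LK m θ ψ x - τ * LV θ x

/-- `q` is a stationary point of `∫ L` under smooth compactly supported variations `δ` with values
in `A`: the first variation vanishes over every compact region that contains the support of `δ`. -/
def IsStationaryAt {V : Type*} [NormedAddCommGroup V] [NormedSpace ℝ V] (A : Set V)
    (L : (Spacetime → V) → Spacetime → ℂ) (q : Spacetime → V) : Prop :=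
  ∀ δ : Spacetime → V, ContDiff ℝ ∞ δ → HasCompactSupport δ → (∀ x, δ x ∈ A) →
    ∀ K : Set Spacetime, IsCompact K → tsupport δ ⊆ K →
      HasDerivAt (fun ε : ℝ => ∫ x in K, L (fun y => q y + ε • δ y) x) 0 0

/-! Components of tensor fields, with upper and with lower indices -/

def up1 (B : Spacetime → Fin 4 → ℝ) (α : Fin 4) : Spacetime → ℝ := fun y => B y α

def low1 (B : Spacetime → Fin 4 → ℝ) (α : Fin 4) : Spacetime → ℝ := fun y => (sg α : ℝ) * B y α

def up2 (W : Spacetime → Fin 4 → Fin 4 → ℝ) (α β : Fin 4) : Spacetime → ℝ := fun y => W y α β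

def low2 (W : Spacetime → Fin 4 → Fin 4 → ℝ) (α β : Fin 4) : Spacetime → ℝ :=
  fun y => (sg α : ℝ) * (sg β : ℝ) * W y α β

def low3 (F : Spacetime → Fin 4 → Fin 4 → Fin 4 → ℝ) (α ρ σ : Fin 4) : Spacetime → ℝ :=
  fun y => (sg α : ℝ) * (sg ρ : ℝ) * (sg σ : ℝ) * F y α ρ σ

/-! Scalar field -/

def scalarPotential (ζ : ℝ) (φ : Spacetime → ℝ) (x : Spacetime) : ℝ :=
  -96 * Real.cos (2 * ζ) *
    ((∑ α, pdU α φ x * pd α φ x) + 8 * Real.cos (2 * ζ) * φ x ^ 4)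

def ScalarEquation (ζ τ : ℝ) (ψ : Spacetime → Spinor) (φ : Spacetime → ℝ) (x : Spacetime) :
    Prop :=
  ((box φ x - 16 * Real.cos (2 * ζ) * φ x ^ 3 : ℝ) : ℂ)
    = ((1 / (192 * τ * Real.cos (2 * ζ)) : ℝ) : ℂ) *
      herm (ψ x) ((∑ α, gammaUp α * expIJ ζ * theta [α]) *ᵥ ψ x)

/-! Vector field of the first type -/

/-- `ε_{αβρσ} ∂^α B^β ∂^ρ B^σ`. -/
def vectorDivTerm (B : Spacetime → Fin 4 → ℝ) (x : Spacetime) : ℝ :=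
  ∑ α, ∑ β, ∑ ρ, ∑ σ, (eps α β ρ σ : ℝ) * pdU α (up1 B β) x * pdU ρ (up1 B σ) x

def vectorPotential (ζ : ℝ) (B : Spacetime → Fin 4 → ℝ) (x : Spacetime) : ℝ :=
  -384 * (∑ α, low1 B α x * up1 B α x) ^ 2 * Real.cos (4 * ζ)
    - 256 * (∑ α, ∑ β, (up1 B α x * low1 B α x * pd β (up1 B β) x
        - up1 B α x * low1 B β x * pd α (up1 B β) x)) * Real.cos (3 * ζ)
    - 32 * (2 * (∑ α, ∑ β, pd α (up1 B β) x * pdU α (low1 B β) x)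
        + (∑ α, pd α (up1 B α) x) ^ 2) * Real.cos (2 * ζ)
    - 32 * vectorDivTerm B x * Real.sin (2 * ζ)

def VectorEquation (ζ τ : ℝ) (ψ : Spacetime → Spinor) (B : Spacetime → Fin 4 → ℝ)
    (x : Spacetime) : Prop :=
  ∀ α, ((box (low1 B α) x + (1 / 2) * ∑ β, pd α (pd β (up1 B β)) x
      + 6 * Real.cos (3 * ζ) / Real.cos (2 * ζ) *
        ∑ β, (low1 B β x * pd α (up1 B β) x - low1 B α x * pd β (up1 B β) x)
      - 12 * Real.cos (4 * ζ) / Real.cos (2 * ζ) *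
        (∑ β, low1 B β x * up1 B β x) * low1 B α x : ℝ) : ℂ)
    = ((1 / (128 * τ * Real.cos (2 * ζ)) : ℝ) : ℂ) *
      herm (ψ x) ((∑ β, gammaUp β * expJ ζ * theta [β, α]) *ᵥ ψ x)

/-! Vector field of the second type -/

def imVectorPotential (ζ : ℝ) (A : Spacetime → Fin 4 → ℝ) (x : Spacetime) : ℝ :=
  -32 * Real.cos (2 * ζ) *
    ((∑ α, ∑ β, pd α (up1 A β) x * pdU α (low1 A β) x)
      - ∑ α, ∑ β, pd α (up1 A β) x * pd β (up1 A α) x)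

def ImVectorEquation (ζ τ : ℝ) (ψ : Spacetime → Spinor) (A : Spacetime → Fin 4 → ℝ)
    (x : Spacetime) : Prop :=
  ∀ α, ((box (low1 A α) x - ∑ β, pd α (pd β (up1 A β)) x : ℝ) : ℂ)
    = Complex.I * ((1 / (64 * τ * Real.cos (2 * ζ)) : ℝ) : ℂ) *
      herm (ψ x) ((gamma α * expJ ζ) *ᵥ ψ x)

/-! Antisymmetric tensor field -/

def antisymPotential (ζ : ℝ) (W : Spacetime → Fin 4 → Fin 4 → ℝ) (x : Spacetime) : ℝ :=
  1024 * Real.cos (2 * ζ) ^ 2 *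
      ((∑ α, ∑ β, ∑ ρ, ∑ σ,
          up2 W α β x * low2 W β ρ x * up2 W ρ σ x * low2 W σ α x)
        - (∑ α, ∑ β, up2 W α β x * low2 W α β x) ^ 2)
    + 64 * Real.cos (2 * ζ) *
      ((∑ α, ∑ ρ, ∑ σ, pd α (up2 W ρ σ) x * pdU α (low2 W ρ σ) x)
        + 2 * ∑ α, (∑ β, pd β (up2 W α β) x) * (∑ σ, pdU σ (low2 W α σ) x))

def AntisymEquation (ζ τ : ℝ) (ψ : Spacetime → Spinor) (W : Spacetime → Fin 4 → Fin 4 → ℝ)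
    (x : Spacetime) : Prop :=
  ∀ α β, ((box (low2 W α β) x
      - (∑ σ, pd α (pdU σ (low2 W β σ)) x) + (∑ σ, pd β (pdU σ (low2 W α σ)) x)
      + 32 * Real.cos (2 * ζ) *
        ((∑ ρ, ∑ σ, low2 W α ρ x * up2 W ρ σ x * low2 W σ β x)
          + (∑ ρ, ∑ σ, up2 W ρ σ x * low2 W ρ σ x) * low2 W α β x) : ℝ) : ℂ)
    = Complex.I * ((1 / (128 * τ * Real.cos (2 * ζ)) : ℝ) : ℂ) *
      herm (ψ x) ((∑ ν, gammaUp ν *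
        ((Real.sin ζ : ℂ) • 1 + (Complex.I * (Real.cos ζ : ℂ)) • calJ) *
          theta [ν, α, β]) *ᵥ ψ x)

/-! Symmetric contraction-free tensor field -/

def symPotential (ζ : ℝ) (S : Spacetime → Fin 4 → Fin 4 → ℝ) (x : Spacetime) : ℝ :=
  64 * Real.cos (2 * ζ) ^ 2 *
      ((∑ α, ∑ β, ∑ ρ, ∑ σ,
          up2 S α β x * low2 S β ρ x * up2 S ρ σ x * low2 S σ α x)
        - (∑ α, ∑ β, up2 S α β x * low2 S α β x) ^ 2)
    - 32 * Real.cos (2 * ζ) *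
      ((∑ α, ∑ β, ∑ ρ, pd α (up2 S β ρ) x * pdU α (low2 S β ρ) x)
        - ∑ α, ∑ β, ∑ ρ, pdU α (up2 S β ρ) x * pd β (low2 S α ρ) x)

/-- In this definition `S_μ^ν S_ν^σ S_σ^μ` is written with `S_μ^ν = η_{μμ} S^{μν}`. -/
def SymEquation (ζ τ : ℝ) (ψ : Spacetime → Spinor) (S : Spacetime → Fin 4 → Fin 4 → ℝ)
    (x : Spacetime) : Prop :=
  ∀ α β, ((box (low2 S α β) x
      - (1 / 2) * (∑ μ, pd α (pdU μ (low2 S μ β)) x)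
      - (1 / 2) * (∑ μ, pd β (pdU μ (low2 S μ α)) x)
      + (1 / 4) * (eta α β : ℝ) * (∑ μ, ∑ ν, pd μ (pd ν (up2 S μ ν)) x)
      + 4 * Real.cos (2 * ζ) *
        ((∑ μ, ∑ ν, low2 S α μ x * up2 S μ ν x * low2 S ν β x)
          - (∑ μ, ∑ ν, up2 S μ ν x * low2 S μ ν x) * low2 S α β x
          - (1 / 4) * (eta α β : ℝ) *
            ∑ μ, ∑ ν, ∑ σ, ((sg μ : ℝ) * up2 S μ ν x) * ((sg ν : ℝ) * up2 S ν σ x) *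
              ((sg σ : ℝ) * up2 S σ μ x)) : ℝ) : ℂ)
    = ((1 / (128 * τ * Real.cos (2 * ζ)) : ℝ) : ℂ) *
      herm (ψ x) ((expIJ ζ * (gamma α * theta [β] + gamma β * theta [α]
        - ((1 / 2 : ℂ) * (eta α β : ℂ)) • ∑ μ, gammaUp μ * theta [μ])) *ᵥ ψ x)

/-! Fierz tensor field -/

/-- `F_{αβρσ} = ∂_α F_{βρσ} - ∂_β F_{αρσ} + 4 (F_{αρ}^ν F_{βνσ} - F_{βρ}^ν F_{ανσ})`. -/
def fierzStrength (F : Spacetime → Fin 4 → Fin 4 → Fin 4 → ℝ) (α β ρ σ : Fin 4)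
    (x : Spacetime) : ℝ :=
  pd α (low3 F β ρ σ) x - pd β (low3 F α ρ σ) x
    + 4 * ∑ ν, (sg ν : ℝ) * (low3 F α ρ ν x * low3 F β ν σ x - low3 F β ρ ν x * low3 F α ν σ x)

/-- `-32 F_{αβρσ} F^{αβρσ}`. -/
def fierzPotential (F : Spacetime → Fin 4 → Fin 4 → Fin 4 → ℝ) (x : Spacetime) : ℝ :=
  -32 * ∑ α, ∑ β, ∑ ρ, ∑ σ, fierzStrength F α β ρ σ x *
    ((sg α : ℝ) * (sg β : ℝ) * (sg ρ : ℝ) * (sg σ : ℝ) * fierzStrength F α β ρ σ x)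

/-- The tensor `ξ̃_{αρσ}`; raised indices are written as lowered ones with a factor `sg`. -/
def xiTilde (F : Spacetime → Fin 4 → Fin 4 → Fin 4 → ℝ) (α ρ σ : Fin 4) (x : Spacetime) : ℝ :=
  8 * (2 * (∑ β, ∑ ν, ((sg β : ℝ) * (sg ν : ℝ) * low3 F β ν ρ x) * pd β (low3 F α σ ν) x)
      + (∑ β, ∑ ν, ((sg β : ℝ) * (sg ν : ℝ) * low3 F β ν ρ x) * pd α (low3 F β ν σ) x)
      + ∑ β, ∑ ν, ((sg ν : ℝ) * low3 F α ρ ν x) * ((sg β : ℝ) * pd β (low3 F β σ ν) x))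
    - 32 * ((∑ β, ∑ μ, ∑ ν, low3 F β ρ μ x * ((sg μ : ℝ) * (sg ν : ℝ) * low3 F α μ ν x) *
          ((sg β : ℝ) * low3 F β ν σ x))
      - ∑ β, ∑ μ, ∑ ν, low3 F β ρ μ x *
          ((sg β : ℝ) * (sg μ : ℝ) * (sg ν : ℝ) * low3 F β μ ν x) * low3 F α ν σ x)
    + box (low3 F α ρ σ) x
    - ∑ β, (sg β : ℝ) * pd β (pd α (low3 F β ρ σ)) x

/-- `ξ_{αρσ} = ½ (ξ̃_{αρσ} - ξ̃_{ασρ})`. -/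
def xi (F : Spacetime → Fin 4 → Fin 4 → Fin 4 → ℝ) (α ρ σ : Fin 4) (x : Spacetime) : ℝ :=
  (1 / 2) * (xiTilde F α ρ σ x - xiTilde F α σ ρ x)

/-- `χ_{αρσ} = (128 τ)⁻¹ ψ^† η̂ γ_α Θ_{ρσ} ψ`. -/
def chi (τ : ℝ) (ψ : Spacetime → Spinor) (α ρ σ : Fin 4) (x : Spacetime) : ℂ :=
  ((1 / (128 * τ) : ℝ) : ℂ) * herm (ψ x) ((gamma α * theta [ρ, σ]) *ᵥ ψ x)

/-- `ξ_{αρσ} - ⅓ η_{αρ} ξ^β_{βσ} + ⅓ η_{ασ} ξ^β_{βρ} - ⅙ ε_{αρσω} ε^{λμνω} ξ_{λμν}`. -/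
def fierzProj (X : Fin 4 → Fin 4 → Fin 4 → ℂ) (α ρ σ : Fin 4) : ℂ :=
  X α ρ σ - (1 / 3) * (eta α ρ : ℂ) * (∑ β, (sg β : ℂ) * X β β σ)
    + (1 / 3) * (eta α σ : ℂ) * (∑ β, (sg β : ℂ) * X β β ρ)
    - (1 / 6) * ∑ l, ∑ μ, ∑ ν, ∑ w, (eps α ρ σ w : ℂ) * (eps l μ ν w : ℂ) * X l μ ν

def FierzEquation (τ : ℝ) (ψ : Spacetime → Spinor)
    (F : Spacetime → Fin 4 → Fin 4 → Fin 4 → ℝ) (x : Spacetime) : Prop :=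
  ∀ α ρ σ, fierzProj (fun a r s => ((xi F a r s x : ℝ) : ℂ)) α ρ σ
    = fierzProj (fun a r s => chi τ ψ a r s x) α ρ σ

end ForceField

end

open ForceField

namespace ForceField

/-! Right multiplications in the Clifford algebra -/

/-! All six cases reduce to one matrix algebra and one variational computation.

Algebra. The matrices Θ_I are products of the right multiplications R_α in the Clifford algebra
(`cliff`). These commute with every γ and satisfy R_α R_β + R_β R_α = -2η_{αβ}. Thus Θ_α = R_α,
Θ_{αβ} = R_β R_α for α ≠ β (`theta_cons`), and 𝒥 is the product of all four R_α. It squares to -1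
and anticommutes with each R_α. Consequently a three-index Θ is a signed 𝒥 R_μ (`theta_triple`), and
𝒥 acts on two-index Θ as the Hodge dual (`calJ_mul_theta_pair`). The R_α are anti-self-adjoint for
η̂, which puts all required combinations into the real space `forceMat`.

Variation. In each case θ = T q with T real-linear, so the curvature is quadratic in the field and
linear in its first derivatives, and the action along q + εδ is a polynomial of degree at most four
in ε. Its linear coefficient is computed using cyclicity of the trace and integration by parts: a
divergence drops out, and the source plus 2τ times the covariant divergence of the curvature (plus
conjugate) remains. Testing with δ = g v, for g a bump function and v a fixed value, gives
`isStationaryAt_iff`: stationarity means that the pairing `eulerLagrange` vanishes at every point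
for all v of the given algebraic type. The rest is pointwise algebra in q and its derivatives.

Traces. Three patterns occur. For the scalar, antisymmetric and symmetric fields, θ_α is a
combination of (cos ζ + i sin ζ 𝒥) R_μ; these satisfy Clifford relations scaled by cos 2ζ
(`cliffVec_anticomm`), and traces of three of them vanish, so L_V has no cubic part. For the first
vector field and the Fierz field, θ_α is a combination of the Θ_{ρσ}, which close under commutators
like the Lorentz Lie algebra (`thetaTensor_comm`); for the vector, e^{ζ𝒥} mixes a tensor with its
dual and produces cos 2ζ, cos 3ζ, cos 4ζ. The second vector field is abelian, and its curvature is a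
curl.

Reading off the equations. A constrained v detects only the part of the coefficient of its own type:
the symmetric trace-free part (`forall_symTraceless_iff`), the antisymmetric part
(`forall_antisym_iff`), or the Fierz projection (`forall_fierz_iff`). -/

theorem rcoef_anticomm (α β : Fin 4) (I : MultiIndex) :
    rcoef α (symmDiff I {β}) * rcoef β I + rcoef β (symmDiff I {α}) * rcoef α I
      = if α = β then -2 * sg α else 0 := by
  revert α β I
  decide +kernel

/-- Toggling α and β in an index set commutes, so both products send a basis vector to multiples of
the same one, and only the coefficients need comparison. The right multiplications thus form a
second set of Clifford generators. -/
theorem rightZ_anticomm (α β : Fin 4) :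
    rightZ α * rightZ β + rightZ β * rightZ α = (-2 * eta α β) • 1 := by
  refine mat_ext_single fun I => ?_
  rw [Matrix.add_mulVec, ← Matrix.mulVec_mulVec, ← Matrix.mulVec_mulVec, rightZ_mulVec_single,
    rightZ_mulVec_single, rightZ_mulVec_single, rightZ_mulVec_single, Matrix.smul_mulVec,
    Matrix.one_mulVec, symmDiff_right_comm I {α} {β}, ← Pi.single_add, ← Pi.single_smul]
  have h := rcoef_anticomm α β I
  by_cases hab : α = β
  · subst hab
    simp only [if_true] at h
    rw [symmDiff_symmDiff_cancel_right]
    congr 1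
    simp only [eta, Matrix.diagonal_apply_eq, smul_eq_mul]
    linarith
  · rw [if_neg hab] at h
    simp only [mul_one, h, eta, Matrix.diagonal_apply_ne _ hab]
    simp

/-- Right multiplication by `e_α` in the Clifford algebra. -/
noncomputable def cliff (α : Fin 4) : Mat := (rightZ α).map (Int.cast : ℤ → ℂ)

theorem map_mul_int (A B : Matrix MultiIndex MultiIndex ℤ) :
    (A * B).map (Int.cast : ℤ → ℂ) = A.map Int.cast * B.map Int.cast :=
  Matrix.map_mul (f := Int.castRingHom ℂ)

theorem cliff_anticomm (α β : Fin 4) :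
    cliff α * cliff β + cliff β * cliff α = (-2 * (eta α β : ℂ)) • 1 := by
  rw [cliff, cliff, ← map_mul_int, ← map_mul_int, ← Matrix.map_add _ Int.cast_add,
    rightZ_anticomm]
  ext I J
  simp only [Matrix.map_apply, Matrix.smul_apply, Matrix.one_apply, smul_eq_mul]
  split_ifs <;> simp

theorem gamma_mul_cliff (α β : Fin 4) : gamma α * cliff β = cliff β * gamma α := by
  rw [cliff, gamma, ← map_mul_int, ← map_mul_int, (gammaZ_commute_rightZ α β).eq]

theorem iotaZ_eq_zero : ∀ (α : Fin 4) (I K : MultiIndex), α ∉ I → iotaZ α K I = 0 := by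
  decide +kernel

theorem wedgeZ_mulVec_single (α : Fin 4) (I : MultiIndex) (c : ℤ) :
    wedgeZ α *ᵥ Pi.single I c
      = if α ∈ I then 0 else Pi.single (insert α I) ((-1) ^ pos α I * c) := by
  ext K
  by_cases h : α ∈ I
  · simp [wedgeZ, h]
  · by_cases hK : K = insert α I <;> simp [wedgeZ, h, hK]

theorem basisVec_cons (α : Fin 4) (L : List (Fin 4)) :
    basisVec (α :: L) = wedgeZ α *ᵥ basisVec L := rfl

theorem exists_basisVec_eq_single (L : List (Fin 4)) :
    ∃ c, basisVec L = Pi.single L.toFinset c := by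
  induction L with
  | nil => exact ⟨1, rfl⟩
  | cons α L ih =>
    obtain ⟨c, hc⟩ := ih
    rw [basisVec_cons, hc, wedgeZ_mulVec_single, List.toFinset_cons]
    split_ifs
    · exact ⟨0, by simp⟩
    · exact ⟨_, rfl⟩

/-- `vacuum` is the unit of the Clifford algebra, where left and right multiplication coincide. This
connects right multiplications with the defining property of Θ. -/
theorem rightZ_vacuum (α : Fin 4) : rightZ α *ᵥ vacuum = gammaZ α *ᵥ vacuum := by
  rw [vacuum, rightZ_mulVec_single, gammaZ_mulVec_single]
  congr 1

/-- Both sides commute with all γ, so it suffices to compare them on e_∅. There Θ_L R_α e_∅ = Θ_L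
γ_α e_∅ = γ_α e_L, and ι_α kills e_L because α is not in L. The order of the factors is reversed
relative to the multi-index. -/
theorem thetaZ_cons {α : Fin 4} {L : List (Fin 4)} (h : α ∉ L) :
    thetaZ (α :: L) = thetaZ L * rightZ α := by
  obtain ⟨h1, h2⟩ := thetaZ_spec L
  refine (eq_thetaZ (fun β => (h1 β).mul_right (gammaZ_commute_rightZ β α)) ?_).symm
  obtain ⟨c, hc⟩ := exists_basisVec_eq_single L
  rw [← Matrix.mulVec_mulVec, rightZ_vacuum, Matrix.mulVec_mulVec, ← (h1 α).eq,
    ← Matrix.mulVec_mulVec, h2, basisVec_cons, gammaZ, Matrix.sub_mulVec, sub_eq_self, hc]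
  ext K
  simp [iotaZ_eq_zero α L.toFinset K (by simpa using h)]

theorem thetaZ_eq_zero {L : List (Fin 4)} (h : basisVec L = 0) : thetaZ L = 0 :=
  (eq_thetaZ (fun _ => Commute.zero_right _) (by rw [h, Matrix.zero_mulVec])).symm

theorem basisVec_cons_of_mem {α : Fin 4} {L : List (Fin 4)} (h : α ∈ L) :
    basisVec (α :: L) = 0 := by
  obtain ⟨c, hc⟩ := exists_basisVec_eq_single L
  rw [basisVec_cons, hc, wedgeZ_mulVec_single, if_pos (by simpa using h)]

theorem basisVec_cons_of_eq_zero {α : Fin 4} {L : List (Fin 4)} (h : basisVec L = 0) :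
    basisVec (α :: L) = 0 := by
  rw [basisVec_cons, h, Matrix.mulVec_zero]

theorem basisVec_of_not_nodup {L : List (Fin 4)} (h : ¬ L.Nodup) : basisVec L = 0 := by
  induction L with
  | nil => simp at h
  | cons α L ih =>
    by_cases hα : α ∈ L
    · exact basisVec_cons_of_mem hα
    · exact basisVec_cons_of_eq_zero (ih fun hL => h (List.nodup_cons.2 ⟨hα, hL⟩))

/-- The wedge product with a repeated factor is zero, and an element of the commutant is determined
by its value on e_∅. -/
theorem theta_of_not_nodup {L : List (Fin 4)} (h : ¬ L.Nodup) : theta L = 0 := by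
  rw [theta, thetaZ_eq_zero (basisVec_of_not_nodup h)]
  ext; simp

theorem theta_cons {α : Fin 4} {L : List (Fin 4)} (h : α ∉ L) :
    theta (α :: L) = theta L * cliff α := by
  rw [theta, thetaZ_cons h, map_mul_int]
  rfl

theorem theta_nil : theta [] = 1 := by
  rw [theta, ← eq_thetaZ (T := 1) (fun _ => Commute.one_right _) (by rw [Matrix.one_mulVec]; rfl)]
  ext I J
  simp only [Matrix.map_apply, Matrix.one_apply]
  split_ifs <;> simp

theorem theta_single (α : Fin 4) : theta [α] = cliff α := by
  rw [theta_cons (by simp), theta_nil, Matrix.one_mul]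

theorem theta_pair {α β : Fin 4} (h : α ≠ β) : theta [α, β] = cliff β * cliff α := by
  rw [theta_cons (by simpa using h), theta_single]

theorem theta_self (α : Fin 4) : theta [α, α] = 0 := theta_of_not_nodup (by simp)

theorem calJ_eq : calJ = cliff 3 * cliff 2 * cliff 1 * cliff 0 := by
  rw [calJ, theta_cons (by decide), theta_cons (by decide), theta_cons (by decide), theta_single]


/-! ### Words in the right multiplications, the Levi-Civita symbol and duality -/

/-- A word in the right multiplications, acting on a basis vector. -/
def wordAct (L : List (Fin 4)) (I : MultiIndex) : MultiIndex × ℤ :=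
  L.foldr (fun α p => (symmDiff p.1 {α}, rcoef α p.1 * p.2)) (I, 1)

theorem word_mulVec_single (L : List (Fin 4)) (I : MultiIndex) :
    (L.map rightZ).prod *ᵥ Pi.single I 1 = Pi.single (wordAct L I).1 (wordAct L I).2 := by
  induction L with
  | nil => rw [List.map_nil, List.prod_nil, Matrix.one_mulVec]; rfl
  | cons a L ih =>
    rw [List.map_cons, List.prod_cons, ← Matrix.mulVec_mulVec, ih, rightZ_mulVec_single]
    rfl

theorem map_word (L : List (Fin 4)) :
    (L.map rightZ).prod.map (Int.cast : ℤ → ℂ) = (L.map cliff).prod := by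
  induction L with
  | nil => simp
  | cons a L ih => rw [List.map_cons, List.prod_cons, map_mul_int, ih, List.map_cons,
      List.prod_cons, cliff]

/-- A word in the R_α is a signed permutation of the basis, so an identity between words is a finite
check of index sets and integers, within reach of `decide`, with no matrix product evaluated. -/
theorem word_eq {L L' : List (Fin 4)} {s : ℤ}
    (h : ∀ I, (wordAct L I).1 = (wordAct L' I).1 ∧ (wordAct L I).2 = s * (wordAct L' I).2) :
    (L.map cliff).prod = (s : ℂ) • (L'.map cliff).prod := by
  have : (L.map rightZ).prod = s • (L'.map rightZ).prod := by
    refine mat_ext_single fun I => ?_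
    rw [Matrix.smul_mulVec, word_mulVec_single, word_mulVec_single, (h I).1, (h I).2,
      ← Pi.single_smul, smul_eq_mul]
  rw [← map_word, ← map_word, this]
  ext I J
  simp only [Matrix.map_apply, Matrix.smul_apply, smul_eq_mul, Int.cast_mul]

/-- Of the four factors of 𝒥, three anticommute with R_μ and one commutes with it; the resulting
sign is confirmed on basis vectors. -/
theorem calJ_mul_cliff (μ : Fin 4) : calJ * cliff μ = -(cliff μ * calJ) := by
  have h := word_eq (L := [3, 2, 1, 0, μ]) (L' := [μ, 3, 2, 1, 0]) (s := -1)
    (by revert μ; decide +kernel)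
  simpa [calJ_eq, mul_assoc] using h

theorem calJ_mul_calJ : calJ * calJ = -1 := by
  have h := word_eq (L := [3, 2, 1, 0, 3, 2, 1, 0]) (L' := []) (s := -1) (by decide +kernel)
  simpa [calJ_eq, mul_assoc] using h

/-- The right side is a Vandermonde product, alternating in its arguments, with value 12 at (0, 1,
2, 3). It replaces the determinant by a polynomial, so that symmetries of ε follow by `ring` and
numerical values are cheap. -/
theorem eps_eq : ∀ α β ρ σ : Fin 4, 12 * eps α β ρ σ =
    ((β : ℤ) - α) * (ρ - α) * (σ - α) * (ρ - β) * (σ - β) * (σ - ρ) := by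
  decide +kernel

theorem theta_triple_of_ne {α ρ σ : Fin 4} (h1 : α ≠ ρ) (h2 : α ≠ σ) (h3 : ρ ≠ σ) :
    theta [α, ρ, σ] = cliff σ * cliff ρ * cliff α := by
  rw [theta_cons (by simp [h1, h2]), theta_pair h3]

theorem eps_eq_zero {α β ρ σ : Fin 4}
    (h : α = β ∨ α = ρ ∨ α = σ ∨ β = ρ ∨ β = σ ∨ ρ = σ) : eps α β ρ σ = 0 := by
  have := eps_eq α β ρ σ
  rcases h with h | h | h | h | h | h <;> subst h <;> simpa using this

/-- The finite check behind `theta_triple`. The factor 12 and the product of differences stand for ε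
through `eps_eq`, which spares `decide` the determinants. -/
theorem word_triple_spec : ∀ α ρ σ μ : Fin 4,
    α ≠ ρ → α ≠ σ → α ≠ μ → ρ ≠ σ → ρ ≠ μ → σ ≠ μ → ∀ I,
    (wordAct [σ, ρ, α] I).1 = (wordAct [3, 2, 1, 0, μ] I).1 ∧
      12 * (wordAct [σ, ρ, α] I).2 =
        sg μ * (((ρ : ℤ) - α) * (σ - α) * (μ - α) * (σ - ρ) * (μ - ρ) * (μ - σ)) *
          (wordAct [3, 2, 1, 0, μ] I).2 := by
  decide +kernel

theorem exists_fourth : ∀ α ρ σ : Fin 4, ∃ μ : Fin 4, α ≠ μ ∧ ρ ≠ μ ∧ σ ≠ μ ∧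
    (α ≠ ρ → α ≠ σ → ρ ≠ σ → ∀ ν, ν ≠ μ → α = ν ∨ ρ = ν ∨ σ = ν) := by
  decide +kernel

/-- For distinct indices only the missing fourth index μ survives in the sum, and the word check
fixes the sign; for repeated indices both sides vanish. This is what places the antisymmetric field
in the span of the 𝒥-rotated R_μ. -/
theorem theta_triple (α ρ σ : Fin 4) :
    theta [α, ρ, σ] = ∑ μ, ((sg μ : ℂ) * (eps α ρ σ μ : ℂ)) • (calJ * cliff μ) := by
  by_cases h : α ≠ ρ ∧ α ≠ σ ∧ ρ ≠ σ
  · obtain ⟨h1, h2, h3⟩ := h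
    obtain ⟨μ, h4, h5, h6, h7⟩ := exists_fourth α ρ σ
    rw [Finset.sum_eq_single μ]
    · have h8 := word_eq (L := [σ, ρ, α]) (L' := [3, 2, 1, 0, μ]) (s := sg μ * eps α ρ σ μ)
        (fun I => by
          obtain ⟨h9, h10⟩ := word_triple_spec α ρ σ μ h1 h2 h4 h3 h5 h6 I
          refine ⟨h9, ?_⟩
          rw [← eps_eq] at h10
          linarith)
      rw [theta_triple_of_ne h1 h2 h3]
      simpa [calJ_eq, mul_assoc] using h8
    · intro ν _ hν
      have := h7 h1 h2 h3 ν hν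
      rw [eps_eq_zero (by tauto)]
      simp
    · simp
  · rw [theta_of_not_nodup (by simp; tauto)]
    refine (Finset.sum_eq_zero fun μ _ => ?_).symm
    rw [eps_eq_zero (by tauto)]
    simp

theorem word_pair_spec : ∀ α β ρ σ : Fin 4,
    α ≠ β → α ≠ ρ → α ≠ σ → β ≠ ρ → β ≠ σ → ρ ≠ σ → ∀ I,
    (wordAct [3, 2, 1, 0, β, α] I).1 = (wordAct [σ, ρ] I).1 ∧
      12 * (wordAct [3, 2, 1, 0, β, α] I).2 =
        sg ρ * sg σ * (((β : ℤ) - α) * (ρ - α) * (σ - α) * (ρ - β) * (σ - β) * (σ - ρ)) *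
          (wordAct [σ, ρ] I).2 := by
  decide +kernel

theorem calJ_mul_theta_pair_of_ne {α β ρ σ : Fin 4} (h1 : α ≠ β) (h2 : α ≠ ρ) (h3 : α ≠ σ)
    (h4 : β ≠ ρ) (h5 : β ≠ σ) (h6 : ρ ≠ σ) :
    calJ * theta [α, β] = ((sg ρ * sg σ * eps α β ρ σ : ℤ) : ℂ) • theta [ρ, σ] := by
  have h8 := word_eq (L := [3, 2, 1, 0, β, α]) (L' := [σ, ρ]) (s := sg ρ * sg σ * eps α β ρ σ)
    (fun I => by
      obtain ⟨h9, h10⟩ := word_pair_spec α β ρ σ h1 h2 h3 h4 h5 h6 I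
      refine ⟨h9, ?_⟩
      rw [← eps_eq] at h10
      linarith)
  rw [theta_pair h1, theta_pair h6]
  simpa [calJ_eq, mul_assoc] using h8

theorem theta_swap (α β : Fin 4) : theta [β, α] = -theta [α, β] := by
  by_cases h : α = β
  · subst h
    simp [theta_self]
  · rw [theta_pair h, theta_pair (Ne.symm h), eq_neg_iff_add_eq_zero, cliff_anticomm, eta,
      Matrix.diagonal_apply_ne _ h]
    simp

theorem exists_complement : ∀ α β : Fin 4, α ≠ β → ∃ ρ σ : Fin 4,
    α ≠ ρ ∧ α ≠ σ ∧ β ≠ ρ ∧ β ≠ σ ∧ ρ ≠ σ ∧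
    ∀ κ, κ ≠ ρ → κ ≠ σ → α = κ ∨ β = κ := by
  decide +kernel

/-- Multiplication by `𝒥` is the Hodge dual on two-index theta matrices. -/
theorem calJ_mul_theta_pair (α β : Fin 4) :
    calJ * theta [α, β] =
      ∑ ρ, ∑ σ, ((1 / 2 : ℂ) * (sg ρ * sg σ * eps α β ρ σ)) • theta [ρ, σ] := by
  by_cases h : α = β
  · subst h
    rw [theta_self, mul_zero]
    refine (Finset.sum_eq_zero fun ρ _ => Finset.sum_eq_zero fun σ _ => ?_).symm
    rw [eps_eq_zero (by tauto)]
    simp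
  · obtain ⟨ρ, σ, h2, h3, h4, h5, h6, h7⟩ := exists_complement α β h
    have key : ∀ κ l, (κ ≠ ρ ∧ κ ≠ σ) ∨ (l ≠ ρ ∧ l ≠ σ) ∨ κ = l →
        ((1 / 2 : ℂ) * (sg κ * sg l * eps α β κ l)) • theta [κ, l] = 0 := by
      intro κ l hk
      rw [eps_eq_zero]
      · simp
      · rcases hk with hk | hk | hk
        · have := h7 κ hk.1 hk.2
          tauto
        · have := h7 l hk.1 hk.2
          tauto
        · tauto
    have hes : (eps α β σ ρ : ℂ) = -(eps α β ρ σ : ℂ) := by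
      have e1 := eps_eq α β σ ρ
      have e2 := eps_eq α β ρ σ
      have : eps α β σ ρ = -eps α β ρ σ := by linarith
      rw [this]
      push_cast
      rfl
    -- Only the two orders of the complementary pair contribute. They agree, since ε and Θ both
    -- change sign, and this absorbs the factor 1/2.
    rw [Finset.sum_eq_add ρ σ h6]
    · rw [Finset.sum_eq_single σ, Finset.sum_eq_single ρ,
        calJ_mul_theta_pair_of_ne h h2 h3 h4 h5 h6, theta_swap ρ σ, hes, smul_neg, ← neg_smul,
        ← add_smul]
      · congr 1
        push_cast
        ring
      · intro l _ hl
        by_cases hl' : σ = l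
        · exact key _ _ (by tauto)
        · exact key _ _ (by tauto)
      · simp
      · intro l _ hl
        by_cases hl' : ρ = l
        · exact key _ _ (by tauto)
        · exact key _ _ (by tauto)
      · simp
    · intro κ _ hκ
      exact Finset.sum_eq_zero fun l _ => key _ _ (Or.inl hκ)
    · simp
    · simp

/-! Adjoints with respect to the Hermitian metric -/

theorem rightZ_adjoint : ∀ (α : Fin 4) (I J : MultiIndex),
    rightZ α J I * ∏ κ ∈ J, sg κ = -((∏ κ ∈ I, sg κ) * rightZ α I J) := by
  decide +kernel

theorem gammaZ_adjoint (α : Fin 4) (I J : MultiIndex) :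
    gammaZ α J I * ∏ κ ∈ J, sg κ = -((∏ κ ∈ I, sg κ) * gammaZ α I J) := by
  simp only [gammaZ_apply]
  revert α I J
  decide +kernel

/-- Since η̂ is diagonal and the entries are integers, anti-self-adjointness is an entry-wise
identity of integers. -/
theorem conjTranspose_map_mul_etaHat {A : Matrix MultiIndex MultiIndex ℤ}
    (h : ∀ I J, A J I * ∏ κ ∈ J, sg κ = -((∏ κ ∈ I, sg κ) * A I J)) :
    (A.map (Int.cast : ℤ → ℂ))ᴴ * etaHat = -(etaHat * A.map Int.cast) := by
  ext I J
  rw [etaHat_eq_diagonal, Matrix.mul_diagonal, Matrix.neg_apply, Matrix.diagonal_mul]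
  have := congrArg (Int.cast : ℤ → ℂ) (h I J)
  simpa using this

theorem cliff_adjoint (α : Fin 4) : (cliff α)ᴴ * etaHat = -(etaHat * cliff α) :=
  conjTranspose_map_mul_etaHat (rightZ_adjoint α)

theorem gamma_adjoint (α : Fin 4) : (gamma α)ᴴ * etaHat = -(etaHat * gamma α) :=
  conjTranspose_map_mul_etaHat (gammaZ_adjoint α)

theorem conjTranspose_mul_etaHat_mul {A A' B B' : Mat}
    (hA : Aᴴ * etaHat = etaHat * A') (hB : Bᴴ * etaHat = etaHat * B') :
    (A * B)ᴴ * etaHat = etaHat * (B' * A') := by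
  rw [Matrix.conjTranspose_mul, Matrix.mul_assoc, hA, ← Matrix.mul_assoc, hB, Matrix.mul_assoc]

theorem cliff_adjoint' (α : Fin 4) : (cliff α)ᴴ * etaHat = etaHat * -cliff α := by
  rw [cliff_adjoint, Matrix.mul_neg]

/-- The adjoint reverses the four factors and contributes four signs, which cancel. Reversing four
anticommuting factors takes six transpositions, so the product returns to 𝒥. -/
theorem calJ_adjoint : calJᴴ * etaHat = etaHat * calJ := by
  have h := conjTranspose_mul_etaHat_mul (conjTranspose_mul_etaHat_mul
    (conjTranspose_mul_etaHat_mul (cliff_adjoint' 3) (cliff_adjoint' 2)) (cliff_adjoint' 1))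
    (cliff_adjoint' 0)
  have h2 := word_eq (L := [0, 1, 2, 3]) (L' := [3, 2, 1, 0]) (s := 1) (by decide +kernel)
  rw [calJ_eq, h]
  simp only [List.map_cons, List.map_nil, List.prod_cons, List.prod_nil, mul_one, Int.cast_one,
    one_smul, ← mul_assoc] at h2
  rw [← h2]
  congr 1
  simp only [neg_mul, mul_neg, neg_neg, ← mul_assoc]

/-! ### The real space of force matrices, and reality of the coupling -/

/-- The matrices that may occur as components of a force tensor. -/
def forceMat : Submodule ℝ Mat where
  carrier := {A | Aᴴ * etaHat = -(etaHat * A) ∧ ∀ α, gamma α * A = A * gamma α}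
  zero_mem' := by simp
  add_mem' := by
    rintro A B ⟨h1, h2⟩ ⟨h3, h4⟩
    refine ⟨?_, fun α => ?_⟩
    · rw [Matrix.conjTranspose_add, Matrix.add_mul, h1, h3, Matrix.mul_add, neg_add]
    · rw [Matrix.mul_add, h2, h4, Matrix.add_mul]
  smul_mem' := by
    rintro r A ⟨h1, h2⟩
    refine ⟨?_, fun α => ?_⟩
    · rw [Matrix.conjTranspose_smul, Matrix.smul_mul, h1, Matrix.mul_smul, star_trivial, smul_neg]
    · rw [Matrix.mul_smul, h2, Matrix.smul_mul]

theorem mem_forceMat {A : Mat} :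
    A ∈ forceMat ↔ Aᴴ * etaHat = -(etaHat * A) ∧ ∀ α, gamma α * A = A * gamma α := Iff.rfl

/-- Raising the index of γ multiplies it by a nonzero sign, so the conditions separate into one
linear condition for each component. -/
theorem isForceTensor_iff {θ : Fin 4 → Mat} : IsForceTensor θ ↔ ∀ α, θ α ∈ forceMat := by
  have hsg : ∀ α, (sg α : ℂ) ≠ 0 := by
    intro α
    fin_cases α <;> simp [sg]
  simp only [IsForceTensor, mem_forceMat, forall_and, add_eq_zero_iff_eq_neg, gammaUp, sub_eq_zero,
    Matrix.smul_mul, Matrix.mul_smul]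
  refine and_congr Iff.rfl ⟨fun h α β => ?_, fun h α β => ?_⟩
  · exact smul_right_injective _ (hsg β) (h β α)
  · rw [h]

theorem gamma_mul_theta (α : Fin 4) (L : List (Fin 4)) :
    gamma α * theta L = theta L * gamma α :=
  ((eq_theta_iff L _).1 rfl).1 α

theorem gamma_mul_calJ (α : Fin 4) : gamma α * calJ = calJ * gamma α := gamma_mul_theta _ _

theorem cliff_mem : ∀ α, cliff α ∈ forceMat := fun α => ⟨cliff_adjoint α, fun β => gamma_mul_cliff β α⟩

/-- Taking the adjoint of R_β R_α gives two signs, which cancel, and reverses the order; the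
reversal supplies the required minus sign. -/
theorem theta_pair_mem (α β : Fin 4) : theta [α, β] ∈ forceMat := by
  refine ⟨?_, fun κ => gamma_mul_theta κ _⟩
  by_cases h : α = β
  · subst h
    simp [theta_self]
  · have := theta_swap α β
    rw [theta_pair h, theta_pair (Ne.symm h)] at this
    rw [theta_pair h, conjTranspose_mul_etaHat_mul (cliff_adjoint' β) (cliff_adjoint' α), neg_mul_neg,
      this, mul_neg]

theorem I_smul_mem {A : Mat} (h1 : Aᴴ * etaHat = etaHat * A)
    (h2 : ∀ α, gamma α * A = A * gamma α) : Complex.I • A ∈ forceMat := by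
  refine ⟨?_, fun α => ?_⟩
  · rw [Matrix.conjTranspose_smul, Matrix.smul_mul, h1, Matrix.mul_smul]
    simp
  · rw [Matrix.mul_smul, h2, Matrix.smul_mul]

theorem gamma_mul_mul {A B : Mat} (α : Fin 4) (h1 : gamma α * A = A * gamma α)
    (h2 : gamma α * B = B * gamma α) : gamma α * (A * B) = A * B * gamma α := by
  rw [← mul_assoc, h1, mul_assoc, h2, mul_assoc]

/-- The product 𝒥 R_μ is self-adjoint: the sign from R_μ cancels the sign from commuting it past 𝒥.
Hence the factor i in cos ζ + i sin ζ 𝒥. -/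
theorem I_calJ_cliff_mem (μ : Fin 4) : Complex.I • (calJ * cliff μ) ∈ forceMat := by
  refine I_smul_mem ?_ fun α => gamma_mul_mul α (gamma_mul_calJ α) (gamma_mul_cliff α μ)
  rw [conjTranspose_mul_etaHat_mul calJ_adjoint (cliff_adjoint' μ), calJ_mul_cliff, neg_mul]

theorem expIJ_mul (ζ : ℝ) (A : Mat) :
    expIJ ζ * A = Real.cos ζ • A + Real.sin ζ • (Complex.I • (calJ * A)) := by
  rw [expIJ, Matrix.add_mul, Matrix.smul_mul, Matrix.smul_mul, Matrix.one_mul, mul_comm Complex.I,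
    mul_smul, Complex.coe_smul, Complex.coe_smul]

theorem expJ_mul (ζ : ℝ) (A : Mat) :
    expJ ζ * A = Real.cos ζ • A + Real.sin ζ • (calJ * A) := by
  rw [expJ, Matrix.add_mul, Matrix.smul_mul, Matrix.smul_mul, Matrix.one_mul, Complex.coe_smul,
    Complex.coe_smul]

theorem expIJ_mul_cliff_mem (ζ : ℝ) (μ : Fin 4) : expIJ ζ * cliff μ ∈ forceMat := by
  rw [expIJ_mul]
  exact add_mem (Submodule.smul_mem _ _ (cliff_mem μ)) (Submodule.smul_mem _ _ (I_calJ_cliff_mem μ))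

theorem I_smul_expJ_mem (ζ : ℝ) : Complex.I • expJ ζ ∈ forceMat := by
  have h1 : Complex.I • (1 : Mat) ∈ forceMat :=
    I_smul_mem (by simp) (by simp)
  have h2 : Complex.I • calJ ∈ forceMat := I_smul_mem calJ_adjoint gamma_mul_calJ
  have h3 := expJ_mul ζ 1
  rw [mul_one, mul_one] at h3
  rw [h3, smul_add, smul_comm, smul_comm Complex.I (Real.sin ζ)]
  exact add_mem (Submodule.smul_mem _ _ h1) (Submodule.smul_mem _ _ h2)

/-- Here η̂M is a Hermitian matrix, so its quadratic form is real. -/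
theorem star_herm_mulVec {M : Mat} (h : Mᴴ * etaHat = etaHat * M) (v : Spinor) :
    star (herm v (M *ᵥ v)) = herm v (M *ᵥ v) := by
  have hη : etaHatᴴ = etaHat := by
    rw [etaHat_eq_diagonal, Matrix.diagonal_conjTranspose]
    congr 1
    ext I
    simp
  have h2 : (etaHat * M)ᴴ = etaHat * M := by rw [Matrix.conjTranspose_mul, hη, h]
  rw [herm, Matrix.mulVec_mulVec, ← Matrix.star_dotProduct, Matrix.star_mulVec, h2,
    ← Matrix.dotProduct_mulVec]

/-- Both γ^α and A are anti-self-adjoint and they commute, so their product is self-adjoint and the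
coupling is real. -/
theorem star_herm_gammaUp {A : Mat} (hA : A ∈ forceMat) (α : Fin 4) (v : Spinor) :
    star (herm v ((gammaUp α * A) *ᵥ v)) = herm v ((gammaUp α * A) *ᵥ v) := by
  refine star_herm_mulVec ?_ v
  have h1 : (gamma α)ᴴ * etaHat = etaHat * -gamma α := by rw [gamma_adjoint, mul_neg]
  have h2 : Aᴴ * etaHat = etaHat * -A := by rw [hA.1, mul_neg]
  have h3 := conjTranspose_mul_etaHat_mul h1 h2
  rw [neg_mul_neg, ← hA.2] at h3
  rw [gammaUp, Matrix.smul_mul, Matrix.conjTranspose_smul, Matrix.smul_mul, h3, Matrix.mul_smul]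
  simp

/-! Traces -/

/-- Since 𝒥² = -1, the trace of 𝒥A𝒥 is -tr A by cyclicity and +tr A by anticommutation. -/
theorem trace_eq_zero_of_calJ_anticomm {A : Mat} (h : calJ * A = -(A * calJ)) : A.trace = 0 := by
  have h1 : (calJ * A * calJ).trace = -A.trace := by
    rw [Matrix.trace_mul_comm, ← mul_assoc, calJ_mul_calJ, neg_one_mul, Matrix.trace_neg]
  rw [h, neg_mul, mul_assoc, calJ_mul_calJ, mul_neg_one, neg_neg] at h1
  linear_combination (1 / 2 : ℂ) * h1

theorem trace_calJ : calJ.trace = 0 := by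
  have h0 : cliff 0 * cliff 0 = -1 := by
    simpa using word_eq (L := [0, 0]) (L' := []) (s := -1) (by decide +kernel)
  have h1 : (cliff 0 * calJ * cliff 0).trace = -calJ.trace := by
    rw [Matrix.trace_mul_comm, ← mul_assoc, h0, neg_one_mul, Matrix.trace_neg]
  rw [mul_assoc, calJ_mul_cliff, mul_neg, ← mul_assoc, h0, neg_one_mul, neg_neg] at h1
  linear_combination (1 / 2 : ℂ) * h1

theorem trace_one_mat : (1 : Mat).trace = 16 := by
  rw [Matrix.trace_one]
  norm_num

theorem trace_mul_of_anticomm {a b : Mat} {z : ℂ} (h : a * b + b * a = z • 1) :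
    (a * b).trace = 8 * z := by
  have h1 := congrArg Matrix.trace h
  rw [Matrix.trace_add, Matrix.trace_mul_comm b a, Matrix.trace_smul, trace_one_mat,
    smul_eq_mul] at h1
  linear_combination (1 / 2 : ℂ) * h1

/-- Moving a through b, c and d produces the three contractions and -bcda, whose trace is minus the
original one by cyclicity; hence the trace is half the contracted terms. -/
theorem trace_four_of_anticomm {a b c d : Mat} {ab ac ad bc bd cd : ℂ}
    (hab : a * b + b * a = ab • 1) (hac : a * c + c * a = ac • 1) (had : a * d + d * a = ad • 1)
    (hbc : b * c + c * b = bc • 1) (hbd : b * d + d * b = bd • 1) (hcd : c * d + d * c = cd • 1) :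
    (a * b * (c * d)).trace = 4 * (ab * cd - ac * bd + ad * bc) := by
  have e1 : a * b * (c * d) = ab • (c * d) - ac • (b * d) + ad • (b * c) - b * c * d * a := by
    have h1 : a * b = ab • 1 - b * a := eq_sub_of_add_eq hab
    have h2 : a * c = ac • 1 - c * a := eq_sub_of_add_eq hac
    have h3 : a * d = ad • 1 - d * a := eq_sub_of_add_eq had
    rw [h1, sub_mul, smul_mul_assoc, one_mul, mul_assoc b a, ← mul_assoc a c d, h2, sub_mul,
      smul_mul_assoc, one_mul, mul_assoc c a d, h3, mul_sub, mul_sub, mul_sub]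
    simp only [mul_smul_comm, mul_one, ← mul_assoc]
    abel
  have e2 := congrArg Matrix.trace e1
  have e3 : (b * c * d * a).trace = (a * b * (c * d)).trace := by
    rw [Matrix.trace_mul_comm]
    simp only [mul_assoc]
  rw [Matrix.trace_sub, Matrix.trace_add, Matrix.trace_sub, Matrix.trace_smul, Matrix.trace_smul,
    Matrix.trace_smul, e3, trace_mul_of_anticomm hcd, trace_mul_of_anticomm hbd,
    trace_mul_of_anticomm hbc] at e2
  simp only [smul_eq_mul] at e2
  linear_combination (1 / 2 : ℂ) * e2

/-! Partial derivatives -/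

section PartialDerivatives

variable {E F : Type*} [NormedAddCommGroup E] [NormedSpace ℝ E] [NormedAddCommGroup F]
  [NormedSpace ℝ F]

theorem contDiff_pd {f : Spacetime → E} (hf : ContDiff ℝ ∞ f) (α : Fin 4) :
    ContDiff ℝ ∞ (fun x => pd α f x) :=
  (hf.fderiv_right (m := ∞) (by simp)).clm_apply contDiff_const

theorem differentiable_of_smooth {f : Spacetime → E} (hf : ContDiff ℝ ∞ f) : Differentiable ℝ f :=
  hf.differentiable (by simp)

theorem pd_add {f g : Spacetime → E} {x : Spacetime} (α : Fin 4) (hf : DifferentiableAt ℝ f x)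
    (hg : DifferentiableAt ℝ g x) : pd α (fun y => f y + g y) x = pd α f x + pd α g x := by
  rw [pd, fderiv_fun_add hf hg]
  rfl

theorem pd_sub {f g : Spacetime → E} {x : Spacetime} (α : Fin 4) (hf : DifferentiableAt ℝ f x)
    (hg : DifferentiableAt ℝ g x) : pd α (fun y => f y - g y) x = pd α f x - pd α g x := by
  rw [pd, fderiv_fun_sub hf hg]
  rfl

theorem pd_const_smul {f : Spacetime → E} {x : Spacetime} (α : Fin 4)
    (hf : DifferentiableAt ℝ f x) (r : ℝ) : pd α (fun y => r • f y) x = r • pd α f x := by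
  rw [pd, fderiv_fun_const_smul hf]
  rfl

theorem pd_sum {ι : Type*} {s : Finset ι} {f : ι → Spacetime → E} {x : Spacetime} (α : Fin 4)
    (hf : ∀ i ∈ s, DifferentiableAt ℝ (f i) x) :
    pd α (fun y => ∑ i ∈ s, f i y) x = ∑ i ∈ s, pd α (f i) x := by
  rw [pd, fderiv_fun_sum hf, _root_.sum_apply]
  rfl

theorem pd_mul {𝔸 : Type*} [NormedCommRing 𝔸] [NormedAlgebra ℝ 𝔸] {f g : Spacetime → 𝔸}
    {x : Spacetime} (α : Fin 4) (hf : DifferentiableAt ℝ f x) (hg : DifferentiableAt ℝ g x) :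
    pd α (fun y => f y * g y) x = pd α f x * g x + f x * pd α g x := by
  rw [pd, fderiv_fun_mul hf hg]
  simp only [_root_.add_apply, _root_.smul_apply, smul_eq_mul, pd]
  ring

theorem pd_linear [FiniteDimensional ℝ E] (l : E →ₗ[ℝ] F) {f : Spacetime → E} {x : Spacetime}
    (hf : DifferentiableAt ℝ f x) (α : Fin 4) : pd α (fun y => l (f y)) x = l (pd α f x) := by
  have h := (LinearMap.toContinuousLinearMap l).hasFDerivAt.comp x hf.hasFDerivAt
  have h2 : pd α (fun y => l (f y)) x
      = ((LinearMap.toContinuousLinearMap l).comp (fderiv ℝ f x)) (Pi.single α 1) := by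
    rw [← h.fderiv]
    rfl
  rw [h2]
  rfl

theorem contDiff_linear [FiniteDimensional ℝ E] (l : E →ₗ[ℝ] F) {f : Spacetime → E}
    (hf : ContDiff ℝ ∞ f) : ContDiff ℝ ∞ fun y => l (f y) :=
  (LinearMap.toContinuousLinearMap l).contDiff.comp hf

theorem pd_pd_comm {f : Spacetime → E} (hf : ContDiff ℝ ∞ f) (α β : Fin 4) (x : Spacetime) :
    pd α (fun y => pd β f y) x = pd β (fun y => pd α f y) x := by
  have hd : DifferentiableAt ℝ (fderiv ℝ f) x :=
    (hf.fderiv_right (m := ∞) (by simp)).differentiable (by simp) x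
  have key : ∀ a b : Fin 4, pd a (fun y => pd b f y) x
      = fderiv ℝ (fderiv ℝ f) x (Pi.single a 1) (Pi.single b 1) := by
    intro a b
    have h := hd.hasFDerivAt.clm_apply (hasFDerivAt_const (Pi.single b (1 : ℝ)) x)
    have h2 := h.fderiv
    unfold pd
    rw [h2]
    simp
  rw [key, key]
  exact (hf.contDiffAt.isSymmSndFDerivAt (by
    rw [minSmoothness_of_isRCLikeNormedField]
    exact WithTop.coe_le_coe.2 (le_top : (2 : ℕ∞) ≤ ⊤))) _ _

theorem hasCompactSupport_pd {f : Spacetime → E} (hf : HasCompactSupport f) (α : Fin 4) :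
    HasCompactSupport (fun x => pd α f x) :=
  hf.fderiv_apply ℝ (Pi.single α 1)

/-- Integration by parts against the constant function 1, whose derivative vanishes. -/
theorem integral_pd_eq_zero {J : Spacetime → ℂ} (hJ : ContDiff ℝ ∞ J) (hs : HasCompactSupport J)
    (α : Fin 4) : ∫ x, pd α J x = 0 := by
  have h1 := (contDiff_pd hJ α).continuous.integrable_of_hasCompactSupport (μ := volume)
    (hasCompactSupport_pd hs α)
  have h2 := hJ.continuous.integrable_of_hasCompactSupport (μ := volume) hs
  have h := integral_mul_fderiv_eq_neg_fderiv_mul_of_integrable (μ := (volume : Measure Spacetime))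
    (f := fun _ => (1 : ℂ)) (g := J) (v := Pi.single α 1) (by simp) (by simpa [pd] using h1)
    (by simpa using h2) (fun _ _ => differentiableAt_const _)
    (fun x _ => differentiable_of_smooth hJ x)
  simpa [pd] using h

end PartialDerivatives

/-! Smooth matrix fields -/

/-- Entry-wise smoothness. -/
def SmoothMat (C : Spacetime → Mat) : Prop := ∀ I J, ContDiff ℝ ∞ fun y => C y I J

namespace SmoothMat

variable {A B : Spacetime → Mat}

theorem add (hA : SmoothMat A) (hB : SmoothMat B) : SmoothMat fun y => A y + B y :=
  fun I J => (hA I J).add (hB I J)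

theorem sub (hA : SmoothMat A) (hB : SmoothMat B) : SmoothMat fun y => A y - B y :=
  fun I J => (hA I J).sub (hB I J)

theorem mul (hA : SmoothMat A) (hB : SmoothMat B) : SmoothMat fun y => A y * B y :=
  fun I J => by
    simp only [Matrix.mul_apply]
    exact ContDiff.sum fun K _ => (hA I K).mul (hB K J)

theorem trace (hA : SmoothMat A) : ContDiff ℝ ∞ fun y => (A y).trace :=
  ContDiff.sum fun I _ => hA I I

theorem diff (hA : SmoothMat A) (I J : MultiIndex) (x : Spacetime) :
    DifferentiableAt ℝ (fun y => A y I J) x := differentiable_of_smooth (hA I J) x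

end SmoothMat

theorem pdMat_add {A B : Spacetime → Mat} (hA : SmoothMat A) (hB : SmoothMat B) (α : Fin 4)
    (x : Spacetime) : pdMat α (fun y => A y + B y) x = pdMat α A x + pdMat α B x := by
  ext I J
  exact pd_add α (hA.diff I J x) (hB.diff I J x)

theorem pdMat_sub {A B : Spacetime → Mat} (hA : SmoothMat A) (hB : SmoothMat B) (α : Fin 4)
    (x : Spacetime) : pdMat α (fun y => A y - B y) x = pdMat α A x - pdMat α B x := by
  ext I J
  exact pd_sub α (hA.diff I J x) (hB.diff I J x)

theorem pdMat_mul {A B : Spacetime → Mat} (hA : SmoothMat A) (hB : SmoothMat B) (α : Fin 4)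
    (x : Spacetime) :
    pdMat α (fun y => A y * B y) x = pdMat α A x * B x + A x * pdMat α B x := by
  ext I J
  simp only [pdMat, Matrix.of_apply, Matrix.mul_apply, Matrix.add_apply]
  rw [pd_sum (f := fun K y => A y I K * B y K J) α
    fun K _ => (hA.diff I K x).fun_mul (hB.diff K J x), ← Finset.sum_add_distrib]
  exact Finset.sum_congr rfl fun K _ => pd_mul α (hA.diff I K x) (hB.diff K J x)

theorem pd_trace {A : Spacetime → Mat} (hA : SmoothMat A) (α : Fin 4) (x : Spacetime) :
    pd α (fun y => (A y).trace) x = (pdMat α A x).trace :=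
  pd_sum α fun I _ => hA.diff I I x

/-! Force fields that depend linearly on a field `q` -/

section LinearForce

variable {V : Type*} [NormedAddCommGroup V] [NormedSpace ℝ V]
  (T : V →ₗ[ℝ] (Fin 4 → Mat))

/-- A matrix entry of `T`. -/
noncomputable def entry (β : Fin 4) (I J : MultiIndex) : V →ₗ[ℝ] ℂ where
  toFun v := T v β I J
  map_add' v w := by simp
  map_smul' r v := by simp

/-- The curvature as a function of the field `q` and its first derivatives `p`. -/
noncomputable def curvJet (q : V) (p : Fin 4 → V) (α β : Fin 4) : Mat :=
  T (p α) β - T (p β) α + T q α * T q β - T q β * T q α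

/-- The derivative in direction `γ` of the curvature, as a function of the field `q`, its first
derivatives `p` and its second derivatives `h`. -/
noncomputable def dcurvJet (q : V) (p : Fin 4 → V) (h : Fin 4 → Fin 4 → V) (γ α β : Fin 4) : Mat :=
  T (h γ α) β - T (h γ β) α + (T (p γ) α * T q β + T q α * T (p γ) β)
    - (T (p γ) β * T q α + T q β * T (p γ) α)

/-- The covariant divergence of the curvature, paired with `T v`. -/
noncomputable def yangMills (q : V) (p : Fin 4 → V) (h : Fin 4 → Fin 4 → V) (v : V) : ℂ :=
  ∑ α, ∑ β, (sg α : ℂ) * (sg β : ℂ) *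
    ((dcurvJet T q p h α α β + (T q α * curvJet T q p α β - curvJet T q p α β * T q α))
      * T v β).trace

theorem curvJet_swap (q : V) (p : Fin 4 → V) (α β : Fin 4) :
    curvJet T q p β α = -curvJet T q p α β := by
  simp only [curvJet]
  abel

variable [FiniteDimensional ℝ V]

theorem smoothMat_linear {q : Spacetime → V} (hq : ContDiff ℝ ∞ q) (β : Fin 4) :
    SmoothMat fun y => T (q y) β :=
  fun I J => contDiff_linear (entry T β I J) hq

theorem pdMat_linear {q : Spacetime → V} (hq : ContDiff ℝ ∞ q) (α β : Fin 4) (x : Spacetime) :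
    pdMat α (fun y => T (q y) β) x = T (pd α q x) β := by
  ext I J
  exact pd_linear (entry T β I J) (differentiable_of_smooth hq x) α

/-- A fixed linear T commutes with differentiation. The curvature becomes an algebraic function of
the value and first derivatives of q at the point, so later trace computations can treat q, p, h as
independent variables. -/
theorem curvature_linear {q : Spacetime → V} (hq : ContDiff ℝ ∞ q) (α β : Fin 4) (x : Spacetime) :
    curvature (fun y => T (q y)) α β x = curvJet T (q x) (fun γ => pd γ q x) α β := by
  rw [curvature, pdMat_linear T hq, pdMat_linear T hq, curvJet]

theorem smoothMat_curvJet {q : Spacetime → V} (hq : ContDiff ℝ ∞ q) (α β : Fin 4) :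
    SmoothMat fun y => curvJet T (q y) (fun γ => pd γ q y) α β :=
  ((((smoothMat_linear T (contDiff_pd hq α) β).sub (smoothMat_linear T (contDiff_pd hq β) α))).add
    ((smoothMat_linear T hq α).mul (smoothMat_linear T hq β))).sub
    ((smoothMat_linear T hq β).mul (smoothMat_linear T hq α))

theorem pdMat_curvJet {q : Spacetime → V} (hq : ContDiff ℝ ∞ q) (γ α β : Fin 4) (x : Spacetime) :
    pdMat γ (fun y => curvJet T (q y) (fun γ => pd γ q y) α β) x
      = dcurvJet T (q x) (fun γ => pd γ q x) (fun γ α => pd γ (fun y => pd α q y) x) γ α β := by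
  have h1 := smoothMat_linear T hq
  have h2 := fun α => smoothMat_linear T (contDiff_pd hq α)
  simp only [curvJet, dcurvJet]
  rw [pdMat_sub (((h2 α β).sub (h2 β α)).add ((h1 α).mul (h1 β))) ((h1 β).mul (h1 α)),
    pdMat_add ((h2 α β).sub (h2 β α)) ((h1 α).mul (h1 β)), pdMat_sub (h2 α β) (h2 β α),
    pdMat_mul (h1 α) (h1 β), pdMat_mul (h1 β) (h1 α), pdMat_linear T hq, pdMat_linear T hq,
    pdMat_linear T (contDiff_pd hq α), pdMat_linear T (contDiff_pd hq β)]

theorem omega_eq_one : omega = 1 := by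
  have : Matrix.det eta = -1 := by
    rw [eta, Matrix.det_diagonal]
    decide
  rw [omega, this]
  simp

theorem LV_linear {q : Spacetime → V} (hq : ContDiff ℝ ∞ q) (x : Spacetime) :
    LV (fun y => T (q y)) x = (1 / 2) * (∑ α, ∑ β, (sg α : ℂ) * (sg β : ℂ) *
        (curvJet T (q x) (fun γ => pd γ q x) α β * curvJet T (q x) (fun γ => pd γ q x) α β).trace)
      + star ((1 / 2) * (∑ α, ∑ β, (sg α : ℂ) * (sg β : ℂ) *
        (curvJet T (q x) (fun γ => pd γ q x) α β *
          curvJet T (q x) (fun γ => pd γ q x) α β).trace)) := by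
  have : halfTrace (fun y => T (q y)) x = (1 / 2) * (∑ α, ∑ β, (sg α : ℂ) * (sg β : ℂ) *
        (curvJet T (q x) (fun γ => pd γ q x) α β *
          curvJet T (q x) (fun γ => pd γ q x) α β).trace) := by
    rw [halfTrace, omega_eq_one]
    simp only [curvature_linear T hq, Matrix.mul_smul, Matrix.trace_smul, smul_eq_mul,
      Complex.ofReal_one, mul_one]
  rw [LV, this]

end LinearForce

/-! The first variation -/

/-- Linearity of the integral makes the integrated function a polynomial in ε, whose derivative at 0
is its linear coefficient; no differentiation under the integral sign is needed. Five coefficients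
suffice because the curvature Lagrangian is quartic. -/
theorem hasDerivAt_integral_of_polynomial {K : Set Spacetime} (hK : IsCompact K)
    {c : Fin 5 → Spacetime → ℂ} (hc : ∀ k, Continuous (c k)) {f : ℝ → Spacetime → ℂ}
    (hf : ∀ ε x, f ε x = ∑ k : Fin 5, (ε : ℂ) ^ (k : ℕ) * c k x) :
    HasDerivAt (fun ε => ∫ x in K, f ε x) (∫ x in K, c 1 x) 0 := by
  have hi : ∀ k, IntegrableOn (c k) K := fun k => (hc k).continuousOn.integrableOn_compact hK
  have h1 : (fun ε : ℝ => ∫ x in K, f ε x)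
      = fun ε : ℝ => ∑ k : Fin 5, (ε : ℂ) ^ (k : ℕ) * ∫ x in K, c k x := by
    funext ε
    simp only [hf]
    rw [integral_finsetSum _ fun k _ => (hi k).const_mul _]
    exact Finset.sum_congr rfl fun k _ => integral_const_mul _ _
  rw [h1]
  have h2 : ∀ k : Fin 5, HasDerivAt (fun ε : ℝ => (ε : ℂ) ^ (k : ℕ) * ∫ x in K, c k x)
      (((k : ℕ) * ((0 : ℝ) : ℂ) ^ ((k : ℕ) - 1) * 1) * ∫ x in K, c k x) 0 := fun k =>
    ((Complex.ofRealCLM.hasDerivAt (x := (0 : ℝ))).pow (k : ℕ)).mul_const _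
  refine (HasDerivAt.fun_sum (u := Finset.univ) fun k _ => h2 k).congr_deriv ?_
  simp [Fin.sum_univ_five]

section LinearForce

variable {V : Type*} [NormedAddCommGroup V] [NormedSpace ℝ V]
  (T : V →ₗ[ℝ] (Fin 4 → Mat))

/-- The coupling of a force tensor to the spinor field. -/
noncomputable def source (ψ : Spinor) (θ : Fin 4 → Mat) : ℂ := herm ψ ((∑ α, gammaUp α * θ α) *ᵥ ψ)

theorem herm_add (u v w : Spinor) : herm u (v + w) = herm u v + herm u w := by
  rw [herm, Matrix.mulVec_add, dotProduct_add]
  rfl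

theorem herm_smul (c : ℂ) (u v : Spinor) : herm u (c • v) = c * herm u v := by
  rw [herm, Matrix.mulVec_smul, dotProduct_smul]
  rfl

theorem herm_sum {ι : Type*} (s : Finset ι) (u : Spinor) (v : ι → Spinor) :
    herm u (∑ i ∈ s, v i) = ∑ i ∈ s, herm u (v i) := by
  classical
  induction s using Finset.induction_on with
  | empty => simp [herm]
  | insert a s ha ih => rw [Finset.sum_insert ha, Finset.sum_insert ha, herm_add, ih]

theorem source_add (ψ : Spinor) (θ θ' : Fin 4 → Mat) :
    source ψ (θ + θ') = source ψ θ + source ψ θ' := by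
  simp only [source, Pi.add_apply, Matrix.mul_add, Finset.sum_add_distrib, Matrix.add_mulVec,
    herm_add]

theorem source_smul (c : ℂ) (ψ : Spinor) (θ : Fin 4 → Mat) :
    source ψ (c • θ) = c * source ψ θ := by
  simp only [source, Pi.smul_apply, Matrix.mul_smul, ← Finset.smul_sum, Matrix.smul_mulVec,
    herm_smul]

theorem star_source {ψ : Spinor} {θ : Fin 4 → Mat} (hθ : IsForceTensor θ) :
    star (source ψ θ) = source ψ θ := by
  rw [source, Matrix.sum_mulVec, herm_sum, star_sum]
  exact Finset.sum_congr rfl fun α _ => star_herm_gammaUp (isForceTensor_iff.1 hθ α) α ψ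

theorem herm_diracD (θ : Spacetime → Fin 4 → Mat) (ψ : Spacetime → Spinor) (x : Spacetime) :
    herm (ψ x) (diracD θ ψ x)
      = herm (ψ x) (∑ α, gammaUp α *ᵥ pd α ψ x) + source (ψ x) (θ x) := by
  rw [source, ← herm_add, Matrix.sum_mulVec, ← Finset.sum_add_distrib, diracD]
  simp only [Matrix.mulVec_add, Matrix.mulVec_mulVec]

/-- The coupling is real for a force tensor, so half of it plus its conjugate is the full `source`;
θ enters L_K nowhere else. -/
theorem LK_eq (m : ℝ) {θ : Spacetime → Fin 4 → Mat} {x : Spacetime} (hθ : IsForceTensor (θ x))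
    (ψ : Spacetime → Spinor) :
    LK m θ ψ x = LK m 0 ψ x + source (ψ x) (θ x) := by
  have h0 : source (ψ x) ((0 : Spacetime → Fin 4 → Mat) x) = 0 := by simp [source, herm]
  simp only [LK, herm_diracD, h0, omega_eq_one, star_mul', star_add, star_source hθ, star_zero]
  have : star (1 / 2 : ℂ) = 1 / 2 := by simp
  rw [this]
  push_cast
  ring

/-! ### The trace pairing and its expansion along a variation -/

/-- The Lorentz-invariant trace pairing of two curvature-like arrays, plus its conjugate. -/
noncomputable def tracePair (A B : Fin 4 → Fin 4 → Mat) : ℂ :=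
  (∑ α, ∑ β, (sg α : ℂ) * (sg β : ℂ) * (A α β * B α β).trace)
    + star (∑ α, ∑ β, (sg α : ℂ) * (sg β : ℂ) * (A α β * B α β).trace)

theorem tracePair_comm (A B : Fin 4 → Fin 4 → Mat) : tracePair A B = tracePair B A := by
  simp only [tracePair, fun α β => Matrix.trace_mul_comm (A α β) (B α β)]

theorem tracePair_add_right (A B C : Fin 4 → Fin 4 → Mat) :
    tracePair A (B + C) = tracePair A B + tracePair A C := by
  simp only [tracePair, Pi.add_apply, Matrix.trace_add, mul_add,
    Finset.sum_add_distrib, star_add]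
  ring

theorem tracePair_smul_right (r : ℝ) (A B : Fin 4 → Fin 4 → Mat) :
    tracePair A (r • B) = r * tracePair A B := by
  have : ∑ α, ∑ β, (sg α : ℂ) * (sg β : ℂ) * (A α β * (r • B) α β).trace
      = r * ∑ α, ∑ β, (sg α : ℂ) * (sg β : ℂ) * (A α β * B α β).trace := by
    simp only [Pi.smul_apply, Matrix.mul_smul, Matrix.trace_smul, Complex.real_smul,
      Finset.mul_sum]
    exact Finset.sum_congr rfl fun _ _ => Finset.sum_congr rfl fun _ _ => by ring
  rw [tracePair, this, star_mul', tracePair]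
  simp only [RCLike.star_def, Complex.conj_ofReal]
  ring

/-- The part of the curvature of `q + ε v` that is linear in `ε`. -/
noncomputable def curvLin (q : V) (v : V) (w : Fin 4 → V) (α β : Fin 4) : Mat :=
  curvJet T v w α β - (T v α * T v β - T v β * T v α)
    + (T v α * T q β + T q α * T v β - T v β * T q α - T q β * T v α)

/-- The part of the curvature of `q + ε v` that is quadratic in `ε`. -/
noncomputable def curvQuad (v : V) (α β : Fin 4) : Mat := T v α * T v β - T v β * T v α

/-- The derivative part of the curvature is linear and the commutator is bilinear, so the expansion
stops at ε². -/
theorem curvJet_add_smul (q : V) (p : Fin 4 → V) (v : V) (w : Fin 4 → V) (ε : ℝ) :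
    curvJet T (q + ε • v) (fun α => p α + ε • w α)
      = curvJet T q p + ε • (curvLin T q v w + ε • curvQuad T v) := by
  funext α β
  simp only [curvJet, curvLin, curvQuad, Pi.add_apply, Pi.smul_apply, map_add, map_smul, add_mul,
    mul_add, smul_mul_assoc, mul_smul_comm, smul_add, smul_sub]
  abel

theorem tracePair_curvJet_add_smul (q : V) (p : Fin 4 → V) (v : V) (w : Fin 4 → V) (ε : ℝ) :
    tracePair (curvJet T (q + ε • v) (fun α => p α + ε • w α))
        (curvJet T (q + ε • v) (fun α => p α + ε • w α))
      = tracePair (curvJet T q p) (curvJet T q p)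
        + ε * (2 * tracePair (curvJet T q p) (curvLin T q v w))
        + ε ^ 2 * (tracePair (curvLin T q v w) (curvLin T q v w)
          + 2 * tracePair (curvJet T q p) (curvQuad T v))
        + ε ^ 3 * (2 * tracePair (curvLin T q v w) (curvQuad T v))
        + ε ^ 4 * tracePair (curvQuad T v) (curvQuad T v) := by
  have hl : ∀ A B C : Fin 4 → Fin 4 → Mat, tracePair (A + B) C = tracePair A C + tracePair B C := by
    intro A B C
    rw [tracePair_comm, tracePair_add_right, tracePair_comm C, tracePair_comm C]
  have hs : ∀ (A B : Fin 4 → Fin 4 → Mat) (r : ℝ), tracePair (r • A) B = r * tracePair A B := by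
    intro A B r
    rw [tracePair_comm, tracePair_smul_right, tracePair_comm]
  rw [curvJet_add_smul]
  simp only [hl, hs, tracePair_add_right, tracePair_smul_right,
    tracePair_comm (curvLin T q v w) (curvJet T q p), tracePair_comm (curvQuad T v)
    (curvJet T q p), tracePair_comm (curvQuad T v) (curvLin T q v w)]
  ring

/-- The part of the first variation that is a divergence is the divergence of this current. -/
noncomputable def current (q : V) (p : Fin 4 → V) (v : V) (α : Fin 4) : ℂ :=
  ∑ β, (sg α : ℂ) * (sg β : ℂ) * (curvJet T q p α β * T v β).trace

/-- The derivative of the current. -/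
noncomputable def dcurrent (q : V) (p : Fin 4 → V) (h : Fin 4 → Fin 4 → V) (v : V)
    (w : Fin 4 → V) (α : Fin 4) : ℂ :=
  ∑ β, (sg α : ℂ) * (sg β : ℂ) *
    ((dcurvJet T q p h α α β * T v β).trace + (curvJet T q p α β * T (w α) β).trace)

/-- Integration by parts at the level of jets: the Leibniz rule for the current accounts for the
derivative of v, and the leftover is the covariant divergence. The values h may be arbitrary, since
the terms containing them cancel between the two expressions on the right. -/
theorem sum_trace_curvLin (q : V) (p : Fin 4 → V) (h : Fin 4 → Fin 4 → V) (v : V)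
    (w : Fin 4 → V) :
    ∑ α, ∑ β, (sg α : ℂ) * (sg β : ℂ) * (curvJet T q p α β * curvLin T q v w α β).trace
      = 2 * ((∑ α, dcurrent T q p h v w α) - yangMills T q p h v) := by
  -- D is the covariant derivative of v. The linearized curvature is its antisymmetrization, and
  -- pairing with the antisymmetric curvature counts it twice.
  set D : Fin 4 → Fin 4 → Mat := fun α β => T (w α) β + (T q α * T v β - T v β * T q α) with hD
  have h1 : ∀ α β, curvLin T q v w α β = D α β - D β α := by
    intro α β
    simp only [hD, curvLin, curvJet]
    abel
  have h2 : ∑ α, ∑ β, (sg α : ℂ) * (sg β : ℂ) * (curvJet T q p α β * D β α).trace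
      = -∑ α, ∑ β, (sg α : ℂ) * (sg β : ℂ) * (curvJet T q p α β * D α β).trace := by
    rw [Finset.sum_comm, ← Finset.sum_neg_distrib]
    refine Finset.sum_congr rfl fun α _ => ?_
    rw [← Finset.sum_neg_distrib]
    refine Finset.sum_congr rfl fun β _ => ?_
    rw [curvJet_swap, neg_mul, Matrix.trace_neg]
    ring
  -- Cyclicity of the trace moves the commutator with T q from v onto the curvature.
  have h3 : ∀ α β, (curvJet T q p α β * (T v β * T q α)).trace
      = (T q α * curvJet T q p α β * T v β).trace := by
    intro α β
    rw [← mul_assoc, Matrix.trace_mul_comm, ← mul_assoc]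
  have h4 : ∑ α, ∑ β, (sg α : ℂ) * (sg β : ℂ) * (curvJet T q p α β * D α β).trace
      = (∑ α, dcurrent T q p h v w α) - yangMills T q p h v := by
    rw [yangMills, ← Finset.sum_sub_distrib]
    refine Finset.sum_congr rfl fun α _ => ?_
    rw [dcurrent, ← Finset.sum_sub_distrib]
    refine Finset.sum_congr rfl fun β _ => ?_
    have h5 := h3 α β
    rw [hD, Matrix.mul_add, Matrix.mul_sub, Matrix.trace_add, Matrix.trace_sub, h5,
      Matrix.add_mul, Matrix.sub_mul, Matrix.trace_add, Matrix.trace_sub, ← mul_assoc]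
    ring
  have h5 : ∑ α, ∑ β, (sg α : ℂ) * (sg β : ℂ) * (curvJet T q p α β * curvLin T q v w α β).trace
      = (∑ α, ∑ β, (sg α : ℂ) * (sg β : ℂ) * (curvJet T q p α β * D α β).trace)
        - ∑ α, ∑ β, (sg α : ℂ) * (sg β : ℂ) * (curvJet T q p α β * D β α).trace := by
    rw [← Finset.sum_sub_distrib]
    refine Finset.sum_congr rfl fun α _ => ?_
    rw [← Finset.sum_sub_distrib]
    refine Finset.sum_congr rfl fun β _ => ?_
    rw [h1, Matrix.mul_sub, Matrix.trace_sub, mul_sub]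
  rw [h5, h2, h4]
  ring

end LinearForce

/-! ### Smoothness of the Lagrangian and the Euler-Lagrange criterion -/

theorem ContDiff.star_complex {f : Spacetime → ℂ} (hf : ContDiff ℝ ∞ f) :
    ContDiff ℝ ∞ fun y => star (f y) :=
  Complex.conjCLE.contDiff.comp hf

theorem contDiff_mulVec {A : Spacetime → Mat} (hA : SmoothMat A) {φ : Spacetime → Spinor}
    (hφ : ContDiff ℝ ∞ φ) : ContDiff ℝ ∞ fun y => A y *ᵥ φ y :=
  contDiff_pi.2 fun I => by
    simp only [Matrix.mulVec, dotProduct]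
    exact ContDiff.sum fun J _ => (hA I J).mul (contDiff_pi.1 hφ J)

theorem smoothMat_const (A : Mat) : SmoothMat fun _ => A := fun _ _ => contDiff_const

theorem contDiff_herm {ψ φ : Spacetime → Spinor} (hψ : ContDiff ℝ ∞ ψ) (hφ : ContDiff ℝ ∞ φ) :
    ContDiff ℝ ∞ fun y => herm (ψ y) (φ y) := by
  simp only [herm, dotProduct, Pi.star_apply]
  exact ContDiff.sum fun I _ => (ContDiff.star_complex (contDiff_pi.1 hψ I)).mul
    (contDiff_pi.1 (contDiff_mulVec (smoothMat_const etaHat) hφ) I)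

theorem smoothMat_sum {ι : Type*} {s : Finset ι} {A : ι → Spacetime → Mat}
    (h : ∀ i ∈ s, SmoothMat (A i)) : SmoothMat fun y => ∑ i ∈ s, A i y := fun I J => by
  simp only [Matrix.sum_apply]
  exact ContDiff.sum fun i hi => h i hi I J

theorem contDiff_tracePair {A B : Spacetime → Fin 4 → Fin 4 → Mat}
    (hA : ∀ α β, SmoothMat fun y => A y α β) (hB : ∀ α β, SmoothMat fun y => B y α β) :
    ContDiff ℝ ∞ fun y => tracePair (A y) (B y) := by
  have h : ContDiff ℝ ∞ fun y =>
      ∑ α, ∑ β, (sg α : ℂ) * (sg β : ℂ) * (A y α β * B y α β).trace :=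
    ContDiff.sum fun α _ => ContDiff.sum fun β _ =>
      contDiff_const.mul ((hA α β).mul (hB α β)).trace
  exact h.add (ContDiff.star_complex h)

theorem tracePair_zero_right (A : Fin 4 → Fin 4 → Mat) : tracePair A 0 = 0 := by
  simp [tracePair]

section LinearForce

variable {V : Type*} [NormedAddCommGroup V] [NormedSpace ℝ V] (T : V →ₗ[ℝ] (Fin 4 → Mat))

/-- The Euler-Lagrange expression at a field with value `q`, first derivatives `p` and second
derivatives `h`, paired with `v`. -/
noncomputable def eulerLagrange (τ : ℝ) (ψ : Spinor) (q : V) (p : Fin 4 → V) (h : Fin 4 → Fin 4 → V)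
    (v : V) : ℂ :=
  source ψ (T v) + 2 * τ * (yangMills T q p h v + star (yangMills T q p h v))

theorem yangMills_smul (q : V) (p : Fin 4 → V) (h : Fin 4 → Fin 4 → V) (r : ℝ) (v : V) :
    yangMills T q p h (r • v) = r * yangMills T q p h v := by
  simp only [yangMills, map_smul, Pi.smul_apply, Matrix.mul_smul, Matrix.trace_smul,
    Complex.real_smul, Finset.mul_sum]
  exact Finset.sum_congr rfl fun _ _ => Finset.sum_congr rfl fun _ _ => by ring

/-- Real homogeneity lets the scalar factor g of a variation g v leave the pairing, as the
fundamental lemma of the calculus of variations requires. -/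
theorem eulerLagrange_smul (τ : ℝ) (ψ : Spinor) (q : V) (p : Fin 4 → V) (h : Fin 4 → Fin 4 → V)
    (r : ℝ) (v : V) :
    eulerLagrange T τ ψ q p h (r • v) = r * eulerLagrange T τ ψ q p h v := by
  have h1 : T (r • v) = (r : ℂ) • T v := by
    rw [map_smul, Complex.coe_smul]
  rw [eulerLagrange, eulerLagrange, yangMills_smul, h1, source_smul, star_mul']
  simp only [RCLike.star_def, Complex.conj_ofReal]
  ring

variable [FiniteDimensional ℝ V]

theorem LV_eq_tracePair {q : Spacetime → V} (hq : ContDiff ℝ ∞ q) (x : Spacetime) :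
    LV (fun y => T (q y)) x = (1 / 2) * tracePair (curvJet T (q x) fun γ => pd γ q x)
      (curvJet T (q x) fun γ => pd γ q x) := by
  have : star (1 / 2 : ℂ) = 1 / 2 := by simp
  rw [LV_linear T hq, star_mul', this, ← mul_add]
  rfl

theorem Ltot_linear (hF : ∀ v, IsForceTensor (T v)) (m τ : ℝ) (ψ : Spacetime → Spinor)
    {q : Spacetime → V} (hq : ContDiff ℝ ∞ q) (x : Spacetime) :
    Ltot m τ ψ (fun y => T (q y)) x = LK m 0 ψ x + source (ψ x) (T (q x))
      - τ / 2 * tracePair (curvJet T (q x) fun γ => pd γ q x)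
          (curvJet T (q x) fun γ => pd γ q x) := by
  rw [Ltot, LK_eq m (θ := fun y => T (q y)) (hF (q x)), LV_eq_tracePair T hq]
  ring

theorem contDiff_source {ψ : Spacetime → Spinor} (hψ : ContDiff ℝ ∞ ψ) {q : Spacetime → V}
    (hq : ContDiff ℝ ∞ q) : ContDiff ℝ ∞ fun y => source (ψ y) (T (q y)) :=
  contDiff_herm hψ (contDiff_mulVec (smoothMat_sum fun α _ =>
    (smoothMat_const (gammaUp α)).mul (smoothMat_linear T hq α)) hψ)

theorem contDiff_LK (m : ℝ) {ψ : Spacetime → Spinor} (hψ : ContDiff ℝ ∞ ψ) :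
    ContDiff ℝ ∞ fun y => LK m 0 ψ y := by
  have h1 : ContDiff ℝ ∞ fun y => diracD 0 ψ y :=
    ContDiff.sum fun α _ => contDiff_mulVec (smoothMat_const _)
      ((contDiff_pd hψ α).add (contDiff_mulVec (smoothMat_const _) hψ))
  have h2 : ContDiff ℝ ∞ fun y => 1 / 2 * herm (ψ y) (diracD 0 ψ y) :=
    contDiff_const.mul (contDiff_herm hψ h1)
  exact ((h2.add (ContDiff.star_complex h2)).sub
    (contDiff_const.mul (contDiff_herm hψ hψ))).mul contDiff_const

variable {T}

/-- The integrand of the first variation. -/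
noncomputable def firstVariation (T : V →ₗ[ℝ] (Fin 4 → Mat)) (τ : ℝ) (ψ : Spacetime → Spinor)
    (q δ : Spacetime → V) (x : Spacetime) : ℂ :=
  source (ψ x) (T (δ x)) - τ * tracePair (curvJet T (q x) fun γ => pd γ q x)
    (curvLin T (q x) (δ x) fun γ => pd γ δ x)

theorem smoothMat_curvLin {q δ : Spacetime → V} (hq : ContDiff ℝ ∞ q) (hδ : ContDiff ℝ ∞ δ)
    (α β : Fin 4) : SmoothMat fun y => curvLin T (q y) (δ y) (fun γ => pd γ δ y) α β := by
  have h1 := smoothMat_linear T hq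
  have h2 := smoothMat_linear T hδ
  exact ((smoothMat_curvJet T hδ α β).sub (((h2 α).mul (h2 β)).sub ((h2 β).mul (h2 α)))).add
    (((((h2 α).mul (h1 β)).add ((h1 α).mul (h2 β))).sub ((h2 β).mul (h1 α))).sub
      ((h1 β).mul (h2 α)))

theorem smoothMat_curvQuad {δ : Spacetime → V} (hδ : ContDiff ℝ ∞ δ)
    (α β : Fin 4) : SmoothMat fun y => curvQuad T (δ y) α β := by
  have h2 := smoothMat_linear T hδ
  exact ((h2 α).mul (h2 β)).sub ((h2 β).mul (h2 α))

theorem hasDerivAt_action (hF : ∀ v, IsForceTensor (T v)) (m τ : ℝ) {ψ : Spacetime → Spinor}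
    (hψ : ContDiff ℝ ∞ ψ) {q δ : Spacetime → V} (hq : ContDiff ℝ ∞ q) (hδ : ContDiff ℝ ∞ δ)
    {K : Set Spacetime} (hK : IsCompact K) :
    HasDerivAt (fun ε : ℝ => ∫ x in K, Ltot m τ ψ (fun y => T (q y + ε • δ y)) x)
      (∫ x in K, firstVariation T τ ψ q δ x) 0 := by
  have hC := smoothMat_curvJet T hq
  have hL := smoothMat_curvLin (T := T) hq hδ
  have hQ := smoothMat_curvQuad (T := T) hδ
  -- The coefficients of 1, ε, ..., ε⁴ in the Lagrangian along q + εδ. Only the second enters the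
  -- derivative; the others are needed for integrability.
  let c : Fin 5 → Spacetime → ℂ := ![
    fun x => LK m 0 ψ x + source (ψ x) (T (q x))
      - τ / 2 * tracePair (curvJet T (q x) fun γ => pd γ q x) (curvJet T (q x) fun γ => pd γ q x),
    firstVariation T τ ψ q δ,
    fun x => -(τ / 2) * (tracePair (curvLin T (q x) (δ x) fun γ => pd γ δ x)
        (curvLin T (q x) (δ x) fun γ => pd γ δ x)
      + 2 * tracePair (curvJet T (q x) fun γ => pd γ q x) (curvQuad T (δ x))),
    fun x => -τ * tracePair (curvLin T (q x) (δ x) fun γ => pd γ δ x) (curvQuad T (δ x)),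
    fun x => -(τ / 2) * tracePair (curvQuad T (δ x)) (curvQuad T (δ x))]
  have hc : ∀ k, Continuous (c k) := by
    have h0 : ContDiff ℝ ∞ (c 0) :=
      ((contDiff_LK m hψ).add (contDiff_source T hψ hq)).sub
        (contDiff_const.mul (contDiff_tracePair hC hC))
    have h1 : ContDiff ℝ ∞ (c 1) :=
      (contDiff_source T hψ hδ).sub (contDiff_const.mul (contDiff_tracePair hC hL))
    have h2 : ContDiff ℝ ∞ (c 2) :=
      contDiff_const.mul ((contDiff_tracePair hL hL).add
        (contDiff_const.mul (contDiff_tracePair hC hQ)))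
    have h3 : ContDiff ℝ ∞ (c 3) := contDiff_const.mul (contDiff_tracePair hL hQ)
    have h4 : ContDiff ℝ ∞ (c 4) := contDiff_const.mul (contDiff_tracePair hQ hQ)
    intro k
    fin_cases k
    exacts [h0.continuous, h1.continuous, h2.continuous, h3.continuous, h4.continuous]
  refine hasDerivAt_integral_of_polynomial hK hc fun ε x => ?_
  have h1 : ∀ γ, pd γ (fun y => q y + ε • δ y) x = pd γ q x + ε • pd γ δ x := by
    intro γ
    have hd := differentiable_of_smooth hδ x
    rw [pd_add γ (differentiable_of_smooth hq x) (hd.fun_const_smul ε), pd_const_smul γ hd]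
  have h2 : T (q x + ε • δ x) = T (q x) + (ε : ℂ) • T (δ x) := by
    rw [map_add, map_smul, Complex.coe_smul]
  rw [Ltot_linear T hF m τ ψ (hq.add (hδ.const_smul ε))]
  simp only [h1]
  rw [tracePair_curvJet_add_smul, h2, source_add, source_smul, Fin.sum_univ_five]
  simp only [c, firstVariation, Matrix.cons_val]
  simp
  ring

/-- The jet identity `sum_trace_curvLin`, with the formal derivative of the current identified with
its actual partial derivative. The factor 2 there is the source of the 2τ. -/
theorem firstVariation_eq (τ : ℝ) (ψ : Spacetime → Spinor) {q δ : Spacetime → V}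
    (hq : ContDiff ℝ ∞ q) (hδ : ContDiff ℝ ∞ δ) (x : Spacetime) :
    firstVariation T τ ψ q δ x
      = eulerLagrange T τ (ψ x) (q x) (fun γ => pd γ q x)
          (fun γ α => pd γ (fun y => pd α q y) x) (δ x)
        + ∑ α, pd α (fun y => -2 * τ * (current T (q y) (fun γ => pd γ q y) (δ y) α
          + star (current T (q y) (fun γ => pd γ q y) (δ y) α))) x := by
  have hJ : ∀ α, ContDiff ℝ ∞ fun y => current T (q y) (fun γ => pd γ q y) (δ y) α := fun α =>
    ContDiff.sum fun β _ => contDiff_const.mul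
      ((smoothMat_curvJet T hq α β).mul (smoothMat_linear T hδ β)).trace
  have h1 : ∀ α, pd α (fun y => current T (q y) (fun γ => pd γ q y) (δ y) α) x
      = dcurrent T (q x) (fun γ => pd γ q x) (fun γ α => pd γ (fun y => pd α q y) x) (δ x)
        (fun γ => pd γ δ x) α := by
    intro α
    have hs := fun β => (smoothMat_curvJet T hq α β).mul (smoothMat_linear T hδ β)
    simp only [current, dcurrent]
    rw [pd_sum α fun β _ => (differentiable_of_smooth (contDiff_const.mul (hs β).trace) x)]
    refine Finset.sum_congr rfl fun β _ => ?_
    rw [pd_mul α (differentiableAt_const _) (differentiable_of_smooth (hs β).trace x),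
      pd_trace (hs β), pdMat_mul (smoothMat_curvJet T hq α β) (smoothMat_linear T hδ β),
      pdMat_curvJet T hq, pdMat_linear T hδ, Matrix.trace_add]
    simp [pd]
  have h2 : ∀ α, pd α (fun y => -2 * τ * (current T (q y) (fun γ => pd γ q y) (δ y) α
          + star (current T (q y) (fun γ => pd γ q y) (δ y) α))) x
      = -2 * τ * (dcurrent T (q x) (fun γ => pd γ q x) (fun γ α => pd γ (fun y => pd α q y) x)
        (δ x) (fun γ => pd γ δ x) α + star (dcurrent T (q x) (fun γ => pd γ q x)
          (fun γ α => pd γ (fun y => pd α q y) x) (δ x) (fun γ => pd γ δ x) α)) := by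
    intro α
    have hd := differentiable_of_smooth (hJ α) x
    have hd' := differentiable_of_smooth (ContDiff.star_complex (hJ α)) x
    rw [pd_mul α (differentiableAt_const _) (hd.fun_add hd'), pd_add α hd hd', h1]
    have h3 : pd α (fun y => star (current T (q y) (fun γ => pd γ q y) (δ y) α)) x
        = star (pd α (fun y => current T (q y) (fun γ => pd γ q y) (δ y) α) x) :=
      pd_linear (Complex.conjCLE : ℂ →ₗ[ℝ] ℂ) hd α
    rw [h3, h1]
    simp [pd]
  simp only [h2]
  rw [firstVariation, tracePair, sum_trace_curvLin T (q x) (fun γ => pd γ q x)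
    (fun γ α => pd γ (fun y => pd α q y) x) (δ x) (fun γ => pd γ δ x), eulerLagrange,
    ← Finset.mul_sum, Finset.sum_add_distrib, ← star_sum]
  simp only [star_mul', star_sub]
  have : star (2 : ℂ) = 2 := by simp
  rw [this]
  ring

theorem integral_firstVariation (τ : ℝ) {ψ : Spacetime → Spinor} (hψ : ContDiff ℝ ∞ ψ)
    {q δ : Spacetime → V} (hq : ContDiff ℝ ∞ q) (hδ : ContDiff ℝ ∞ δ) (hs : HasCompactSupport δ)
    {K : Set Spacetime} (hK : tsupport δ ⊆ K) :
    ∫ x in K, firstVariation T τ ψ q δ x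
      = ∫ x, eulerLagrange T τ (ψ x) (q x) (fun γ => pd γ q x)
          (fun γ α => pd γ (fun y => pd α q y) x) (δ x) := by
  -- Off the support δ and its first derivatives vanish, so K may be replaced by the whole space,
  -- where divergences of compactly supported currents integrate to zero.
  have h0 : ∀ x ∉ tsupport δ, firstVariation T τ ψ q δ x = 0 := by
    intro x hx
    have h1 : δ x = 0 := image_eq_zero_of_notMem_tsupport hx
    have h2 : ∀ γ, pd γ δ x = 0 := by
      intro γ
      have : fderiv ℝ δ x = 0 := by
        by_contra hne
        exact hx (support_fderiv_subset ℝ hne)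
      rw [pd, this]
      rfl
    have h3 : (curvLin T (q x) (δ x) fun γ => pd γ δ x) = 0 := by
      funext α β
      simp [curvLin, curvJet, h1, h2]
    rw [firstVariation, h3, tracePair_zero_right, h1, map_zero]
    simp [source, herm]
  have hc : ContDiff ℝ ∞ (firstVariation T τ ψ q δ) :=
    (contDiff_source T hψ hδ).sub (contDiff_const.mul (contDiff_tracePair
      (smoothMat_curvJet T hq) (smoothMat_curvLin hq hδ)))
  have hi : Integrable (firstVariation T τ ψ q δ) :=
    hc.continuous.integrable_of_hasCompactSupport (HasCompactSupport.intro hs h0)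
  have hJ : ∀ α, ContDiff ℝ ∞ fun y => -2 * (τ : ℂ) * (current T (q y) (fun γ => pd γ q y) (δ y) α
          + star (current T (q y) (fun γ => pd γ q y) (δ y) α)) := fun α => by
    have h : ContDiff ℝ ∞ fun y => current T (q y) (fun γ => pd γ q y) (δ y) α :=
      ContDiff.sum fun β _ => contDiff_const.mul
        ((smoothMat_curvJet T hq α β).mul (smoothMat_linear T hδ β)).trace
    exact contDiff_const.mul (h.add (ContDiff.star_complex h))
  have hJs : ∀ α, HasCompactSupport fun y => -2 * (τ : ℂ) *
      (current T (q y) (fun γ => pd γ q y) (δ y) α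
          + star (current T (q y) (fun γ => pd γ q y) (δ y) α)) := fun α =>
    HasCompactSupport.intro hs fun x hx => by
      simp [current, image_eq_zero_of_notMem_tsupport hx]
  rw [setIntegral_eq_integral_of_forall_compl_eq_zero fun x hx => h0 x fun h => hx (hK h)]
  have h4 : (fun x => eulerLagrange T τ (ψ x) (q x) (fun γ => pd γ q x)
          (fun γ α => pd γ (fun y => pd α q y) x) (δ x))
      = fun x => firstVariation T τ ψ q δ x - ∑ α, pd α (fun y => -2 * (τ : ℂ) *
        (current T (q y) (fun γ => pd γ q y) (δ y) α
          + star (current T (q y) (fun γ => pd γ q y) (δ y) α))) x := by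
    funext x
    rw [firstVariation_eq τ ψ hq hδ]
    ring
  have hpi := fun α => (contDiff_pd (hJ α) α).continuous.integrable_of_hasCompactSupport
    (μ := volume) (hasCompactSupport_pd (hJs α) α)
  rw [h4, integral_sub hi (integrable_finsetSum _ fun α _ => hpi α),
    integral_finsetSum _ fun α _ => hpi α]
  simp only [fun α => integral_pd_eq_zero (hJ α) (hJs α) α, Finset.sum_const_zero, sub_zero]

/-- The Euler-Lagrange criterion for fields on which the force tensor depends linearly. -/
theorem isStationaryAt_iff (hF : ∀ v, IsForceTensor (T v)) {A : Set V}
    (hA : ∀ v ∈ A, ∀ r : ℝ, r • v ∈ A) (m τ : ℝ) {ψ : Spacetime → Spinor} (hψ : ContDiff ℝ ∞ ψ)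
    {q : Spacetime → V} (hq : ContDiff ℝ ∞ q) :
    IsStationaryAt A (fun q => Ltot m τ ψ (fun y => T (q y))) q ↔
      ∀ x, ∀ v ∈ A, eulerLagrange T τ (ψ x) (q x) (fun γ => pd γ q x)
          (fun γ α => pd γ (fun y => pd α q y) x) v = 0 := by
  constructor
  · intro h x v hv
    have hcont : Continuous fun x => eulerLagrange T τ (ψ x) (q x) (fun γ => pd γ q x)
          (fun γ α => pd γ (fun y => pd α q y) x) v := by
      have hY : ContDiff ℝ ∞ fun x => yangMills T (q x) (fun γ => pd γ q x)
          (fun γ α => pd γ (fun y => pd α q y) x) v :=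
        ContDiff.sum fun α _ => ContDiff.sum fun β _ => contDiff_const.mul
          (SmoothMat.trace (SmoothMat.mul (SmoothMat.add (by
            have h1 := smoothMat_linear T hq
            have h2 := fun α => smoothMat_linear T (contDiff_pd hq α)
            have h3 := fun α β => smoothMat_linear T (contDiff_pd (contDiff_pd hq α) β)
            exact (((h3 α α β).sub (h3 β α α)).add
              (((h2 α α).mul (h1 β)).add ((h1 α).mul (h2 α β)))).sub
              (((h2 α β).mul (h1 α)).add ((h1 β).mul (h2 α α))))
            (((smoothMat_linear T hq α).mul (smoothMat_curvJet T hq α β)).sub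
              ((smoothMat_curvJet T hq α β).mul (smoothMat_linear T hq α))))
            (smoothMat_const _)))
      exact ((contDiff_source T hψ contDiff_const).add
        (contDiff_const.mul (hY.add (ContDiff.star_complex hY)))).continuous
    -- The fundamental lemma, with test variations g v: g is an arbitrary smooth compactly supported
    -- real function and v a fixed value. Closure of A under real scaling keeps g v admissible.
    have hae := ae_eq_zero_of_integral_contDiff_smul_eq_zero
      (hcont.locallyIntegrable (μ := volume)) fun g hg hgs => by
        have hδ : ContDiff ℝ ∞ fun y => g y • v := hg.smul contDiff_const
        have hδs : HasCompactSupport fun y => g y • v := hgs.smul_right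
        have h1 := h _ hδ hδs (fun y => hA v hv _) _ hδs subset_rfl
        have h2 := (hasDerivAt_action hF m τ hψ hq hδ hδs).unique h1
        rw [integral_firstVariation τ hψ hq hδ hδs subset_rfl] at h2
        simpa only [eulerLagrange_smul, Complex.real_smul] using h2
    -- Continuity upgrades vanishing almost everywhere to vanishing at every point.
    have := (hcont.ae_eq_iff_eq (volume : Measure Spacetime) continuous_const).1 hae
    exact congrFun this x
  · intro h δ hδ hδs hδA K hK hsub
    have h1 := hasDerivAt_action hF m τ hψ hq hδ hK
    rw [integral_firstVariation τ hψ hq hδ hδs hsub] at h1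
    simpa only [h _ _ (hδA _), integral_zero] using h1

end LinearForce

/-- The Minkowski inner product of vectors given by upper components. -/
def minkowski (m n : Fin 4 → ℝ) : ℝ := ∑ μ, (sg μ : ℝ) * m μ * n μ

theorem minkowski_comm (m n : Fin 4 → ℝ) : minkowski m n = minkowski n m :=
  Finset.sum_congr rfl fun _ _ => by ring

/-! The combinations of `(cos ζ + i sin ζ 𝒥) Θ_μ` -/

/-- The matrix `m^μ (cos ζ + i sin ζ 𝒥) Θ_μ`. -/
noncomputable def cliffVec (ζ : ℝ) : (Fin 4 → ℝ) →ₗ[ℝ] Mat where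
  toFun m := ∑ μ, m μ • (expIJ ζ * cliff μ)
  map_add' m n := by simp [add_smul, Finset.sum_add_distrib]
  map_smul' r m := by simp [Finset.smul_sum, mul_smul]

theorem cliffVec_apply (ζ : ℝ) (m : Fin 4 → ℝ) :
    cliffVec ζ m = ∑ μ, m μ • (expIJ ζ * cliff μ) := rfl

/-- Moving R_μ past the rotation changes the sign of 𝒥. Since (i𝒥)² = 1, the product of cos ζ + i
sin ζ 𝒥 and cos ζ - i sin ζ 𝒥 is cos² ζ - sin² ζ. This is the origin of every cos 2ζ in this family.
-/
theorem expIJ_mul_cliff_mul (ζ : ℝ) (μ ν : Fin 4) :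
    expIJ ζ * cliff μ * (expIJ ζ * cliff ν) = (Real.cos (2 * ζ) : ℂ) • (cliff μ * cliff ν) := by
  have h1 : cliff μ * calJ = -(calJ * cliff μ) := by rw [calJ_mul_cliff, neg_neg]
  have h2 : cliff μ * expIJ ζ
      = ((Real.cos ζ : ℂ) • 1 - (Complex.I * (Real.sin ζ : ℂ)) • calJ) * cliff μ := by
    rw [expIJ, mul_add, mul_smul_comm, mul_smul_comm, mul_one, h1, sub_mul, smul_mul_assoc,
      smul_mul_assoc, one_mul, smul_neg, sub_eq_add_neg]
  have h3 : expIJ ζ * ((Real.cos ζ : ℂ) • 1 - (Complex.I * (Real.sin ζ : ℂ)) • calJ)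
      = (Real.cos (2 * ζ) : ℂ) • 1 := by
    rw [expIJ, add_mul, mul_sub, mul_sub]
    simp only [smul_mul_smul_comm, mul_one, one_mul, calJ_mul_calJ, smul_neg]
    rw [Real.cos_two_mul', mul_comm (Complex.I * _), sub_add_sub_cancel, sub_neg_eq_add, ← add_smul]
    congr 1
    push_cast
    linear_combination Complex.sin ζ ^ 2 * Complex.I_sq
  rw [mul_assoc, ← mul_assoc (cliff μ), h2, mul_assoc, ← mul_assoc (expIJ ζ), h3, smul_mul_assoc,
    one_mul]

theorem cliffVec_anticomm (ζ : ℝ) (m n : Fin 4 → ℝ) :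
    cliffVec ζ m * cliffVec ζ n + cliffVec ζ n * cliffVec ζ m
      = ((-2 * Real.cos (2 * ζ) * minkowski m n : ℝ) : ℂ) • 1 := by
  have h : ∀ m n : Fin 4 → ℝ, cliffVec ζ m * cliffVec ζ n
      = ∑ μ, ∑ ν, (m μ * n ν) • (Real.cos (2 * ζ) : ℂ) • (cliff μ * cliff ν) := by
    intro m n
    simp only [cliffVec_apply, Finset.sum_mul_sum, smul_mul_smul_comm,
      expIJ_mul_cliff_mul]
  rw [h, h n m, Finset.sum_comm (f := fun μ ν => (n μ * m ν) • _), ← Finset.sum_add_distrib]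
  have h2 : ∀ μ, (∑ ν, (m μ * n ν) • (Real.cos (2 * ζ) : ℂ) • (cliff μ * cliff ν)
        + ∑ ν, (n ν * m μ) • (Real.cos (2 * ζ) : ℂ) • (cliff ν * cliff μ))
      = ((-2 * Real.cos (2 * ζ) * ((sg μ : ℝ) * m μ * n μ) : ℝ) : ℂ) • (1 : Mat) := by
    intro μ
    rw [← Finset.sum_add_distrib, Finset.sum_eq_single μ]
    · rw [mul_comm (n μ), ← smul_add, ← smul_add, cliff_anticomm, eta, Matrix.diagonal_apply_eq,
        ← Complex.coe_smul, smul_smul, smul_smul]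
      congr 1
      push_cast
      ring
    · intro ν _ hν
      rw [mul_comm (n ν), ← smul_add, ← smul_add, cliff_anticomm, eta,
        Matrix.diagonal_apply_ne _ hν.symm]
      simp
    · simp
  simp only [h2]
  rw [← Finset.sum_smul, ← Complex.ofReal_sum, ← Finset.mul_sum]
  rfl

theorem trace_cliffVec_mul (ζ : ℝ) (m n : Fin 4 → ℝ) :
    (cliffVec ζ m * cliffVec ζ n).trace = ((-16 * Real.cos (2 * ζ) * minkowski m n : ℝ) : ℂ) := by
  rw [trace_mul_of_anticomm (cliffVec_anticomm ζ m n)]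
  push_cast
  ring

theorem calJ_mul_cliffVec (ζ : ℝ) (m : Fin 4 → ℝ) :
    calJ * cliffVec ζ m = -(cliffVec ζ m * calJ) := by
  have h : calJ * expIJ ζ = expIJ ζ * calJ := by simp [expIJ, mul_add, add_mul]
  simp only [cliffVec_apply, Finset.mul_sum, Finset.sum_mul, ← Finset.sum_neg_distrib,
    mul_smul_comm, smul_mul_assoc]
  refine Finset.sum_congr rfl fun μ _ => ?_
  rw [← mul_assoc, h, mul_assoc, calJ_mul_cliff, mul_neg, mul_assoc, smul_neg]

/-- A product of an odd number of these matrices anticommutes with 𝒥. -/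
theorem trace_cliffVec_three (ζ : ℝ) (a b c : Fin 4 → ℝ) :
    (cliffVec ζ a * cliffVec ζ b * cliffVec ζ c).trace = 0 := by
  refine trace_eq_zero_of_calJ_anticomm ?_
  rw [← mul_assoc, ← mul_assoc, calJ_mul_cliffVec, neg_mul, neg_mul, mul_assoc (cliffVec ζ a),
    calJ_mul_cliffVec, mul_neg, neg_mul, neg_neg, ← mul_assoc, mul_assoc _ calJ, calJ_mul_cliffVec,
    mul_neg]
  simp only [mul_assoc]

theorem trace_comm_mul_comm (ζ : ℝ) (a b c d : Fin 4 → ℝ) :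
    ((cliffVec ζ a * cliffVec ζ b - cliffVec ζ b * cliffVec ζ a) *
      (cliffVec ζ c * cliffVec ζ d - cliffVec ζ d * cliffVec ζ c)).trace
      = ((64 * Real.cos (2 * ζ) ^ 2 *
        (minkowski a d * minkowski b c - minkowski a c * minkowski b d) : ℝ) : ℂ) := by
  have h := fun a b c d => trace_four_of_anticomm (cliffVec_anticomm ζ a b)
    (cliffVec_anticomm ζ a c) (cliffVec_anticomm ζ a d) (cliffVec_anticomm ζ b c)
    (cliffVec_anticomm ζ b d) (cliffVec_anticomm ζ c d)
  rw [sub_mul, mul_sub, mul_sub, Matrix.trace_sub, Matrix.trace_sub, Matrix.trace_sub, h, h, h, h,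
    minkowski_comm d c, minkowski_comm b a]
  push_cast
  ring

section FamilyVec

variable {V : Type*} [NormedAddCommGroup V] [NormedSpace ℝ V] {T : V →ₗ[ℝ] (Fin 4 → Mat)} {ζ : ℝ}
  {u : V → Fin 4 → Fin 4 → ℝ} (hT : ∀ v α, T v α = cliffVec ζ (u v α))
include hT

/-- The curl part of the curvature is of degree one in the generators and the commutator part of
degree two. Their cross terms are traces of three generators and vanish, leaving a quadratic and a
quartic part. -/
theorem tracePair_of_cliffVec (q : V) (p : Fin 4 → V) :
    (1 / 2) * tracePair (curvJet T q p) (curvJet T q p) =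
      ((∑ α, ∑ β, (sg α : ℝ) * (sg β : ℝ) *
        (-16 * Real.cos (2 * ζ) *
          minkowski (u (p α) β - u (p β) α) (u (p α) β - u (p β) α)
        + 64 * Real.cos (2 * ζ) ^ 2 * (minkowski (u q α) (u q β) ^ 2
          - minkowski (u q α) (u q α) * minkowski (u q β) (u q β))) : ℝ) : ℂ) := by
  have h : ∑ α, ∑ β, (sg α : ℂ) * (sg β : ℂ) * (curvJet T q p α β * curvJet T q p α β).trace
      = ((∑ α, ∑ β, (sg α : ℝ) * (sg β : ℝ) *
        (-16 * Real.cos (2 * ζ) *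
          minkowski (u (p α) β - u (p β) α) (u (p α) β - u (p β) α)
        + 64 * Real.cos (2 * ζ) ^ 2 * (minkowski (u q α) (u q β) ^ 2
          - minkowski (u q α) (u q α) * minkowski (u q β) (u q β))) : ℝ) : ℂ) := by
    push_cast
    refine Finset.sum_congr rfl fun α _ => Finset.sum_congr rfl fun β _ => ?_
    have h1 : curvJet T q p α β = cliffVec ζ (u (p α) β - u (p β) α)
        + (cliffVec ζ (u q α) * cliffVec ζ (u q β) - cliffVec ζ (u q β) * cliffVec ζ (u q α)) := by
      rw [curvJet, hT, hT, hT, hT, map_sub, add_sub_assoc]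
    have h3 := trace_cliffVec_three ζ
    rw [h1, add_mul, mul_add, mul_add, Matrix.trace_add, Matrix.trace_add, Matrix.trace_add,
      trace_comm_mul_comm, trace_cliffVec_mul, mul_sub, sub_mul, Matrix.trace_sub,
      Matrix.trace_sub, ← mul_assoc, ← mul_assoc, h3, h3, h3, h3, minkowski_comm (u q β) (u q α)]
    push_cast
    ring
  rw [tracePair, h, RCLike.star_def, Complex.conj_ofReal]
  ring

theorem yangMills_of_cliffVec (q : V) (p : Fin 4 → V) (h : Fin 4 → Fin 4 → V) (v : V) :
    yangMills T q p h v =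
      ((∑ α, ∑ β, (sg α : ℝ) * (sg β : ℝ) *
        (-16 * Real.cos (2 * ζ) * minkowski (u (h α α) β - u (h α β) α) (u v β)
        + 64 * Real.cos (2 * ζ) ^ 2 *
          (minkowski (u q α) (u q α) * minkowski (u q β) (u v β)
          - minkowski (u q α) (u q β) * minkowski (u q α) (u v β))) : ℝ) : ℂ) := by
  rw [yangMills]
  push_cast
  refine Finset.sum_congr rfl fun α _ => Finset.sum_congr rfl fun β _ => ?_
  have h3 := trace_cliffVec_three ζ
  have h1 : (dcurvJet T q p h α α β * T v β).trace
      = ((-16 * Real.cos (2 * ζ) * minkowski (u (h α α) β - u (h α β) α) (u v β) : ℝ) : ℂ) := by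
    rw [← trace_cliffVec_mul, dcurvJet, map_sub]
    simp only [hT]
    simp only [add_mul _ _ (cliffVec ζ (u v β)), sub_mul _ _ (cliffVec ζ (u v β)),
      Matrix.trace_add, Matrix.trace_sub, h3]
    ring
  -- Invariance of the trace form turns the nested commutator into a product of two commutators, to
  -- which `trace_comm_mul_comm` applies.
  have h2 : ((T q α * curvJet T q p α β - curvJet T q p α β * T q α) * T v β).trace
      = (curvJet T q p α β * (T v β * T q α - T q α * T v β)).trace := by
    rw [sub_mul, mul_sub, Matrix.trace_sub, Matrix.trace_sub, mul_assoc, Matrix.trace_mul_comm,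
      mul_assoc, mul_assoc]
  have h4 : curvJet T q p α β = cliffVec ζ (u (p α) β - u (p β) α)
      + (cliffVec ζ (u q α) * cliffVec ζ (u q β) - cliffVec ζ (u q β) * cliffVec ζ (u q α)) := by
    rw [curvJet, hT, hT, hT, hT, map_sub, add_sub_assoc]
  rw [add_mul, Matrix.trace_add, h1, h2, h4, hT v β, hT q α, add_mul, Matrix.trace_add,
    trace_comm_mul_comm, mul_sub (cliffVec ζ (u (p α) β - u (p β) α)), Matrix.trace_sub,
    ← mul_assoc, ← mul_assoc, h3, h3, minkowski_comm (u q β) (u q α)]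
  push_cast
  ring

end FamilyVec

/-! The combinations of the matrices `Θ_{ρσ}` -/

/-- The matrix `f^{ρσ} Θ_{ρσ}`. -/
noncomputable def thetaTensor : (Fin 4 → Fin 4 → ℝ) →ₗ[ℝ] Mat where
  toFun f := ∑ ρ, ∑ σ, f ρ σ • theta [ρ, σ]
  map_add' m n := by simp [add_smul, Finset.sum_add_distrib]
  map_smul' r m := by simp [Finset.smul_sum, mul_smul]

theorem thetaTensor_apply (f : Fin 4 → Fin 4 → ℝ) :
    thetaTensor f = ∑ ρ, ∑ σ, f ρ σ • theta [ρ, σ] := rfl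

/-- For distinct indices in each pair this is the four-generator trace of R_σ R_ρ R_ν R_μ; the
contraction inside a pair is zero there. -/
theorem trace_theta_pair_mul (ρ σ μ ν : Fin 4) :
    (theta [ρ, σ] * theta [μ, ν]).trace
      = 16 * ((eta σ μ : ℂ) * eta ρ ν - eta σ ν * eta ρ μ) := by
  by_cases h1 : ρ = σ
  · subst h1
    rw [theta_self]
    simp
    ring
  by_cases h2 : μ = ν
  · subst h2
    rw [theta_self]
    simp
  rw [theta_pair h1, theta_pair h2, trace_four_of_anticomm (cliff_anticomm _ _)
    (cliff_anticomm _ _) (cliff_anticomm _ _) (cliff_anticomm _ _) (cliff_anticomm _ _)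
    (cliff_anticomm _ _)]
  have h3 : eta σ ρ = 0 := by rw [eta, Matrix.diagonal_apply_ne _ (Ne.symm h1)]
  rw [h3]
  push_cast
  ring

/-- The Minkowski inner product of antisymmetric tensors given by upper components. -/
def minkowski2 (f g : Fin 4 → Fin 4 → ℝ) : ℝ := ∑ ρ, ∑ σ, (sg ρ : ℝ) * (sg σ : ℝ) * f ρ σ * g ρ σ

theorem trace_thetaTensor_mul {f g : Fin 4 → Fin 4 → ℝ} (hg : g ∈ Antisym) :
    (thetaTensor f * thetaTensor g).trace = ((-32 * minkowski2 f g : ℝ) : ℂ) := by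
  have h : ∀ ρ σ, ∑ μ, ∑ ν, ((f ρ σ * g μ ν : ℝ) : ℂ) *
      (16 * ((eta σ μ : ℂ) * eta ρ ν - eta σ ν * eta ρ μ))
      = ((-32 * ((sg ρ : ℝ) * (sg σ : ℝ) * f ρ σ * g ρ σ) : ℝ) : ℂ) := by
    intro ρ σ
    have h1 : ∑ μ, ∑ ν, ((f ρ σ * g μ ν : ℝ) : ℂ) * (16 * ((eta σ μ : ℂ) * eta ρ ν))
        = ((16 * ((sg ρ : ℝ) * (sg σ : ℝ) * f ρ σ * g σ ρ) : ℝ) : ℂ) := by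
      simp only [eta, Matrix.diagonal_apply]
      simp
      ring
    have h2 : ∑ μ, ∑ ν, ((f ρ σ * g μ ν : ℝ) : ℂ) * (16 * ((eta σ ν : ℂ) * eta ρ μ))
        = ((16 * ((sg ρ : ℝ) * (sg σ : ℝ) * f ρ σ * g ρ σ) : ℝ) : ℂ) := by
      simp only [eta, Matrix.diagonal_apply]
      simp
      ring
    simp only [mul_sub, Finset.sum_sub_distrib, h1, h2, hg σ ρ]
    push_cast
    ring
  rw [thetaTensor_apply, thetaTensor_apply, Finset.sum_mul_sum, Matrix.trace_sum, minkowski2,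
    Finset.mul_sum, Complex.ofReal_sum]
  refine Finset.sum_congr rfl fun ρ _ => ?_
  simp only [Finset.sum_mul_sum, Matrix.trace_sum, smul_mul_smul_comm, Matrix.trace_smul,
    trace_theta_pair_mul, Complex.real_smul]
  rw [Finset.sum_comm, Finset.mul_sum, Complex.ofReal_sum]
  exact Finset.sum_congr rfl fun σ _ => h ρ σ

/-- The commutator of antisymmetric tensors, as endomorphisms. -/
def bracket (f g : Fin 4 → Fin 4 → ℝ) (ρ σ : Fin 4) : ℝ :=
  ∑ κ, (sg κ : ℝ) * (f ρ κ * g κ σ - g ρ κ * f κ σ)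

theorem bracket_mem {f g : Fin 4 → Fin 4 → ℝ} (hf : f ∈ Antisym) (hg : g ∈ Antisym) :
    bracket f g ∈ Antisym := by
  intro ρ σ
  rw [bracket, bracket, ← Finset.sum_neg_distrib]
  refine Finset.sum_congr rfl fun κ _ => ?_
  rw [hf ρ κ, hf κ σ, hg ρ κ, hg κ σ]
  ring

/-- Two anticommutations carry R_ν through the product. The result says that Θ_{ρσ} acts on the R_ν
as an infinitesimal Lorentz transformation. -/
theorem theta_pair_mul_cliff (ρ σ ν : Fin 4) :
    theta [ρ, σ] * cliff ν - cliff ν * theta [ρ, σ]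
      = (-2 * (eta ρ ν : ℂ)) • cliff σ + (2 * (eta σ ν : ℂ)) • cliff ρ := by
  by_cases h1 : ρ = σ
  · subst h1
    rw [theta_self, ← add_smul]
    simp
  rw [theta_pair h1]
  have h2 := congrArg (fun M => cliff σ * M) (cliff_anticomm ρ ν)
  have h3 := congrArg (fun M => M * cliff ρ) (cliff_anticomm σ ν)
  simp only [mul_add, add_mul, mul_smul_comm, smul_mul_assoc, mul_one, one_mul, ← mul_assoc]
    at h2 h3
  rw [← h2, eq_comm, ← sub_eq_zero, ← mul_assoc]
  have h4 : (2 * (eta σ ν : ℂ)) • cliff ρ = -((-2 * (eta σ ν : ℂ)) • cliff ρ) := by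
    rw [← neg_smul]
    congr 1
    ring
  rw [h4, ← h3]
  abel

theorem thetaTensor_mul_cliff {f : Fin 4 → Fin 4 → ℝ} (hf : f ∈ Antisym) (ν : Fin 4) :
    thetaTensor f * cliff ν - cliff ν * thetaTensor f
      = ∑ σ, (-4 * (sg ν : ℝ) * f ν σ) • cliff σ := by
  rw [thetaTensor_apply]
  simp only [Finset.sum_mul, Finset.mul_sum, smul_mul_assoc, mul_smul_comm,
    ← Finset.sum_sub_distrib, ← smul_sub, theta_pair_mul_cliff, smul_add, Finset.sum_add_distrib]
  have h1 : ∑ ρ, ∑ σ, f ρ σ • (-2 * (eta ρ ν : ℂ)) • cliff σ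
      = ∑ σ, (-2 * (sg ν : ℝ) * f ν σ) • cliff σ := by
    rw [Finset.sum_eq_single ν]
    · refine Finset.sum_congr rfl fun σ _ => ?_
      rw [eta, Matrix.diagonal_apply_eq, ← Complex.coe_smul, smul_smul, ← Complex.coe_smul]
      congr 1
      push_cast
      ring
    · intro ρ _ hρ
      simp [eta, Matrix.diagonal_apply_ne _ hρ]
    · simp
  have h2 : ∑ ρ, ∑ σ, f ρ σ • (2 * (eta σ ν : ℂ)) • cliff ρ
      = ∑ σ, (-2 * (sg ν : ℝ) * f ν σ) • cliff σ := by
    refine Finset.sum_congr rfl fun ρ _ => ?_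
    rw [Finset.sum_eq_single ν]
    · rw [eta, Matrix.diagonal_apply_eq, ← Complex.coe_smul, smul_smul, ← Complex.coe_smul,
        hf ρ ν]
      congr 1
      push_cast
      ring
    · intro σ _ hσ
      simp [eta, Matrix.diagonal_apply_ne _ hσ]
    · simp
  rw [h1, h2, ← Finset.sum_add_distrib]
  refine Finset.sum_congr rfl fun σ _ => ?_
  rw [← add_smul]
  congr 1
  ring

theorem thetaTensor_eq_sum_cliff {f : Fin 4 → Fin 4 → ℝ} (hf : f ∈ Antisym) :
    thetaTensor f = ∑ ρ, ∑ σ, f ρ σ • (cliff σ * cliff ρ) := by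
  rw [thetaTensor_apply]
  refine Finset.sum_congr rfl fun ρ _ => Finset.sum_congr rfl fun σ _ => ?_
  by_cases h : ρ = σ
  · subst h
    have : f ρ ρ = 0 := by linarith [hf ρ ρ]
    simp [this]
  · rw [theta_pair h]

/-- Commutation with f is a derivation whose action on each R_ν is known, so it can be applied
factor by factor to the products R_σ R_ρ that make up g. The curvature therefore stays in the span
of the Θ_{ρσ}. -/
theorem thetaTensor_comm {f g : Fin 4 → Fin 4 → ℝ} (hf : f ∈ Antisym) (hg : g ∈ Antisym) :
    thetaTensor f * thetaTensor g - thetaTensor g * thetaTensor f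
      = thetaTensor ((4 : ℝ) • bracket f g) := by
  have h1 : ∀ ρ σ, thetaTensor f * (cliff σ * cliff ρ) - cliff σ * cliff ρ * thetaTensor f
      = ∑ κ, (-4 * (sg σ : ℝ) * f σ κ) • (cliff κ * cliff ρ)
        + ∑ κ, (-4 * (sg ρ : ℝ) * f ρ κ) • (cliff σ * cliff κ) := by
    intro ρ σ
    have e1 := congrArg (fun M => M * cliff ρ) (thetaTensor_mul_cliff hf σ)
    have e2 := congrArg (fun M => cliff σ * M) (thetaTensor_mul_cliff hf ρ)
    simp only [sub_mul, mul_sub, Finset.sum_mul, Finset.mul_sum, smul_mul_assoc,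
      mul_smul_comm] at e1 e2
    rw [← e1, ← e2]
    simp only [mul_assoc]
    abel
  rw [map_smul, thetaTensor_eq_sum_cliff hg, thetaTensor_eq_sum_cliff (bracket_mem hf hg)]
  simp only [Finset.mul_sum, Finset.sum_mul, mul_smul_comm, smul_mul_assoc,
    ← Finset.sum_sub_distrib, ← smul_sub, h1, smul_add, Finset.sum_add_distrib, Finset.smul_sum,
    bracket, Finset.sum_smul, mul_sub, sub_smul]
  have h2 : ∑ ρ, ∑ σ, ∑ κ, g ρ σ • (-4 * (sg σ : ℝ) * f σ κ) • (cliff κ * cliff ρ)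
      = -∑ ρ, ∑ σ, ∑ κ, (4 : ℝ) • ((sg κ : ℝ) * (g ρ κ * f κ σ)) • (cliff σ * cliff ρ) := by
    rw [← Finset.sum_neg_distrib]
    refine Finset.sum_congr rfl fun ρ _ => ?_
    rw [Finset.sum_comm, ← Finset.sum_neg_distrib]
    refine Finset.sum_congr rfl fun σ _ => ?_
    rw [← Finset.sum_neg_distrib]
    refine Finset.sum_congr rfl fun κ _ => ?_
    rw [smul_smul, smul_smul, ← neg_smul]
    congr 1
    ring
  have h3 : ∑ ρ, ∑ σ, ∑ κ, g ρ σ • (-4 * (sg ρ : ℝ) * f ρ κ) • (cliff σ * cliff κ)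
      = ∑ ρ, ∑ σ, ∑ κ, (4 : ℝ) • ((sg κ : ℝ) * (f ρ κ * g κ σ)) • (cliff σ * cliff ρ) := by
    have e1 : ∀ ρ : Fin 4, ∑ σ, ∑ κ, g ρ σ • (-4 * (sg ρ : ℝ) * f ρ κ) • (cliff σ * cliff κ)
        = ∑ κ, ∑ σ, g ρ σ • (-4 * (sg ρ : ℝ) * f ρ κ) • (cliff σ * cliff κ) :=
      fun ρ => Finset.sum_comm
    simp only [e1]
    rw [Finset.sum_comm]
    refine Finset.sum_congr rfl fun κ _ => ?_
    rw [Finset.sum_comm]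
    refine Finset.sum_congr rfl fun σ _ => Finset.sum_congr rfl fun ρ _ => ?_
    rw [smul_smul, smul_smul, hf ρ κ]
    congr 1
    ring
  rw [h2, h3]
  simp only [smul_sub, Finset.sum_sub_distrib]
  abel

theorem antisym_add {f g : Fin 4 → Fin 4 → ℝ} (hf : f ∈ Antisym) (hg : g ∈ Antisym) :
    f + g ∈ Antisym := fun ρ σ => by
  rw [Pi.add_apply, Pi.add_apply, hf ρ σ, hg ρ σ]
  simp
  ring

theorem antisym_smul {f : Fin 4 → Fin 4 → ℝ} (r : ℝ) (hf : f ∈ Antisym) :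
    r • f ∈ Antisym := fun ρ σ => by
  rw [Pi.smul_apply, Pi.smul_apply, hf ρ σ]
  simp

theorem antisym_sub {f g : Fin 4 → Fin 4 → ℝ} (hf : f ∈ Antisym) (hg : g ∈ Antisym) :
    f - g ∈ Antisym := fun ρ σ => by
  rw [Pi.sub_apply, Pi.sub_apply, hf ρ σ, hg ρ σ]
  simp
  ring

section FamilyTensor

variable {V : Type*} {u : V → Fin 4 → Fin 4 → Fin 4 → ℝ} (hu : ∀ v α, u v α ∈ Antisym)

/-- The components of the curvature. -/
def strength (u : V → Fin 4 → Fin 4 → Fin 4 → ℝ) (q : V) (p : Fin 4 → V) (α β : Fin 4) :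
    Fin 4 → Fin 4 → ℝ :=
  u (p α) β - u (p β) α + (4 : ℝ) • bracket (u q α) (u q β)

/-- The components of the covariant derivative of the curvature, contracted in the first index up
to the summation. -/
def dstrength (u : V → Fin 4 → Fin 4 → Fin 4 → ℝ) (q : V) (p : Fin 4 → V)
    (h : Fin 4 → Fin 4 → V) (α β : Fin 4) : Fin 4 → Fin 4 → ℝ :=
  u (h α α) β - u (h α β) α + (4 : ℝ) • bracket (u (p α) α) (u q β)
    + (4 : ℝ) • bracket (u q α) (u (p α) β) + (4 : ℝ) • bracket (u q α) (strength u q p α β)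

include hu in
theorem strength_mem (q : V) (p : Fin 4 → V) (α β : Fin 4) : strength u q p α β ∈ Antisym :=
  antisym_add (antisym_sub (hu _ _) (hu _ _)) (antisym_smul _ (bracket_mem (hu _ _) (hu _ _)))

variable [NormedAddCommGroup V] [NormedSpace ℝ V] {T : V →ₗ[ℝ] (Fin 4 → Mat)}
  (hT : ∀ v α, T v α = thetaTensor (u v α))

include hu hT

theorem curvJet_of_thetaTensor (q : V) (p : Fin 4 → V) (α β : Fin 4) :
    curvJet T q p α β = thetaTensor (strength u q p α β) := by
  rw [curvJet, strength, map_add, map_sub, ← thetaTensor_comm (hu _ _) (hu _ _), hT, hT, hT, hT,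
    add_sub_assoc]

theorem tracePair_of_thetaTensor (q : V) (p : Fin 4 → V) :
    (1 / 2) * tracePair (curvJet T q p) (curvJet T q p) =
      ((-32 * ∑ α, ∑ β, (sg α : ℝ) * (sg β : ℝ) *
        minkowski2 (strength u q p α β) (strength u q p α β) : ℝ) : ℂ) := by
  have h : ∑ α, ∑ β, (sg α : ℂ) * (sg β : ℂ) * (curvJet T q p α β * curvJet T q p α β).trace
      = ((-32 * ∑ α, ∑ β, (sg α : ℝ) * (sg β : ℝ) *
        minkowski2 (strength u q p α β) (strength u q p α β) : ℝ) : ℂ) := by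
    simp only [Finset.mul_sum]
    push_cast
    refine Finset.sum_congr rfl fun α _ => Finset.sum_congr rfl fun β _ => ?_
    rw [curvJet_of_thetaTensor hu hT, trace_thetaTensor_mul (strength_mem hu _ _ _ _)]
    push_cast
    ring
  rw [tracePair, h, RCLike.star_def, Complex.conj_ofReal]
  ring

/-- Closure under commutators makes the covariant divergence a combination of the Θ_{ρσ} with
components `dstrength`; the invariant trace form then gives the pairing. -/
theorem yangMills_of_thetaTensor (q : V) (p : Fin 4 → V) (h : Fin 4 → Fin 4 → V) (v : V) :
    yangMills T q p h v =
      ((-32 * ∑ α, ∑ β, (sg α : ℝ) * (sg β : ℝ) *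
        minkowski2 (dstrength u q p h α β) (u v β) : ℝ) : ℂ) := by
  rw [yangMills]
  simp only [Finset.mul_sum]
  push_cast
  refine Finset.sum_congr rfl fun α _ => Finset.sum_congr rfl fun β _ => ?_
  have h1 : dcurvJet T q p h α α β + (T q α * curvJet T q p α β - curvJet T q p α β * T q α)
      = thetaTensor (dstrength u q p h α β) := by
    rw [curvJet_of_thetaTensor hu hT, dstrength, map_add, map_add, map_add, map_sub,
      ← thetaTensor_comm (hu _ _) (hu _ _), ← thetaTensor_comm (hu _ _) (hu _ _),
      ← thetaTensor_comm (hu _ _) (strength_mem hu _ _ _ _), dcurvJet]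
    simp only [hT]
    abel
  rw [h1, hT, trace_thetaTensor_mul (hu _ _)]
  push_cast
  ring

end FamilyTensor

/-! The multiples of `i e^{ζ𝒥}` -/

/-- Since 𝒥² = -1, the exponential doubles its angle when squared; 𝒥 has trace zero and the identity
has trace 16. -/
theorem trace_I_expJ_sq (ζ : ℝ) : (Complex.I • expJ ζ * Complex.I • expJ ζ).trace
    = ((-16 * Real.cos (2 * ζ) : ℝ) : ℂ) := by
  have h : expJ ζ * expJ ζ = (Real.cos (2 * ζ) : ℂ) • 1 + (Real.sin (2 * ζ) : ℂ) • calJ := by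
    rw [expJ, add_mul, mul_add, mul_add]
    simp only [smul_mul_smul_comm, mul_one, one_mul, calJ_mul_calJ, smul_neg]
    rw [Real.cos_two_mul', Real.sin_two_mul]
    push_cast
    module
  rw [smul_mul_smul_comm, h, Complex.I_mul_I, Matrix.trace_smul, Matrix.trace_add,
    Matrix.trace_smul, Matrix.trace_smul, trace_calJ, trace_one_mat]
  simp
  ring

section FamilyAbelian

variable {V : Type*} [NormedAddCommGroup V] [NormedSpace ℝ V] {T : V →ₗ[ℝ] (Fin 4 → Mat)} {ζ : ℝ}
  {u : V → Fin 4 → ℝ} (hT : ∀ v α, T v α = u v α • Complex.I • expJ ζ)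
include hT

/-- All components are multiples of one matrix, so the commutators vanish. -/
theorem curvJet_of_expJ (q : V) (p : Fin 4 → V) (α β : Fin 4) :
    curvJet T q p α β = (u (p α) β - u (p β) α) • Complex.I • expJ ζ := by
  simp only [curvJet, hT, smul_mul_assoc, mul_smul_comm]
  module

theorem tracePair_of_expJ (q : V) (p : Fin 4 → V) :
    (1 / 2) * tracePair (curvJet T q p) (curvJet T q p) =
      ((-16 * Real.cos (2 * ζ) * ∑ α, ∑ β, (sg α : ℝ) * (sg β : ℝ) *
        (u (p α) β - u (p β) α) ^ 2 : ℝ) : ℂ) := by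
  have h : ∑ α, ∑ β, (sg α : ℂ) * (sg β : ℂ) * (curvJet T q p α β * curvJet T q p α β).trace
      = ((-16 * Real.cos (2 * ζ) * ∑ α, ∑ β, (sg α : ℝ) * (sg β : ℝ) *
        (u (p α) β - u (p β) α) ^ 2 : ℝ) : ℂ) := by
    simp only [Finset.mul_sum, Complex.ofReal_sum]
    refine Finset.sum_congr rfl fun α _ => Finset.sum_congr rfl fun β _ => ?_
    rw [curvJet_of_expJ hT, smul_mul_smul_comm, Matrix.trace_smul, trace_I_expJ_sq,
      Complex.real_smul]
    push_cast
    ring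
  rw [tracePair, h, RCLike.star_def, Complex.conj_ofReal]
  ring

theorem yangMills_of_expJ (q : V) (p : Fin 4 → V) (h : Fin 4 → Fin 4 → V) (v : V) :
    yangMills T q p h v =
      ((-16 * Real.cos (2 * ζ) * ∑ α, ∑ β, (sg α : ℝ) * (sg β : ℝ) *
        ((u (h α α) β - u (h α β) α) * u v β) : ℝ) : ℂ) := by
  rw [yangMills]
  simp only [Finset.mul_sum, Complex.ofReal_sum]
  refine Finset.sum_congr rfl fun α _ => Finset.sum_congr rfl fun β _ => ?_
  have h1 : dcurvJet T q p h α α β + (T q α * curvJet T q p α β - curvJet T q p α β * T q α)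
      = (u (h α α) β - u (h α β) α) • Complex.I • expJ ζ := by
    rw [dcurvJet, curvJet_of_expJ hT]
    simp only [hT, smul_mul_assoc, mul_smul_comm]
    module
  rw [h1, hT, smul_mul_smul_comm, Matrix.trace_smul, trace_I_expJ_sq, Complex.real_smul]
  push_cast
  ring

end FamilyAbelian

/-! Components of derivatives -/

theorem pd_const_mul {f : Spacetime → ℝ} {x : Spacetime} (α : Fin 4)
    (hf : DifferentiableAt ℝ f x) (r : ℝ) : pd α (fun y => r * f y) x = r * pd α f x :=
  pd_const_smul α hf r

theorem pdU_eq (α : Fin 4) (f : Spacetime → ℝ) : pdU α f = fun x => (sg α : ℝ) * pd α f x := rfl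

theorem pd_pdU {f : Spacetime → ℝ} (hf : ContDiff ℝ ∞ f) (γ α : Fin 4) (x : Spacetime) :
    pd γ (pdU α f) x = (sg α : ℝ) * pd γ (pd α f) x :=
  pd_const_mul γ (differentiable_of_smooth (contDiff_pd hf α) x) _

theorem box_eq {f : Spacetime → ℝ} (hf : ContDiff ℝ ∞ f) (x : Spacetime) :
    box f x = ∑ α, (sg α : ℝ) * pd α (pd α f) x :=
  Finset.sum_congr rfl fun α _ => pd_pdU hf α α x

theorem contDiff_up1 {B : Spacetime → Fin 4 → ℝ} (hB : ContDiff ℝ ∞ B) (α : Fin 4) :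
    ContDiff ℝ ∞ (up1 B α) := contDiff_pi.1 hB α

theorem contDiff_low1 {B : Spacetime → Fin 4 → ℝ} (hB : ContDiff ℝ ∞ B) (α : Fin 4) :
    ContDiff ℝ ∞ (low1 B α) := contDiff_const.mul (contDiff_up1 hB α)

theorem contDiff_up2 {W : Spacetime → Fin 4 → Fin 4 → ℝ} (hW : ContDiff ℝ ∞ W) (α β : Fin 4) :
    ContDiff ℝ ∞ (up2 W α β) := contDiff_pi.1 (contDiff_pi.1 hW α) β

theorem contDiff_low2 {W : Spacetime → Fin 4 → Fin 4 → ℝ} (hW : ContDiff ℝ ∞ W) (α β : Fin 4) :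
    ContDiff ℝ ∞ (low2 W α β) := contDiff_const.mul (contDiff_up2 hW α β)

theorem contDiff_low3 {F : Spacetime → Fin 4 → Fin 4 → Fin 4 → ℝ} (hF : ContDiff ℝ ∞ F)
    (α ρ σ : Fin 4) : ContDiff ℝ ∞ (low3 F α ρ σ) :=
  contDiff_const.mul (contDiff_pi.1 (contDiff_pi.1 (contDiff_pi.1 hF α) ρ) σ)

theorem pd_up1 {B : Spacetime → Fin 4 → ℝ} (hB : ContDiff ℝ ∞ B) (γ α : Fin 4) :
    pd γ (up1 B α) = up1 (pd γ B) α :=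
  funext fun x => pd_linear (LinearMap.proj α : (Fin 4 → ℝ) →ₗ[ℝ] ℝ)
    (differentiable_of_smooth hB x) γ

theorem pd_low1 {B : Spacetime → Fin 4 → ℝ} (hB : ContDiff ℝ ∞ B) (γ α : Fin 4) :
    pd γ (low1 B α) = low1 (pd γ B) α :=
  funext fun x => (pd_const_mul γ (differentiable_of_smooth (contDiff_up1 hB α) x) _).trans
    (congrArg _ (congrFun (pd_up1 hB γ α) x))

theorem pd_up2 {W : Spacetime → Fin 4 → Fin 4 → ℝ} (hW : ContDiff ℝ ∞ W) (γ α β : Fin 4) :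
    pd γ (up2 W α β) = up2 (pd γ W) α β :=
  funext fun x => pd_linear ((LinearMap.proj β : (Fin 4 → ℝ) →ₗ[ℝ] ℝ) ∘ₗ
    (LinearMap.proj α : (Fin 4 → Fin 4 → ℝ) →ₗ[ℝ] (Fin 4 → ℝ))) (differentiable_of_smooth hW x) γ

theorem pd_low2 {W : Spacetime → Fin 4 → Fin 4 → ℝ} (hW : ContDiff ℝ ∞ W) (γ α β : Fin 4) :
    pd γ (low2 W α β) = low2 (pd γ W) α β :=
  funext fun x => (pd_const_mul γ (differentiable_of_smooth (contDiff_up2 hW α β) x) _).trans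
    (congrArg _ (congrFun (pd_up2 hW γ α β) x))

theorem pd_low3 {F : Spacetime → Fin 4 → Fin 4 → Fin 4 → ℝ} (hF : ContDiff ℝ ∞ F)
    (γ α ρ σ : Fin 4) : pd γ (low3 F α ρ σ) = low3 (pd γ F) α ρ σ :=
  funext fun x => pd_linear ((((sg α : ℝ) * (sg ρ : ℝ) * (sg σ : ℝ)) •
    (LinearMap.proj σ : (Fin 4 → ℝ) →ₗ[ℝ] ℝ)) ∘ₗ
    (LinearMap.proj ρ : (Fin 4 → Fin 4 → ℝ) →ₗ[ℝ] (Fin 4 → ℝ)) ∘ₗ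
    (LinearMap.proj α : (Fin 4 → Fin 4 → Fin 4 → ℝ) →ₗ[ℝ] (Fin 4 → Fin 4 → ℝ)))
    (differentiable_of_smooth hF x) γ

/-! ### Tools shared by the six cases -/

theorem sg_zero : sg 0 = 1 := rfl
theorem sg_one : sg 1 = -1 := rfl
theorem sg_two : sg 2 = -1 := rfl
theorem sg_three : sg 3 = -1 := rfl

theorem sg_mul_sg (α : Fin 4) : (sg α : ℝ) * sg α = 1 := by
  fin_cases α <;> simp [sg]

/-- The force field with components `X (u v α)`. -/
noncomputable def forceOf {V W : Type*} [AddCommGroup V] [Module ℝ V] [AddCommGroup W] [Module ℝ W]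
    (X : W →ₗ[ℝ] Mat) (u : V →ₗ[ℝ] Fin 4 → W) : V →ₗ[ℝ] (Fin 4 → Mat) :=
  LinearMap.pi fun α => X ∘ₗ LinearMap.proj α ∘ₗ u

theorem cliffVec_mem (ζ : ℝ) (m : Fin 4 → ℝ) : cliffVec ζ m ∈ forceMat :=
  Submodule.sum_mem _ fun μ _ => Submodule.smul_mem _ _ (expIJ_mul_cliff_mem ζ μ)

theorem thetaTensor_mem (f : Fin 4 → Fin 4 → ℝ) : thetaTensor f ∈ forceMat :=
  Submodule.sum_mem _ fun ρ _ => Submodule.sum_mem _ fun σ _ =>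
    Submodule.smul_mem _ _ (theta_pair_mem ρ σ)

theorem source_sum {ι : Type*} (s : Finset ι) (ψ : Spinor) (θ : ι → Fin 4 → Mat) :
    source ψ (∑ i ∈ s, θ i) = ∑ i ∈ s, source ψ (θ i) := by
  classical
  induction s using Finset.induction_on with
  | empty => simp [source, herm]
  | insert a s ha ih => rw [Finset.sum_insert ha, Finset.sum_insert ha, source_add, ih]

/-- A real Yang-Mills pairing equals its conjugate, which doubles 2τ to 4τ. This applies in all six
cases. -/
theorem eulerLagrange_of_real {V : Type*} [NormedAddCommGroup V] [NormedSpace ℝ V]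
    {T : V →ₗ[ℝ] (Fin 4 → Mat)} {q : V} {p : Fin 4 → V} {h : Fin 4 → Fin 4 → V} {v : V} {r : ℝ}
    (hr : yangMills T q p h v = r) (τ : ℝ) (ψ : Spinor) :
    eulerLagrange T τ ψ q p h v = source ψ (T v) + 4 * τ * r := by
  rw [eulerLagrange, hr, RCLike.star_def, Complex.conj_ofReal]
  ring

theorem sub_eq_zero_iff_eq_one_div_mul {k : ℝ} (hk : k ≠ 0) (z L : ℂ) :
    z - k * L = 0 ↔ L = ((1 / k : ℝ) : ℂ) * z := by
  have : (k : ℂ) ≠ 0 := by exact_mod_cast hk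
  rw [sub_eq_zero]
  push_cast
  constructor
  · rintro rfl
    field_simp
  · rintro rfl
    field_simp

/-! The scalar field -/

noncomputable def scalarComp : ℝ →ₗ[ℝ] Fin 4 → Fin 4 → ℝ where
  toFun φ α μ := if α = μ then φ else 0
  map_add' φ χ := by
    ext α μ
    by_cases h : α = μ <;> simp [h]
  map_smul' r φ := by
    ext α μ
    by_cases h : α = μ <;> simp [h]

theorem uTensor_apply (α : Fin 4) : uTensor α = cliff α := by
  simp [uTensor, basisTensor, theta_single, Finset.sum_apply]

theorem scalarForce_eq (ζ φ : ℝ) :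
    scalarForce ζ φ = forceOf (cliffVec ζ) scalarComp φ := by
  funext α
  simp [scalarForce, forceOf, cliffVec_apply, scalarComp, matAct, uTensor_apply]

theorem source_scalarForce (ζ φ : ℝ) (ψ : Spinor) :
    source ψ (scalarForce ζ φ)
      = φ * herm ψ ((∑ α, gammaUp α * expIJ ζ * theta [α]) *ᵥ ψ) := by
  rw [scalarForce, source_smul, source]
  simp only [matAct, uTensor_apply, theta_single, mul_assoc]

theorem scalar_case (m τ ζ : ℝ) {ψ : Spacetime → Spinor} (hψ : ContDiff ℝ ∞ ψ)
    {φ : Spacetime → ℝ} (hφ : ContDiff ℝ ∞ φ) :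
    (∀ x, IsForceTensor (scalarForce ζ (φ x))) ∧
      (∀ x, LV (fun y => scalarForce ζ (φ y)) x = (scalarPotential ζ φ x : ℂ)) ∧
      (τ ≠ 0 → Real.cos (2 * ζ) ≠ 0 →
        (IsStationaryAt Set.univ (fun q => Ltot m τ ψ (fun y => scalarForce ζ (q y))) φ ↔
          ∀ x, ScalarEquation ζ τ ψ φ x)) := by
  have hF : ∀ v, IsForceTensor (forceOf (cliffVec ζ) scalarComp v) := fun v =>
    isForceTensor_iff.2 fun α => cliffVec_mem ζ _
  have hT : ∀ v α, forceOf (cliffVec ζ) scalarComp v α = cliffVec ζ (scalarComp v α) :=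
    fun _ _ => rfl
  refine ⟨fun x => scalarForce_eq ζ (φ x) ▸ hF _, fun x => ?_, fun hτ hc => ?_⟩
  · simp only [scalarForce_eq]
    rw [LV_eq_tracePair _ hφ, tracePair_of_cliffVec hT]
    congr 1
    simp [Fin.sum_univ_four, minkowski, scalarComp, scalarPotential, pdU, sg_zero, sg_one, sg_two,
      sg_three]
    ring
  · have hk : 192 * τ * Real.cos (2 * ζ) ≠ 0 := by positivity
    simp only [scalarForce_eq]
    rw [isStationaryAt_iff hF (fun _ _ _ => Set.mem_univ _) m τ hψ hφ]
    refine forall_congr' fun x => ?_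
    -- The constant 192 is 4 · 16 · 3: the factor 4τ, the trace 16, and 4 - 1 from contracting the
    -- curl of φ δ.
    have h1 : ∀ v, eulerLagrange (forceOf (cliffVec ζ) scalarComp) τ (ψ x) (φ x)
        (fun γ => pd γ φ x) (fun γ α => pd γ (fun y => pd α φ y) x) v
        = v * (herm (ψ x) ((∑ α, gammaUp α * expIJ ζ * theta [α]) *ᵥ ψ x) -
          (192 * τ * Real.cos (2 * ζ) : ℝ) *
            ((box φ x - 16 * Real.cos (2 * ζ) * φ x ^ 3 : ℝ) : ℂ)) := by
      intro v
      rw [eulerLagrange_of_real (yangMills_of_cliffVec hT _ _ _ _), ← scalarForce_eq,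
        source_scalarForce, mul_sub, sub_eq_add_neg]
      congr 1
      norm_cast
      rw [box_eq hφ]
      simp [Fin.sum_univ_four, minkowski, scalarComp, sg_zero, sg_one, sg_two, sg_three]
      ring
    simp only [h1, Set.mem_univ, forall_const]
    rw [ScalarEquation, ← sub_eq_zero_iff_eq_one_div_mul hk]
    constructor
    · intro h
      simpa using h 1
    · intro h v
      rw [h, mul_zero]

/-! The vector field of the second type -/

noncomputable def imVectorComp : (Fin 4 → ℝ) →ₗ[ℝ] Fin 4 → ℝ where
  toFun A α := (sg α : ℝ) * A α
  map_add' φ χ := by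
    ext α
    simp [mul_add]
  map_smul' r φ := by
    ext α
    simp [mul_left_comm]

theorem wTensor_apply (α β : Fin 4) : wTensor α β = (Complex.I * (eta α β : ℂ)) • 1 := by
  simp [wTensor, basisTensor, theta_nil, Finset.sum_apply, smul_smul]

theorem imVectorForce_eq (ζ : ℝ) (A : Fin 4 → ℝ) : imVectorForce ζ A
    = forceOf (LinearMap.toSpanSingleton ℝ Mat (Complex.I • expJ ζ)) imVectorComp A := by
  funext α
  simp only [imVectorForce, forceOf, imVectorComp, Finset.sum_apply, Pi.smul_apply, matAct,
    wTensor_apply]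
  rw [Finset.sum_eq_single α]
  · simp only [eta, Matrix.diagonal_apply_eq, mul_smul_comm, mul_one, smul_smul]
    simp [← Complex.coe_smul, smul_smul]
    congr 1
    ring
  · intro β _ hβ
    simp [eta, Matrix.diagonal_apply_ne _ hβ]
  · simp

theorem source_imVectorForce (ζ : ℝ) (A : Fin 4 → ℝ) (ψ : Spinor) :
    source ψ (imVectorForce ζ A)
      = ∑ α, (A α : ℂ) * (Complex.I * herm ψ ((gamma α * expJ ζ) *ᵥ ψ)) := by
  rw [imVectorForce, source_sum]
  refine Finset.sum_congr rfl fun α _ => ?_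
  have h1 : ∑ γ, gammaUp γ * matAct (expJ ζ) (wTensor α) γ = Complex.I • (gamma α * expJ ζ) := by
    rw [Finset.sum_eq_single α]
    · have h : (sg α : ℂ) * sg α = 1 := by exact_mod_cast congrArg (Complex.ofReal) (sg_mul_sg α)
      simp only [matAct, wTensor_apply, eta, Matrix.diagonal_apply_eq, gammaUp, mul_smul_comm,
        smul_mul_assoc, mul_one, smul_smul]
      congr 1
      linear_combination Complex.I * h
    · intro β _ hβ
      simp [matAct, wTensor_apply, eta, Matrix.diagonal_apply_ne _ hβ.symm]
    · simp
  rw [source_smul, source, h1, Matrix.smul_mulVec, herm_smul]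

theorem forall_sum_mul_eq_zero_iff {ι : Type*} [Fintype ι] (z : ι → ℂ) :
    (∀ v ∈ (Set.univ : Set (ι → ℝ)), ∑ α, (v α : ℂ) * z α = 0) ↔ ∀ α, z α = 0 := by
  classical
  constructor
  · intro h α
    have := h (Pi.single α 1) trivial
    rw [Finset.sum_eq_single α (fun β _ hβ => by simp [hβ]) (by simp)] at this
    simpa using this
  · intro h v _
    simp [h]

theorem imVector_case (m τ ζ : ℝ) {ψ : Spacetime → Spinor} (hψ : ContDiff ℝ ∞ ψ)
    {A : Spacetime → Fin 4 → ℝ} (hA : ContDiff ℝ ∞ A) :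
    (∀ x, IsForceTensor (imVectorForce ζ (A x))) ∧
      (∀ x, LV (fun y => imVectorForce ζ (A y)) x = (imVectorPotential ζ A x : ℂ)) ∧
      (τ ≠ 0 → Real.cos (2 * ζ) ≠ 0 →
        (IsStationaryAt Set.univ (fun q => Ltot m τ ψ (fun y => imVectorForce ζ (q y))) A ↔
          ∀ x, ImVectorEquation ζ τ ψ A x)) := by
  set T := forceOf (LinearMap.toSpanSingleton ℝ Mat (Complex.I • expJ ζ)) imVectorComp with hTdef
  have hF : ∀ v, IsForceTensor (T v) := fun v =>
    isForceTensor_iff.2 fun α => Submodule.smul_mem _ _ (I_smul_expJ_mem ζ)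
  have hT : ∀ v α, T v α = imVectorComp v α • Complex.I • expJ ζ := fun _ _ => rfl
  have hTf : ∀ v, imVectorForce ζ v = T v := imVectorForce_eq ζ
  refine ⟨fun x => hTf (A x) ▸ hF _, fun x => ?_, fun hτ hc => ?_⟩
  · simp only [hTf]
    rw [LV_eq_tracePair _ hA, tracePair_of_expJ hT]
    congr 1
    simp [Fin.sum_univ_four, imVectorComp, imVectorPotential, pdU, pd_up1 hA, pd_low1 hA, up1, low1,
      sg_zero, sg_one, sg_two, sg_three]
    ring
  · have hk : 64 * τ * Real.cos (2 * ζ) ≠ 0 := by positivity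
    simp only [hTf]
    rw [isStationaryAt_iff hF (fun _ _ _ => Set.mem_univ _) m τ hψ hA]
    refine forall_congr' fun x => ?_
    have h1 : ∀ v, eulerLagrange T τ (ψ x) (A x)
        (fun γ => pd γ A x) (fun γ α => pd γ (fun y => pd α A y) x) v
        = ∑ α, (v α : ℂ) * (Complex.I * herm (ψ x) ((gamma α * expJ ζ) *ᵥ ψ x) -
          (64 * τ * Real.cos (2 * ζ) : ℝ) *
            ((box (low1 A α) x - ∑ β, pd α (pd β (up1 A β)) x : ℝ) : ℂ)) := by
      intro v
      rw [eulerLagrange_of_real (yangMills_of_expJ hT _ _ _ _), ← hTf,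
        source_imVectorForce]
      simp only [mul_sub, Finset.sum_sub_distrib]
      rw [sub_eq_add_neg]
      congr 1
      have hs := pd_pd_comm hA
      simp only [box_eq (contDiff_low1 hA _), pd_low1 hA, pd_up1 hA, pd_low1 (contDiff_pd hA _),
        pd_up1 (contDiff_pd hA _)]
      norm_cast
      simp [Fin.sum_univ_four, imVectorComp, sg_zero, sg_one, sg_two, sg_three, up1, low1,
        hs 1 0, hs 2 0, hs 3 0, hs 2 1, hs 3 1, hs 3 2]
      ring
    simp only [h1]
    rw [forall_sum_mul_eq_zero_iff, ImVectorEquation]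
    refine forall_congr' fun α => ?_
    rw [sub_eq_zero_iff_eq_one_div_mul hk, mul_left_comm, ← mul_assoc]

/-! ### Component form of the Yang-Mills pairing, and symmetric test tensors -/

/-- The field equation of a force field of the form `u_α^μ (cos ζ + i sin ζ 𝒥) Θ_μ`, up to
coupling constants. -/
noncomputable def vecEquation {V : Type*} (u : V → Fin 4 → Fin 4 → ℝ) (k : ℝ) (q : V)
    (h : Fin 4 → Fin 4 → V) (β μ : Fin 4) : ℝ :=
  ∑ α, (sg α : ℝ) * sg β * sg μ *
    (-16 * k * (u (h α α) β μ - u (h α β) α μ)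
      + 64 * k ^ 2 * (minkowski (u q α) (u q α) * u q β μ - minkowski (u q α) (u q β) * u q α μ))

/-- Expanding the inner products isolates the components of the test value as linear factors, so
that a field equation can be read off as their coefficient. -/
theorem yangMills_eq_vecEquation {V : Type*} [NormedAddCommGroup V] [NormedSpace ℝ V]
    {T : V →ₗ[ℝ] (Fin 4 → Mat)} {ζ : ℝ} {u : V → Fin 4 → Fin 4 → ℝ}
    (hT : ∀ v α, T v α = cliffVec ζ (u v α)) (q : V) (p : Fin 4 → V) (h : Fin 4 → Fin 4 → V)
    (v : V) : yangMills T q p h v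
      = ((∑ β, ∑ μ, u v β μ * vecEquation u (Real.cos (2 * ζ)) q h β μ : ℝ) : ℂ) := by
  rw [yangMills_of_cliffVec hT, Finset.sum_comm]
  congr 1
  refine Finset.sum_congr rfl fun β _ => ?_
  simp only [vecEquation, Finset.mul_sum]
  rw [Finset.sum_comm]
  refine Finset.sum_congr rfl fun α _ => ?_
  have h1 : ∀ m, minkowski m (u v β) = ∑ μ, (sg μ : ℝ) * m μ * u v β μ := fun _ => rfl
  rw [h1, h1, h1]
  simp only [Finset.mul_sum, ← Finset.sum_sub_distrib, ← Finset.sum_add_distrib, Pi.sub_apply]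
  refine Finset.sum_congr rfl fun μ _ => ?_
  ring

theorem linear_pd_eq_zero {V : Type*} [NormedAddCommGroup V] [NormedSpace ℝ V]
    [FiniteDimensional ℝ V] (l : V →ₗ[ℝ] ℝ) {q : Spacetime → V} (hq : ContDiff ℝ ∞ q)
    (h : ∀ x, l (q x) = 0) (γ : Fin 4) (x : Spacetime) : l (pd γ q x) = 0 := by
  rw [← pd_linear l (differentiable_of_smooth hq x) γ]
  simp [h, pd]

/-- A matrix of coefficients as a linear functional. -/
def pairing2 (c : Fin 4 → Fin 4 → ℝ) : (Fin 4 → Fin 4 → ℝ) →ₗ[ℝ] ℝ where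
  toFun v := ∑ a, ∑ b, c a b * v a b
  map_add' v w := by simp [mul_add, Finset.sum_add_distrib]
  map_smul' r v := by simp [Finset.mul_sum, mul_left_comm]

theorem pd_apply2 {W : Spacetime → Fin 4 → Fin 4 → ℝ} (hW : ContDiff ℝ ∞ W) (γ α β : Fin 4)
    (x : Spacetime) : pd γ W x α β = pd γ (fun y => W y α β) x :=
  (congrFun (pd_up2 hW γ α β) x).symm

theorem symTraceless_pd {S : Spacetime → Fin 4 → Fin 4 → ℝ} (hS : ContDiff ℝ ∞ S)
    (h : ∀ x, S x ∈ SymTraceless) (γ : Fin 4) (x : Spacetime) : pd γ S x ∈ SymTraceless := by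
  refine ⟨fun α β => ?_, ?_⟩
  · rw [pd_apply2 hS, pd_apply2 hS]
    congr 1
    exact funext fun y => (h y).1 α β
  · exact linear_pd_eq_zero (pairing2 fun a b => (eta a b : ℝ)) hS (fun x => (h x).2) γ x

theorem symTraceless_smul {v : Fin 4 → Fin 4 → ℝ} (hv : v ∈ SymTraceless) (r : ℝ) :
    r • v ∈ SymTraceless := by
  refine ⟨fun α β => by simp [hv.1 α β], ?_⟩
  have h : ∑ a, ∑ b, (eta a b : ℝ) * (r • v) a b = r * ∑ a, ∑ b, (eta a b : ℝ) * v a b :=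
    (pairing2 fun a b => (eta a b : ℝ)).map_smul r v
  rw [h, hv.2, mul_zero]

/-- Pairing with all symmetric contraction-free tensors detects the symmetric contraction-free
part. -/
theorem forall_symTraceless_iff (X : Fin 4 → Fin 4 → ℂ) :
    (∀ v ∈ SymTraceless, ∑ a, ∑ b, (v a b : ℂ) * X a b = 0) ↔
      ∀ a b, X a b + X b a - (1 / 2) * (eta a b : ℂ) * ∑ μ, (sg μ : ℂ) * X μ μ = 0 := by
  constructor
  · intro h a b
    -- The test tensor is E_ab + E_ba minus its trace part. Its trace is 2η_ab and η contracts with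
    -- itself to 4, hence the coefficient 1/2.
    have hv : (fun c d => (if c = a ∧ d = b then (1 : ℝ) else 0) + (if c = b ∧ d = a then 1 else 0)
        - (1 / 2) * (eta a b : ℝ) * (eta c d : ℝ)) ∈ SymTraceless := by
      refine ⟨fun c d => ?_, ?_⟩
      · have : eta c d = eta d c := by
          simp only [eta, Matrix.diagonal_apply]
          by_cases hcd : c = d
          · simp [hcd]
          · simp [hcd, Ne.symm hcd]
        simp only [this, and_comm (a := c = a), and_comm (a := c = b)]
        ring
      · have h1 : ∑ c, ∑ d, (eta c d : ℝ) * (eta c d : ℝ) = 4 := by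
          simp [Fin.sum_univ_four, eta, Matrix.diagonal_apply, sg_zero, sg_one, sg_two, sg_three]
          norm_num
        have h2 : eta b a = eta a b := by
          simp only [eta, Matrix.diagonal_apply]
          by_cases hcd : a = b
          · simp [hcd]
          · simp [hcd, Ne.symm hcd]
        have h3 : ∀ a b : Fin 4, ∑ c, ∑ d, (eta c d : ℝ) * (if c = a ∧ d = b then (1 : ℝ) else 0)
            = eta a b := by
          intro a b
          simp [ite_and]
        have h4 : ∑ c, ∑ d, (eta c d : ℝ) * ((1 / 2) * (eta a b : ℝ) * (eta c d : ℝ))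
            = 2 * eta a b := by
          have : ∀ c d, (eta c d : ℝ) * ((1 / 2) * (eta a b : ℝ) * (eta c d : ℝ))
              = (1 / 2) * (eta a b : ℝ) * ((eta c d : ℝ) * (eta c d : ℝ)) := fun c d => by ring
          simp only [this, ← Finset.mul_sum, h1]
          ring
        simp only [mul_sub, mul_add, Finset.sum_sub_distrib, Finset.sum_add_distrib]
        rw [h3, h3, h4, h2]
        ring
    have := h _ hv
    simp only [Complex.ofReal_sub, Complex.ofReal_add, Complex.ofReal_mul, Complex.ofReal_div,
      Complex.ofReal_one, Complex.ofReal_ofNat, Complex.ofReal_intCast, sub_mul, add_mul,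
      Finset.sum_sub_distrib, Finset.sum_add_distrib] at this
    have h3 : ∀ a b : Fin 4, ∑ c, ∑ d, ((if c = a ∧ d = b then 1 else 0 : ℝ) : ℂ) * X c d
            = X a b := by
      intro a b
      simp [ite_and, apply_ite]
    have h4 : ∑ c, ∑ d, (1 / 2) * (eta a b : ℂ) * (eta c d : ℂ) * X c d
        = (1 / 2) * (eta a b : ℂ) * ∑ μ, (sg μ : ℂ) * X μ μ := by
      simp only [mul_assoc, ← Finset.mul_sum]
      simp [eta, Matrix.diagonal_apply]
    rw [h3, h3, h4] at this
    exact this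
  · intro h v hv
    have h1 : ∑ a, ∑ b, (v a b : ℂ) * X b a = ∑ a, ∑ b, (v a b : ℂ) * X a b := by
      rw [Finset.sum_comm]
      simp only [hv.1]
    have h2 : ∑ a, ∑ b, (v a b : ℂ) *
        (X a b + X b a - (1 / 2) * (eta a b : ℂ) * ∑ μ, (sg μ : ℂ) * X μ μ) = 0 := by
      simp only [h, mul_zero, Finset.sum_const_zero]
    have h3 : ∑ a, ∑ b, (eta a b : ℂ) * (v a b : ℂ) = 0 := by
      exact_mod_cast congrArg (Complex.ofReal) hv.2
    have h4 : ∀ z : ℂ, ∑ a, ∑ b, (v a b : ℂ) * ((1 / 2) * (eta a b : ℂ) * z)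
        = (1 / 2) * z * ∑ a, ∑ b, (eta a b : ℂ) * (v a b : ℂ) := by
      intro z
      simp only [Finset.mul_sum]
      exact Finset.sum_congr rfl fun _ _ => Finset.sum_congr rfl fun _ _ => by ring
    simp only [mul_sub, mul_add, Finset.sum_sub_distrib, Finset.sum_add_distrib, h1, h4, h3] at h2
    linear_combination (1 / 2 : ℂ) * h2

/-! The symmetric contraction-free tensor field -/

/-- The variational criterion needs a linear map on all arrays, not only on symmetric ones.
Contraction with the symmetric u_{αβ} sees only the symmetric part, whence the symmetrization; the
trace condition plays no role here. The sign lowers the force index. -/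
noncomputable def symComp : (Fin 4 → Fin 4 → ℝ) →ₗ[ℝ] Fin 4 → Fin 4 → ℝ where
  toFun S α μ := (sg α : ℝ) * ((1 / 2) * (S α μ + S μ α))
  map_add' φ χ := by
    ext α μ
    simp
    ring
  map_smul' r φ := by
    ext α μ
    simp
    ring

theorem symComp_of_mem {S : Fin 4 → Fin 4 → ℝ} (h : S ∈ SymTraceless) (α μ : Fin 4) :
    symComp S α μ = (sg α : ℝ) * S α μ := by
  change (sg α : ℝ) * ((1 / 2) * (S α μ + S μ α)) = _
  rw [h.1 μ α]
  ring

theorem uTensor2_apply (α β κ : Fin 4) : uTensor2 α β κ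
    = (1 / 2 : ℂ) • ((eta α κ : ℂ) • cliff β + (eta β κ : ℂ) • cliff α) := by
  rw [uTensor2, Pi.smul_apply, Finset.sum_apply]
  refine congrArg _ ?_
  rw [Finset.sum_eq_single κ]
  · simp [basisTensor, theta_single]
  · intro μ _ hμ
    simp [basisTensor, hμ.symm]
  · simp

theorem symForce_eq (ζ : ℝ) (S : Fin 4 → Fin 4 → ℝ) :
    symForce ζ S = forceOf (cliffVec ζ) symComp S := by
  funext κ
  have h : forceOf (cliffVec ζ) symComp S κ
      = (∑ μ, ((sg κ : ℝ) * (1 / 2) * S κ μ) • (expIJ ζ * cliff μ))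
        + ∑ μ, ((sg κ : ℝ) * (1 / 2) * S μ κ) • (expIJ ζ * cliff μ) := by
    change ∑ μ, symComp S κ μ • (expIJ ζ * cliff μ) = _
    rw [← Finset.sum_add_distrib]
    refine Finset.sum_congr rfl fun μ _ => ?_
    rw [← add_smul]
    congr 1
    change (sg κ : ℝ) * ((1 / 2) * (S κ μ + S μ κ)) = _
    ring
  rw [h]
  simp only [symForce, Finset.sum_apply, Pi.smul_apply, matAct, uTensor2_apply, mul_smul_comm,
    mul_add, smul_add, Finset.sum_add_distrib]
  congr 1
  · rw [Finset.sum_eq_single κ]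
    · refine Finset.sum_congr rfl fun β _ => ?_
      rw [eta, Matrix.diagonal_apply_eq, smul_smul, smul_smul, ← Complex.coe_smul]
      congr 1
      push_cast
      ring
    · intro α _ hα
      simp [eta, Matrix.diagonal_apply_ne _ hα]
    · simp
  · refine Finset.sum_congr rfl fun α _ => ?_
    rw [Finset.sum_eq_single κ]
    · rw [eta, Matrix.diagonal_apply_eq, smul_smul, smul_smul, ← Complex.coe_smul]
      congr 1
      push_cast
      ring
    · intro β _ hβ
      simp [eta, Matrix.diagonal_apply_ne _ hβ]
    · simp

theorem gamma_mul_expIJ (ζ : ℝ) (α : Fin 4) : gamma α * expIJ ζ = expIJ ζ * gamma α := by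
  simp [expIJ, mul_add, add_mul, gamma_mul_calJ]

theorem sg_mul_sg_complex (α : Fin 4) : (sg α : ℂ) * sg α = 1 := by
  exact_mod_cast congrArg (Complex.ofReal) (sg_mul_sg α)

theorem source_symForce (ζ : ℝ) (S : Fin 4 → Fin 4 → ℝ) (ψ : Spinor) :
    source ψ (symForce ζ S) = ∑ α, ∑ β, (S α β : ℂ) *
      ((1 / 2) * (herm ψ ((expIJ ζ * (gamma α * theta [β])) *ᵥ ψ)
        + herm ψ ((expIJ ζ * (gamma β * theta [α])) *ᵥ ψ))) := by
  rw [symForce, source_sum]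
  refine Finset.sum_congr rfl fun α _ => ?_
  rw [source_sum]
  refine Finset.sum_congr rfl fun β _ => ?_
  have h2 : ∀ α β, ∑ κ, gammaUp κ * (expIJ ζ * ((eta α κ : ℂ) • cliff β))
      = expIJ ζ * (gamma α * theta [β]) := by
    intro α β
    rw [Finset.sum_eq_single α]
    · rw [eta, Matrix.diagonal_apply_eq, gammaUp, mul_smul_comm, mul_smul_comm, smul_mul_assoc,
        smul_smul, sg_mul_sg_complex, one_smul, ← mul_assoc, gamma_mul_expIJ, mul_assoc,
        theta_single]
    · intro κ _ hκ
      simp [eta, Matrix.diagonal_apply_ne _ hκ.symm]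
    · simp
  have h1 : ∑ κ, gammaUp κ * matAct (expIJ ζ) (uTensor2 α β) κ
      = (1 / 2 : ℂ) • (expIJ ζ * (gamma α * theta [β]) + expIJ ζ * (gamma β * theta [α])) := by
    simp only [matAct, uTensor2_apply, mul_smul_comm, mul_add, ← Finset.smul_sum,
      Finset.sum_add_distrib, ← h2]
  rw [source_smul, source, h1, Matrix.smul_mulVec, herm_smul, Matrix.add_mulVec, herm_add]

theorem minkowski_sub_self (m n : Fin 4 → ℝ) : minkowski (m - n) (m - n)
    = minkowski m m - 2 * minkowski m n + minkowski n n := by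
  simp only [minkowski, Finset.mul_sum, ← Finset.sum_sub_distrib, ← Finset.sum_add_distrib]
  exact Finset.sum_congr rfl fun _ _ => by simp; ring

/-- Interchanging the summation indices identifies the two squares in the expansion of a squared
curl. -/
theorem sum_minkowski_curl (P : Fin 4 → Fin 4 → Fin 4 → ℝ) :
    ∑ α, ∑ β, (sg α : ℝ) * (sg β : ℝ) * minkowski (P α β - P β α) (P α β - P β α)
      = 2 * (∑ α, ∑ β, (sg α : ℝ) * (sg β : ℝ) * minkowski (P α β) (P α β))
        - 2 * ∑ α, ∑ β, (sg α : ℝ) * (sg β : ℝ) * minkowski (P α β) (P β α) := by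
  have h : ∑ α, ∑ β, (sg α : ℝ) * (sg β : ℝ) * minkowski (P β α) (P β α)
      = ∑ α, ∑ β, (sg α : ℝ) * (sg β : ℝ) * minkowski (P α β) (P α β) := by
    rw [Finset.sum_comm]
    exact Finset.sum_congr rfl fun _ _ => Finset.sum_congr rfl fun _ _ => by ring
  simp only [minkowski_sub_self, mul_add, mul_sub, Finset.sum_add_distrib, Finset.sum_sub_distrib,
    h, Finset.mul_sum]
  rw [sub_add_eq_add_sub, ← Finset.sum_add_distrib]
  congr 1
  · refine Finset.sum_congr rfl fun _ _ => ?_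
    rw [← Finset.sum_add_distrib]
    exact Finset.sum_congr rfl fun _ _ => by ring
  · exact Finset.sum_congr rfl fun _ _ => Finset.sum_congr rfl fun _ _ => by ring

theorem sum_vecPotential (c : ℝ) (M G N : Fin 4 → Fin 4 → ℝ) :
    ∑ α, ∑ β, (sg α : ℝ) * (sg β : ℝ) * (-16 * c * M α β + 64 * c ^ 2 * (G α β - N α β))
      = -16 * c * (∑ α, ∑ β, (sg α : ℝ) * (sg β : ℝ) * M α β)
        + 64 * c ^ 2 * ((∑ α, ∑ β, (sg α : ℝ) * (sg β : ℝ) * G α β)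
          - ∑ α, ∑ β, (sg α : ℝ) * (sg β : ℝ) * N α β) := by
  simp only [Finset.mul_sum, ← Finset.sum_add_distrib, ← Finset.sum_sub_distrib]
  exact Finset.sum_congr rfl fun _ _ => Finset.sum_congr rfl fun _ _ => by ring

theorem symPotential_eq {ζ : ℝ} {S : Spacetime → Fin 4 → Fin 4 → ℝ} (hS : ContDiff ℝ ∞ S)
    (hSA : ∀ x, S x ∈ SymTraceless) (x : Spacetime) :
    ∑ α, ∑ β, (sg α : ℝ) * (sg β : ℝ) *
        (-16 * Real.cos (2 * ζ) *
          minkowski (symComp (pd α S x) β - symComp (pd β S x) α)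
            (symComp (pd α S x) β - symComp (pd β S x) α)
        + 64 * Real.cos (2 * ζ) ^ 2 * (minkowski (symComp (S x) α) (symComp (S x) β) ^ 2
          - minkowski (symComp (S x) α) (symComp (S x) α)
            * minkowski (symComp (S x) β) (symComp (S x) β)))
      = symPotential ζ S x := by
  have hq := hSA x
  have hp := fun γ => symTraceless_pd hS hSA γ x
  have hm : ∀ {R Q : Fin 4 → Fin 4 → ℝ}, R ∈ SymTraceless → Q ∈ SymTraceless → ∀ α β,
      minkowski (symComp R α) (symComp Q β)
        = (sg α : ℝ) * sg β * ∑ μ, (sg μ : ℝ) * R α μ * Q β μ := by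
    intro R Q hR hQ α β
    rw [minkowski, Finset.mul_sum]
    refine Finset.sum_congr rfl fun μ _ => ?_
    rw [symComp_of_mem hR, symComp_of_mem hQ]
    ring
  -- The inner products of the rows of S are the entries of S², up to signs, because S is symmetric.
  -- The sum of their squares is therefore the trace of S⁴.
  have e1 : ∑ α, ∑ β, (sg α : ℝ) * (sg β : ℝ) *
        minkowski (symComp (S x) α) (symComp (S x) β) ^ 2
      = ∑ α, ∑ β, ∑ ρ, ∑ σ,
          up2 S α β x * low2 S β ρ x * up2 S ρ σ x * low2 S σ α x := by
    refine Finset.sum_congr rfl fun α _ => ?_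
    rw [Finset.sum_comm]
    refine Finset.sum_congr rfl fun ρ _ => ?_
    have h1 : ∑ β, ∑ σ, up2 S α β x * low2 S β ρ x * up2 S ρ σ x * low2 S σ α x
        = (∑ β, up2 S α β x * low2 S β ρ x) * ∑ σ, up2 S ρ σ x * low2 S σ α x := by
      rw [Finset.sum_mul_sum]
      exact Finset.sum_congr rfl fun _ _ => Finset.sum_congr rfl fun _ _ => by ring
    have h2 : ∀ a b, ∑ β, up2 S a β x * low2 S β b x
        = (sg b : ℝ) * ∑ μ, (sg μ : ℝ) * S x a μ * S x b μ := by
      intro a b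
      rw [Finset.mul_sum]
      refine Finset.sum_congr rfl fun μ _ => ?_
      rw [up2, low2, hq.1 μ b]
      ring
    have h3 : ∑ μ, (sg μ : ℝ) * S x ρ μ * S x α μ = ∑ μ, (sg μ : ℝ) * S x α μ * S x ρ μ :=
      Finset.sum_congr rfl fun _ _ => by ring
    rw [h1, h2, h2, hm hq hq, h3]
    linear_combination (sg α * sg ρ : ℝ) * (∑ μ, (sg μ : ℝ) * S x α μ * S x ρ μ) ^ 2
      * ((sg α : ℝ) ^ 2 * sg_mul_sg ρ + sg_mul_sg α)
  have e2 : ∑ α, ∑ β, (sg α : ℝ) * (sg β : ℝ) * (minkowski (symComp (S x) α) (symComp (S x) α)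
            * minkowski (symComp (S x) β) (symComp (S x) β))
      = (∑ α, ∑ β, up2 S α β x * low2 S α β x) ^ 2 := by
    have h2 : ∀ α, (sg α : ℝ) * minkowski (symComp (S x) α) (symComp (S x) α)
        = ∑ β, up2 S α β x * low2 S α β x := by
      intro α
      rw [hm hq hq, sg_mul_sg, one_mul, Finset.mul_sum]
      refine Finset.sum_congr rfl fun μ _ => ?_
      rw [up2, low2]
      ring
    rw [sq, Finset.sum_mul_sum]
    refine Finset.sum_congr rfl fun α _ => Finset.sum_congr rfl fun β _ => ?_
    rw [← h2, ← h2]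
    ring
  have e3 : ∑ α, ∑ β, (sg α : ℝ) * (sg β : ℝ) *
        minkowski (symComp (pd α S x) β) (symComp (pd α S x) β)
      = ∑ α, ∑ β, ∑ ρ, pd α (up2 S β ρ) x * pdU α (low2 S β ρ) x := by
    refine Finset.sum_congr rfl fun α _ => Finset.sum_congr rfl fun β _ => ?_
    rw [hm (hp α) (hp α), sg_mul_sg, one_mul, Finset.mul_sum]
    refine Finset.sum_congr rfl fun μ _ => ?_
    rw [pdU, pd_up2 hS, pd_low2 hS, up2, low2]
    ring
  have e4 : ∑ α, ∑ β, (sg α : ℝ) * (sg β : ℝ) *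
        minkowski (symComp (pd α S x) β) (symComp (pd β S x) α)
      = ∑ α, ∑ β, ∑ ρ, pdU α (up2 S β ρ) x * pd β (low2 S α ρ) x := by
    refine Finset.sum_congr rfl fun α _ => Finset.sum_congr rfl fun β _ => ?_
    rw [hm (hp α) (hp β), Finset.mul_sum, Finset.mul_sum]
    refine Finset.sum_congr rfl fun μ _ => ?_
    rw [pdU, pd_up2 hS, pd_low2 hS, up2, low2]
    linear_combination (sg α ^ 2 * sg μ * pd α S x β μ * pd β S x α μ : ℝ) * sg_mul_sg β
  rw [symPotential, ← e1, ← e2, ← e3, ← e4]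
  rw [sum_vecPotential (Real.cos (2 * ζ))
    (fun α β => minkowski (symComp (pd α S x) β - symComp (pd β S x) α)
            (symComp (pd α S x) β - symComp (pd β S x) α)),
    sum_minkowski_curl fun α β => symComp (pd α S x) β]
  ring

theorem sg_cast_sq (α : Fin 4) : (sg α : ℝ) ^ 2 = 1 := by rw [sq, sg_mul_sg]

/-- The field equation of the symmetric tensor field before projection. -/
theorem vecEquation_symComp {k : ℝ} {Q : Fin 4 → Fin 4 → ℝ} (hQ : Q ∈ SymTraceless)
    {H : Fin 4 → Fin 4 → Fin 4 → Fin 4 → ℝ} (hH : ∀ γ α, H γ α ∈ SymTraceless)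
    (hs : ∀ γ α, H γ α = H α γ) (a b : Fin 4) :
    (sg a : ℝ) * vecEquation symComp k Q H a b
      = -16 * k * (∑ α, (sg α : ℝ) * sg a * sg b * H α α a b - ∑ α, (sg b : ℝ) * H a α α b)
        + 64 * k ^ 2 * ((∑ μ, ∑ ν, (sg μ : ℝ) * sg ν * Q μ ν * Q μ ν) * (sg a * sg b * Q a b)
          - ∑ μ, ∑ ν, (sg a : ℝ) * sg b * sg μ * sg ν * Q a μ * Q μ ν * Q ν b) := by
  have key : ∀ α, (sg a : ℝ) * ((sg α : ℝ) * sg a * sg b *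
        (-16 * k * (symComp (H α α) a b - symComp (H α a) α b)
          + 64 * k ^ 2 * (minkowski (symComp Q α) (symComp Q α) * symComp Q a b
            - minkowski (symComp Q α) (symComp Q a) * symComp Q α b)))
      = -16 * k * ((sg α : ℝ) * sg a * sg b * H α α a b - (sg b : ℝ) * H a α α b)
        + 64 * k ^ 2 * ((∑ ν, (sg α : ℝ) * sg ν * Q α ν * Q α ν) * (sg a * sg b * Q a b)
          - ∑ ν, (sg a : ℝ) * sg b * sg ν * sg α * Q a ν * Q ν α * Q α b) := by
    intro α
    have hm : ∀ β, minkowski (symComp Q α) (symComp Q β)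
        = (sg α : ℝ) * sg β * ∑ μ, (sg μ : ℝ) * Q α μ * Q β μ := by
      intro β
      rw [minkowski, Finset.mul_sum]
      refine Finset.sum_congr rfl fun μ _ => ?_
      rw [symComp_of_mem hQ, symComp_of_mem hQ]
      ring
    have e1 : ∑ ν, (sg α : ℝ) * sg ν * Q α ν * Q α ν
        = sg α * ∑ μ, (sg μ : ℝ) * Q α μ * Q α μ := by
      simp only [Finset.mul_sum, mul_assoc]
    have e2 : ∑ ν, (sg a : ℝ) * sg b * sg ν * sg α * Q a ν * Q ν α * Q α b
        = sg a * sg b * sg α * Q α b * ∑ μ, (sg μ : ℝ) * Q α μ * Q a μ := by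
      rw [Finset.mul_sum]
      refine Finset.sum_congr rfl fun ν _ => ?_
      rw [hQ.1 ν α]
      ring
    rw [hm, hm, e1, e2, symComp_of_mem hQ, symComp_of_mem hQ, symComp_of_mem (hH _ _),
      symComp_of_mem (hH _ _), hs α a]
    have ha := sg_cast_sq a
    have hα := sg_cast_sq α
    generalize (sg a : ℝ) = s at *
    generalize (sg α : ℝ) = t at *
    generalize (∑ μ, (sg μ : ℝ) * Q α μ * Q α μ) = A
    generalize (∑ μ, (sg μ : ℝ) * Q α μ * Q a μ) = B
    linear_combination (-16 * k * t * sg b * H α α a b * s + 64 * k ^ 2 * t ^ 3 * sg b * A * Q a b * s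
      - 64 * k ^ 2 * t ^ 3 * sg b * B * Q α b * s + 16 * k * sg b * t ^ 2 * H a α α b) * ha
      + (64 * k ^ 2 * t * sg b * s * A * Q a b - 64 * k ^ 2 * t * sg b * s * B * Q α b
      + 16 * k * sg b * H a α α b) * hα
  rw [vecEquation, Finset.mul_sum, Finset.sum_congr rfl fun α _ => key α,
    Finset.sum_comm (f := fun μ ν => (sg a : ℝ) * sg b * sg μ * sg ν * Q a μ * Q μ ν * Q ν b)]
  simp only [Finset.sum_add_distrib, ← Finset.mul_sum, Finset.sum_sub_distrib, ← Finset.sum_mul]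

/-- Second derivatives of S are again symmetric and contraction-free. In the projection the
symmetric terms of Y double, the divergence terms symmetrize, and of the trace only the double
divergence and the cubic contraction survive. -/
theorem sym_equation {ζ : ℝ} {S : Spacetime → Fin 4 → Fin 4 → ℝ} (hS : ContDiff ℝ ∞ S)
    (hSA : ∀ x, S x ∈ SymTraceless) (x : Spacetime) {Y : Fin 4 → Fin 4 → ℝ}
    (hY : ∀ a b, Y a b = (sg a : ℝ) * vecEquation symComp (Real.cos (2 * ζ)) (S x)
      (fun γ α => pd γ (pd α S) x) a b) (a b : Fin 4) :
    Y a b + Y b a - (1 / 2) * (eta a b : ℝ) * ∑ μ, (sg μ : ℝ) * Y μ μ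
      = -32 * Real.cos (2 * ζ) * (box (low2 S a b) x
      - (1 / 2) * (∑ μ, pd a (pdU μ (low2 S μ b)) x)
      - (1 / 2) * (∑ μ, pd b (pdU μ (low2 S μ a)) x)
      + (1 / 4) * (eta a b : ℝ) * (∑ μ, ∑ ν, pd μ (pd ν (up2 S μ ν)) x)
      + 4 * Real.cos (2 * ζ) *
        ((∑ μ, ∑ ν, low2 S a μ x * up2 S μ ν x * low2 S ν b x)
          - (∑ μ, ∑ ν, up2 S μ ν x * low2 S μ ν x) * low2 S a b x
          - (1 / 4) * (eta a b : ℝ) *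
            ∑ μ, ∑ ν, ∑ σ, ((sg μ : ℝ) * up2 S μ ν x) * ((sg ν : ℝ) * up2 S ν σ x) *
              ((sg σ : ℝ) * up2 S σ μ x))) := by
  have hq := hSA x
  have hh := fun γ α => symTraceless_pd (contDiff_pd hS α) (symTraceless_pd hS hSA α) γ x
  have hs := fun γ α => pd_pd_comm hS γ α x
  have hY' := fun a b => (hY a b).trans (vecEquation_symComp hq hh hs a b)
  simp only [box_eq (contDiff_low2 hS _ _), pd_pdU (contDiff_low2 hS _ _), pd_low2 hS, pd_up2 hS,
    pd_low2 (contDiff_pd hS _), pd_up2 (contDiff_pd hS _), up2, low2]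
  generalize hQ : S x = Q at hq hY'
  generalize hH : (fun γ α => pd γ (fun y => pd α S y) x) = H at hY'
  have hH' : ∀ γ α, pd γ (pd α S) x = H γ α := fun γ α => congrFun (congrFun hH γ) α
  simp only [hH'] at hs hh hY' ⊢
  clear hQ hH hH' hY hS hSA
  generalize Real.cos (2 * ζ) = c at hY'
  have t1 : ∑ x, (sg x : ℝ) * (sg a * sg b * H x x a b) = ∑ x, (sg x : ℝ) * sg a * sg b * H x x a b :=
    Finset.sum_congr rfl fun _ _ => by ring
  have t2 : ∀ a b, ∑ x, (sg x : ℝ) * (sg x * sg b * H a x x b) = ∑ x, (sg b : ℝ) * H a x x b :=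
    fun a b => Finset.sum_congr rfl fun x _ => by
      linear_combination (sg b * H a x x b : ℝ) * sg_cast_sq x
  have t4 : ∑ x, ∑ y, H x y x y = ∑ μ, (sg μ : ℝ) * ∑ x, (sg μ : ℝ) * H μ x x μ := by
    refine Finset.sum_congr rfl fun x _ => ?_
    rw [Finset.mul_sum]
    refine Finset.sum_congr rfl fun y _ => ?_
    rw [(hh x y).1 x y]
    linear_combination (-H x y y x) * sg_cast_sq x
  have t5 : ∑ μ, ∑ ν, (sg a : ℝ) * sg μ * Q a μ * Q μ ν * (sg ν * sg b * Q ν b)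
      = ∑ μ, ∑ ν, (sg a : ℝ) * sg b * sg μ * sg ν * Q a μ * Q μ ν * Q ν b :=
    Finset.sum_congr rfl fun _ _ => Finset.sum_congr rfl fun _ _ => by ring
  have t6 : ∑ μ, ∑ ν, Q μ ν * ((sg μ : ℝ) * sg ν * Q μ ν)
      = ∑ μ, ∑ ν, (sg μ : ℝ) * sg ν * Q μ ν * Q μ ν :=
    Finset.sum_congr rfl fun _ _ => Finset.sum_congr rfl fun _ _ => by ring
  have t7 : ∑ μ, ∑ ν, ∑ σ, (sg μ : ℝ) * Q μ ν * (sg ν * Q ν σ) * (sg σ * Q σ μ)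
      = ∑ μ, (sg μ : ℝ) *
        ∑ ν, ∑ σ, (sg μ : ℝ) * sg μ * sg ν * sg σ * Q μ ν * Q ν σ * Q σ μ := by
    refine Finset.sum_congr rfl fun μ _ => ?_
    simp only [Finset.mul_sum]
    refine Finset.sum_congr rfl fun ν _ => Finset.sum_congr rfl fun σ _ => ?_
    linear_combination (-sg μ * sg ν * sg σ * Q μ ν * Q ν σ * Q σ μ : ℝ) * sg_cast_sq μ
  have s1 : ∑ x, (sg x : ℝ) * sg b * sg a * H x x b a = ∑ x, (sg x : ℝ) * sg a * sg b * H x x a b :=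
    Finset.sum_congr rfl fun x _ => by
      rw [(hh x x).1 b a]
      ring
  have s2 : ∑ μ, ∑ ν, (sg b : ℝ) * sg a * sg μ * sg ν * Q b μ * Q μ ν * Q ν a
      = ∑ μ, ∑ ν, (sg a : ℝ) * sg b * sg μ * sg ν * Q a μ * Q μ ν * Q ν b := by
    rw [Finset.sum_comm]
    refine Finset.sum_congr rfl fun μ _ => Finset.sum_congr rfl fun ν _ => ?_
    rw [hq.1 b ν, hq.1 ν μ, hq.1 μ a]
    ring
  have trQ : ∀ R ∈ SymTraceless, ∑ μ, (sg μ : ℝ) * R μ μ = 0 := by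
    intro R hR
    have := hR.2
    simpa [eta, Matrix.diagonal_apply] using this
  -- The wave operator of S is contraction-free, so it contributes nothing to the subtracted trace;
  -- the next fact says the same for the term proportional to S.
  have r1 : ∑ μ, (sg μ : ℝ) * ∑ x, (sg x : ℝ) * sg μ * sg μ * H x x μ μ = 0 := by
    simp only [Finset.mul_sum]
    rw [Finset.sum_comm]
    refine Finset.sum_eq_zero fun x _ => ?_
    rw [← mul_zero (sg x : ℝ), ← trQ _ (hh x x), Finset.mul_sum]
    refine Finset.sum_congr rfl fun μ _ => ?_
    linear_combination (sg μ * sg x * H x x μ μ : ℝ) * sg_cast_sq μ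
  have r2 : ∀ N : ℝ, ∑ μ, (sg μ : ℝ) * (N * (sg μ * sg μ * Q μ μ)) = 0 := by
    intro N
    rw [← mul_zero N, ← trQ _ hq, Finset.mul_sum]
    refine Finset.sum_congr rfl fun μ _ => ?_
    linear_combination (N * sg μ * Q μ μ : ℝ) * sg_cast_sq μ
  have hY2 : ∑ μ, (sg μ : ℝ) * Y μ μ = 16 * c * (∑ μ, (sg μ : ℝ) * ∑ x, (sg μ : ℝ) * H μ x x μ)
      - 64 * c ^ 2 * ∑ μ, (sg μ : ℝ) *
        ∑ ν, ∑ σ, (sg μ : ℝ) * sg μ * sg ν * sg σ * Q μ ν * Q ν σ * Q σ μ := by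
    have e : ∀ μ, (sg μ : ℝ) * Y μ μ
        = -16 * c * (sg μ * ∑ x, (sg x : ℝ) * sg μ * sg μ * H x x μ μ)
          + 16 * c * (sg μ * ∑ x, (sg μ : ℝ) * H μ x x μ)
          + 64 * c ^ 2 * (sg μ * ((∑ μ, ∑ ν, (sg μ : ℝ) * sg ν * Q μ ν * Q μ ν)
            * (sg μ * sg μ * Q μ μ)))
          - 64 * c ^ 2 * (sg μ *
            ∑ ν, ∑ σ, (sg μ : ℝ) * sg μ * sg ν * sg σ * Q μ ν * Q ν σ * Q σ μ) := by
      intro μ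
      rw [hY']
      ring
    simp only [e, Finset.sum_add_distrib, Finset.sum_sub_distrib, ← Finset.mul_sum, r1, r2]
    ring
  rw [t1, t2, t2, t4, t5, t6, t7, hY2, hY', hY', s1, s2, hq.1 b a]
  ring

theorem sym_case (m τ ζ : ℝ) {ψ : Spacetime → Spinor} (hψ : ContDiff ℝ ∞ ψ)
    {S : Spacetime → Fin 4 → Fin 4 → ℝ} (hS : ContDiff ℝ ∞ S) (hSA : ∀ x, S x ∈ SymTraceless) :
    (∀ x, IsForceTensor (symForce ζ (S x))) ∧
      (∀ x, LV (fun y => symForce ζ (S y)) x = (symPotential ζ S x : ℂ)) ∧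
      (τ ≠ 0 → Real.cos (2 * ζ) ≠ 0 →
        (IsStationaryAt SymTraceless (fun q => Ltot m τ ψ (fun y => symForce ζ (q y))) S ↔
          ∀ x, SymEquation ζ τ ψ S x)) := by
  set T := forceOf (cliffVec ζ) symComp with hTdef
  have hF : ∀ v, IsForceTensor (T v) := fun v =>
    isForceTensor_iff.2 fun α => cliffVec_mem ζ _
  have hT : ∀ v α, T v α = cliffVec ζ (symComp v α) := fun _ _ => rfl
  have hTf : ∀ v, symForce ζ v = T v := symForce_eq ζ
  refine ⟨fun x => hTf (S x) ▸ hF _, fun x => ?_, fun hτ hc => ?_⟩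
  · simp only [hTf]
    rw [LV_eq_tracePair _ hS, tracePair_of_cliffVec hT, symPotential_eq hS hSA]
  · have hk : 128 * τ * Real.cos (2 * ζ) ≠ 0 := by positivity
    simp only [hTf]
    rw [isStationaryAt_iff hF (fun _ hv r => symTraceless_smul hv r) m τ hψ hS]
    refine forall_congr' fun x => ?_
    set s : Fin 4 → Fin 4 → ℂ := fun α β =>
      herm (ψ x) ((expIJ ζ * (gamma α * theta [β])) *ᵥ ψ x) with hs
    set Y : Fin 4 → Fin 4 → ℝ := fun a b => (sg a : ℝ) * vecEquation symComp (Real.cos (2 * ζ))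
      (S x) (fun γ α => pd γ (pd α S) x) a b with hY
    have h1 : ∀ v ∈ SymTraceless, eulerLagrange T τ (ψ x) (S x)
        (fun γ => pd γ S x) (fun γ α => pd γ (fun y => pd α S y) x) v
        = ∑ a, ∑ b, (v a b : ℂ) * ((1 / 2) * (s a b + s b a) + 4 * τ * Y a b) := by
      intro v hv
      rw [eulerLagrange_of_real (yangMills_eq_vecEquation hT _ _ _ _), ← hTf,
        source_symForce]
      simp only [mul_add, Finset.sum_add_distrib]
      congr 1
      push_cast
      simp only [Finset.mul_sum]
      refine Finset.sum_congr rfl fun a _ => Finset.sum_congr rfl fun b _ => ?_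
      rw [symComp_of_mem hv]
      push_cast [hY]
      ring
    have h2 : ∀ a b, herm (ψ x) ((expIJ ζ * (gamma a * theta [b] + gamma b * theta [a]
        - ((1 / 2 : ℂ) * (eta a b : ℂ)) • ∑ μ, gammaUp μ * theta [μ])) *ᵥ ψ x)
        = s a b + s b a - (1 / 2) * (eta a b : ℂ) * ∑ μ, (sg μ : ℂ) * s μ μ := by
      intro a b
      have e : ∑ μ, (sg μ : ℂ) * s μ μ
          = herm (ψ x) ((expIJ ζ * ∑ μ, gammaUp μ * theta [μ]) *ᵥ ψ x) := by
        simp only [Finset.mul_sum, Matrix.sum_mulVec, herm_sum, gammaUp, smul_mul_assoc,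
          mul_smul_comm, Matrix.smul_mulVec, herm_smul, hs]
      rw [e, ← neg_add_eq_sub, mul_add, mul_add, mul_neg, mul_smul_comm, ← neg_smul,
        Matrix.add_mulVec, Matrix.add_mulVec, Matrix.smul_mulVec, herm_add, herm_add, herm_smul]
      simp only [hs]
      ring
    rw [forall₂_congr fun v hv => by rw [h1 v hv], forall_symTraceless_iff, SymEquation]
    refine forall_congr' fun a => forall_congr' fun b => ?_
    rw [← sub_eq_zero_iff_eq_one_div_mul hk, h2]
    have h3 := congrArg (Complex.ofReal) (sym_equation hS hSA x (Y := Y) (fun _ _ => rfl) a b)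
    rw [Complex.ofReal_mul] at h3
    generalize Complex.ofReal (box (low2 S a b) x - _ + _ + _) = E at h3 ⊢
    rw [iff_iff_eq]
    congr 1
    have h4 : ∑ μ, (sg μ : ℂ) * ((1 / 2) * (s μ μ + s μ μ) + 4 * τ * Y μ μ)
        = (∑ μ, (sg μ : ℂ) * s μ μ) + 4 * τ * ∑ μ, (sg μ : ℂ) * Y μ μ := by
      rw [Finset.mul_sum, ← Finset.sum_add_distrib]
      exact Finset.sum_congr rfl fun _ _ => by ring
    rw [h4]
    push_cast at h3 ⊢
    linear_combination (4 * τ : ℂ) * h3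

/-! The antisymmetric tensor field -/

theorem eps_cast (α β ρ σ : Fin 4) : (eps α β ρ σ : ℝ) =
    (((β : ℕ) : ℝ) - (α : ℕ)) * ((ρ : ℕ) - (α : ℕ)) * ((σ : ℕ) - (α : ℕ)) * ((ρ : ℕ) - (β : ℕ))
      * ((σ : ℕ) - (β : ℕ)) * ((σ : ℕ) - (ρ : ℕ)) / 12 := by
  have h := congrArg (Int.cast : ℤ → ℝ) (eps_eq α β ρ σ)
  push_cast at h
  linarith

/-- By `theta_triple`, 𝒥 Θ_{καβ} is a combination of the R_μ, and the minus sign is 𝒥² = -1. The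
matrix is twice the dual of the antisymmetric part of W, up to index position. -/
noncomputable def antisymComp : (Fin 4 → Fin 4 → ℝ) →ₗ[ℝ] Fin 4 → Fin 4 → ℝ where
  toFun W κ μ := -∑ α, ∑ β, (sg μ : ℝ) * (eps κ α β μ : ℝ) * W α β
  map_add' φ χ := by
    ext κ μ
    simp [mul_add, Finset.sum_add_distrib, add_comm]
  map_smul' r φ := by
    ext κ μ
    simp [Finset.mul_sum, mul_left_comm]

theorem antisym_self {W : Fin 4 → Fin 4 → ℝ} (h : W ∈ Antisym) (α : Fin 4) : W α α = 0 := by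
  linarith [h α α]

theorem antisymComp_of_mem {W : Fin 4 → Fin 4 → ℝ} (h : W ∈ Antisym) : antisymComp W =
    ![![0, 2 * W 2 3, -(2 * W 1 3), 2 * W 1 2], ![2 * W 2 3, 0, 2 * W 0 3, -(2 * W 0 2)],
      ![-(2 * W 1 3), -(2 * W 0 3), 0, 2 * W 0 1], ![2 * W 1 2, 2 * W 0 2, -(2 * W 0 1), 0]] := by
  funext κ μ
  change -∑ α, ∑ β, (sg μ : ℝ) * (eps κ α β μ : ℝ) * W α β = _
  fin_cases κ <;> fin_cases μ <;>
    simp [Fin.sum_univ_four, eps_cast, sg, h 1 0, h 2 0, h 3 0, h 2 1, h 3 1, h 3 2] <;> ring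

/-- The field equation is expressed through the dual of W and has to be converted back to W. In
terms of six independent components of each tensor this is a polynomial identity, using symmetry of
the second derivatives. -/
theorem vecEquation_antisymComp {k : ℝ} {Q : Fin 4 → Fin 4 → ℝ} (hQ : Q ∈ Antisym)
    {H : Fin 4 → Fin 4 → Fin 4 → Fin 4 → ℝ} (hH : ∀ γ α, H γ α ∈ Antisym)
    (hs : ∀ γ α, H γ α = H α γ) {v : Fin 4 → Fin 4 → ℝ} (hv : v ∈ Antisym) :
    ∑ β, ∑ μ, antisymComp v β μ * vecEquation antisymComp k Q H β μ
      = 32 * k * ∑ a, ∑ b, v a b * ((∑ x, (sg x : ℝ) * (sg a * sg b * H x x a b))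
          - (∑ x, (sg b : ℝ) * H a x b x) + (∑ x, (sg a : ℝ) * H b x a x)
          + 32 * k * ((∑ ρ, ∑ σ, (sg a : ℝ) * sg ρ * Q a ρ * Q ρ σ * (sg σ * sg b * Q σ b))
            + (∑ ρ, ∑ σ, Q ρ σ * ((sg ρ : ℝ) * sg σ * Q ρ σ)) * (sg a * sg b * Q a b))) := by
  simp only [vecEquation, antisymComp_of_mem hv, antisymComp_of_mem hQ,
    fun γ α => antisymComp_of_mem (hH γ α), minkowski]
  simp only [Fin.sum_univ_four, hs 1 0, hs 2 0, hs 3 0, hs 2 1, hs 3 1, hs 3 2,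
    hv 1 0, hv 2 0, hv 3 0, hv 2 1, hv 3 1, hv 3 2, antisym_self hv,
    hQ 1 0, hQ 2 0, hQ 3 0, hQ 2 1, hQ 3 1, hQ 3 2, antisym_self hQ,
    fun γ α => hH γ α 1 0, fun γ α => hH γ α 2 0, fun γ α => hH γ α 3 0, fun γ α => hH γ α 2 1,
    fun γ α => hH γ α 3 1, fun γ α => hH γ α 3 2, fun γ α => antisym_self (hH γ α),
    sg_zero, sg_one, sg_two, sg_three, Matrix.cons_val, mul_zero, zero_mul, add_zero, zero_add]
  simp only [Int.cast_one, Int.cast_neg]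
  ring

theorem antisym_pd {W : Spacetime → Fin 4 → Fin 4 → ℝ} (hW : ContDiff ℝ ∞ W)
    (h : ∀ x, W x ∈ Antisym) (γ : Fin 4) (x : Spacetime) : pd γ W x ∈ Antisym := by
  intro α β
  rw [pd_apply2 hW, pd_apply2 hW]
  have : (fun y => W y α β) = fun y => (-1 : ℝ) * W y β α := by
    funext y
    rw [h y α β]
    ring
  rw [this, pd_const_mul (f := fun y => W y β α) γ
    (differentiable_of_smooth (contDiff_up2 hW β α) x)]
  ring

theorem antisymPotential_eq {ζ : ℝ} {W : Spacetime → Fin 4 → Fin 4 → ℝ} (hW : ContDiff ℝ ∞ W)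
    (hWA : ∀ x, W x ∈ Antisym) (x : Spacetime) :
    ∑ α, ∑ β, (sg α : ℝ) * (sg β : ℝ) *
        (-16 * Real.cos (2 * ζ) *
          minkowski (antisymComp (pd α W x) β - antisymComp (pd β W x) α)
            (antisymComp (pd α W x) β - antisymComp (pd β W x) α)
        + 64 * Real.cos (2 * ζ) ^ 2 * (minkowski (antisymComp (W x) α) (antisymComp (W x) β) ^ 2
          - minkowski (antisymComp (W x) α) (antisymComp (W x) α)
            * minkowski (antisymComp (W x) β) (antisymComp (W x) β)))
      = antisymPotential ζ W x := by
  have hq := hWA x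
  have hp := fun γ => antisym_pd hW hWA γ x
  simp only [antisymPotential, pdU, pd_low2 hW, pd_up2 hW, up2, low2, minkowski, Pi.sub_apply]
  generalize Real.cos (2 * ζ) = k
  generalize W x = Q at hq
  generalize hP : (fun γ => pd γ W x) = P
  have hP' : ∀ γ, pd γ W x = P γ := congrFun hP
  simp only [hP'] at hp ⊢
  clear hP hP'
  simp only [antisymComp_of_mem hq, fun γ => antisymComp_of_mem (hp γ)]
  simp only [Fin.sum_univ_four, hq 1 0, hq 2 0, hq 3 0, hq 2 1, hq 3 1, hq 3 2, antisym_self hq,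
    fun γ => hp γ 1 0, fun γ => hp γ 2 0, fun γ => hp γ 3 0, fun γ => hp γ 2 1,
    fun γ => hp γ 3 1, fun γ => hp γ 3 2, fun γ => antisym_self (hp γ),
    sg_zero, sg_one, sg_two, sg_three, Matrix.cons_val, mul_zero, zero_mul, add_zero, zero_add,
    sub_zero, zero_sub, sub_self]
  simp only [Int.cast_one, Int.cast_neg]
  ring

theorem antisymForce_eq (ζ : ℝ) (W : Fin 4 → Fin 4 → ℝ) :
    antisymForce ζ W = forceOf (cliffVec ζ) antisymComp W := by
  funext κ
  have h1 : ∀ α β, expIJ ζ * (calJ * theta [κ, α, β])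
      = ∑ μ, (-(sg μ * eps κ α β μ : ℝ)) • (expIJ ζ * cliff μ) := by
    intro α β
    rw [theta_triple, Finset.mul_sum, Finset.mul_sum]
    refine Finset.sum_congr rfl fun μ _ => ?_
    rw [mul_smul_comm, ← mul_assoc, calJ_mul_calJ, neg_one_mul, mul_smul_comm, mul_neg, smul_neg,
      ← neg_smul, ← Complex.coe_smul]
    push_cast
    rfl
  have h2 : forceOf (cliffVec ζ) antisymComp W κ
      = ∑ μ, (-∑ α, ∑ β, (sg μ : ℝ) * (eps κ α β μ : ℝ) * W α β) • (expIJ ζ * cliff μ) := rfl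
  have h3 : ∀ α β, vTensor2 α β κ = calJ * theta [κ, α, β] := by
    intro α β
    simp [vTensor2, matAct, wTensor2, basisTensor, Finset.sum_apply]
  rw [h2]
  simp only [antisymForce, Finset.sum_apply, Pi.smul_apply, matAct, h3, h1, Finset.smul_sum,
    ← Finset.sum_neg_distrib, Finset.sum_smul]
  have h4 : ∀ f : Fin 4 → Fin 4 → Fin 4 → Mat,
      ∑ μ, ∑ α, ∑ β, f μ α β = ∑ α, ∑ β, ∑ μ, f μ α β := by
    intro f
    rw [Finset.sum_comm]
    exact Finset.sum_congr rfl fun _ _ => Finset.sum_comm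
  refine Eq.trans ?_ (h4 _).symm
  refine Finset.sum_congr rfl fun α _ => Finset.sum_congr rfl fun β _ =>
    Finset.sum_congr rfl fun μ _ => ?_
  rw [Complex.coe_smul, smul_smul]
  congr 1
  ring

theorem source_antisymForce (ζ : ℝ) (W : Fin 4 → Fin 4 → ℝ) (ψ : Spinor) :
    source ψ (antisymForce ζ W) = ∑ α, ∑ β, (W α β : ℂ) *
      -(Complex.I * herm ψ ((∑ ν, gammaUp ν *
        ((Real.sin ζ : ℂ) • 1 + (Complex.I * (Real.cos ζ : ℂ)) • calJ) *
          theta [ν, α, β]) *ᵥ ψ)) := by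
  -- Multiplication by 𝒥 exchanges the roles of cosine and sine, since 𝒥² = i² = -1.
  have h1 : expIJ ζ * calJ = (-Complex.I) •
      ((Real.sin ζ : ℂ) • 1 + (Complex.I * (Real.cos ζ : ℂ)) • calJ) := by
    rw [expIJ, add_mul, smul_mul_assoc, smul_mul_assoc, calJ_mul_calJ, one_mul, smul_add, smul_smul,
      smul_smul, add_comm, smul_neg, ← neg_smul]
    congr 1
    · congr 1
      ring
    · congr 1
      linear_combination (Real.cos ζ : ℂ) * Complex.I_sq
  rw [antisymForce, source_sum]
  refine Finset.sum_congr rfl fun α _ => ?_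
  rw [source_sum]
  refine Finset.sum_congr rfl fun β _ => ?_
  have h2 : ∑ ν, gammaUp ν * matAct (expIJ ζ) (vTensor2 α β) ν = (-Complex.I) • ∑ ν, gammaUp ν *
        ((Real.sin ζ : ℂ) • 1 + (Complex.I * (Real.cos ζ : ℂ)) • calJ) * theta [ν, α, β] := by
    rw [Finset.smul_sum]
    refine Finset.sum_congr rfl fun ν _ => ?_
    have h3 : vTensor2 α β ν = calJ * theta [ν, α, β] := by
      simp [vTensor2, matAct, wTensor2, basisTensor, Finset.sum_apply]
    rw [matAct, h3, ← mul_assoc (expIJ ζ), h1, smul_mul_assoc, mul_smul_comm, mul_assoc]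
  rw [source_smul, source, h2, Matrix.smul_mulVec, herm_smul, neg_mul]

/-- The test tensor E_ab - E_ba extracts X_ab - X_ba = 2 X_ab. Antisymmetry of X is what rules out a
remaining projection. -/
theorem forall_antisym_iff {X : Fin 4 → Fin 4 → ℂ} (hX : ∀ a b, X a b = -X b a) :
    (∀ v ∈ Antisym, ∑ a, ∑ b, (v a b : ℂ) * X a b = 0) ↔ ∀ a b, X a b = 0 := by
  constructor
  · intro h a b
    have h3 : ∀ a b : Fin 4, ∑ c, ∑ d, ((if c = a ∧ d = b then 1 else 0 : ℝ) : ℂ) * X c d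
        = X a b := by
      intro a b
      simp [ite_and, apply_ite]
    have := h (fun c d => (if c = a ∧ d = b then (1 : ℝ) else 0) - if c = b ∧ d = a then 1 else 0)
      fun c d => by
        simp only [and_comm (a := c = a), and_comm (a := c = b)]
        ring
    simp only [Complex.ofReal_sub, sub_mul, Finset.sum_sub_distrib, h3] at this
    linear_combination (1 / 2 : ℂ) * this + (1 / 2 : ℂ) * hX a b
  · intro h v _
    simp [h]

theorem antisym_case (m τ ζ : ℝ) {ψ : Spacetime → Spinor} (hψ : ContDiff ℝ ∞ ψ)
    {W : Spacetime → Fin 4 → Fin 4 → ℝ} (hW : ContDiff ℝ ∞ W) (hWA : ∀ x, W x ∈ Antisym) :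
    (∀ x, IsForceTensor (antisymForce ζ (W x))) ∧
      (∀ x, LV (fun y => antisymForce ζ (W y)) x = (antisymPotential ζ W x : ℂ)) ∧
      (τ ≠ 0 → Real.cos (2 * ζ) ≠ 0 →
        (IsStationaryAt Antisym (fun q => Ltot m τ ψ (fun y => antisymForce ζ (q y))) W ↔
          ∀ x, AntisymEquation ζ τ ψ W x)) := by
  set T := forceOf (cliffVec ζ) antisymComp with hTdef
  have hF : ∀ v, IsForceTensor (T v) := fun v =>
    isForceTensor_iff.2 fun α => cliffVec_mem ζ _
  have hT : ∀ v α, T v α = cliffVec ζ (antisymComp v α) := fun _ _ => rfl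
  have hTf : ∀ v, antisymForce ζ v = T v := antisymForce_eq ζ
  refine ⟨fun x => hTf (W x) ▸ hF _, fun x => ?_, fun hτ hc => ?_⟩
  · simp only [hTf]
    rw [LV_eq_tracePair _ hW, tracePair_of_cliffVec hT, antisymPotential_eq hW hWA]
  · have hk : 128 * τ * Real.cos (2 * ζ) ≠ 0 := by positivity
    simp only [hTf]
    rw [isStationaryAt_iff hF (fun _ hv r => antisym_smul r hv) m τ hψ hW]
    refine forall_congr' fun x => ?_
    rw [AntisymEquation]
    have hq := hWA x
    have hh := fun γ α => antisym_pd (contDiff_pd hW α) (antisym_pd hW hWA α) γ x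
    set E : Fin 4 → Fin 4 → ℝ := fun α β => box (low2 W α β) x
      - (∑ σ, pd α (pdU σ (low2 W β σ)) x) + (∑ σ, pd β (pdU σ (low2 W α σ)) x)
      + 32 * Real.cos (2 * ζ) *
        ((∑ ρ, ∑ σ, low2 W α ρ x * up2 W ρ σ x * low2 W σ β x)
          + (∑ ρ, ∑ σ, up2 W ρ σ x * low2 W ρ σ x) * low2 W α β x) with hE
    set r : Fin 4 → Fin 4 → ℂ := fun α β => herm (ψ x) ((∑ ν, gammaUp ν *
        ((Real.sin ζ : ℂ) • 1 + (Complex.I * (Real.cos ζ : ℂ)) • calJ) *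
          theta [ν, α, β]) *ᵥ ψ x) with hr
    have hEq : ∀ a b, E a b = (∑ x₁, (sg x₁ : ℝ) * (sg a * sg b * pd x₁ (pd x₁ W) x a b))
          - (∑ x₁, (sg b : ℝ) * pd a (pd x₁ W) x b x₁)
          + (∑ x₁, (sg a : ℝ) * pd b (pd x₁ W) x a x₁)
          + 32 * Real.cos (2 * ζ) *
            ((∑ ρ, ∑ σ, (sg a : ℝ) * sg ρ * W x a ρ * W x ρ σ * (sg σ * sg b * W x σ b))
            + (∑ ρ, ∑ σ, W x ρ σ * ((sg ρ : ℝ) * sg σ * W x ρ σ)) * (sg a * sg b * W x a b)) := by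
      intro a b
      have e : ∀ a b, ∑ σ, (sg σ : ℝ) * (sg b * sg σ * pd a (pd σ W) x b σ)
          = ∑ σ, (sg b : ℝ) * pd a (pd σ W) x b σ := fun a b => by
        refine Finset.sum_congr rfl fun σ _ => ?_
        linear_combination (sg b * pd a (pd σ W) x b σ : ℝ) * sg_mul_sg σ
      simp only [hE, box_eq (contDiff_low2 hW _ _), pd_pdU (contDiff_low2 hW _ _), pd_low2 hW,
        pd_low2 (contDiff_pd hW _), up2, low2, e]
    have h1 : ∀ v ∈ Antisym, eulerLagrange T τ (ψ x) (W x)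
        (fun γ => pd γ W x) (fun γ α => pd γ (fun y => pd α W y) x) v
        = ∑ a, ∑ b, (v a b : ℂ) *
          (-(Complex.I * r a b - (128 * τ * Real.cos (2 * ζ) : ℝ) * E a b)) := by
      intro v hv
      have h2 : ∑ β, ∑ μ, antisymComp v β μ * vecEquation antisymComp (Real.cos (2 * ζ)) (W x)
          (fun γ α => pd γ (pd α W) x) β μ
          = 32 * Real.cos (2 * ζ) * ∑ a, ∑ b, v a b * E a b := by
        simp only [hEq]
        exact vecEquation_antisymComp hq hh (fun γ α => pd_pd_comm hW γ α x) hv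
      rw [eulerLagrange_of_real (yangMills_eq_vecEquation hT _ _ _ _), ← hTf,
        source_antisymForce]
      have h3 : (fun γ α => pd γ (fun y => pd α W y) x) = fun γ α => pd γ (pd α W) x := rfl
      rw [h3, h2]
      change ∑ α, ∑ β, (v α β : ℂ) * -(Complex.I * r α β) + _ = _
      push_cast
      simp only [Finset.mul_sum, ← Finset.sum_add_distrib]
      refine Finset.sum_congr rfl fun a _ => Finset.sum_congr rfl fun b _ => ?_
      ring
    -- Antisymmetry of the source and, below, of the field expression is the hypothesis of
    -- `forall_antisym_iff`.
    have hrA : ∀ a b, r a b = -r b a := by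
      intro a b
      have h2 : ∀ ν, theta [ν, a, b] = -theta [ν, b, a] := by
        intro ν
        rw [theta_triple, theta_triple, ← Finset.sum_neg_distrib]
        refine Finset.sum_congr rfl fun μ _ => ?_
        have h3 : eps ν a b μ = -eps ν b a μ := by
          have e1 := eps_eq ν a b μ
          have e2 := eps_eq ν b a μ
          have e3 : 12 * eps ν a b μ + 12 * eps ν b a μ = 0 := by
            rw [e1, e2]
            ring
          linarith
        rw [h3]
        simp
      simp only [hr, h2, mul_neg, Finset.sum_neg_distrib]
      rw [← neg_one_smul ℂ, Matrix.smul_mulVec, herm_smul, neg_one_mul]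
    have hEA : ∀ a b, E a b = -E b a := by
      intro a b
      have e1 : ∑ x₁, (sg x₁ : ℝ) * (sg b * sg a * pd x₁ (pd x₁ W) x b a)
          = -∑ x₁, (sg x₁ : ℝ) * (sg a * sg b * pd x₁ (pd x₁ W) x a b) := by
        rw [← Finset.sum_neg_distrib]
        refine Finset.sum_congr rfl fun μ _ => ?_
        rw [hh μ μ b a]
        ring
      have e2 : ∑ ρ, ∑ σ, (sg b : ℝ) * sg ρ * W x b ρ * W x ρ σ * (sg σ * sg a * W x σ a)
          = -∑ ρ, ∑ σ, (sg a : ℝ) * sg ρ * W x a ρ * W x ρ σ * (sg σ * sg b * W x σ b) := by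
        rw [Finset.sum_comm]
        simp only [← Finset.sum_neg_distrib]
        refine Finset.sum_congr rfl fun μ _ => Finset.sum_congr rfl fun ν _ => ?_
        rw [hq b ν, hq ν μ, hq μ a]
        ring
      rw [hEq, hEq, e1, e2, hq b a]
      ring
    rw [forall₂_congr fun v hv => by rw [h1 v hv], forall_antisym_iff fun a b => by
      rw [hrA, hEA]
      push_cast
      ring]
    refine forall_congr' fun a => forall_congr' fun b => ?_
    rw [neg_eq_zero, sub_eq_zero_iff_eq_one_div_mul hk, mul_left_comm, ← mul_assoc]

/-! The vector field of the first type -/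

/-- The antisymmetric matrix with the given entries above the diagonal. -/
def antisymOf (a b c d e f : ℝ) : Fin 4 → Fin 4 → ℝ :=
  ![![0, a, b, c], ![-a, 0, d, e], ![-b, -d, 0, f], ![-c, -e, -f, 0]]

theorem antisymOf_add (a b c d e f a' b' c' d' e' f' : ℝ) :
    antisymOf a b c d e f + antisymOf a' b' c' d' e' f'
      = antisymOf (a + a') (b + b') (c + c') (d + d') (e + e') (f + f') := by
  funext i j
  fin_cases i <;> fin_cases j <;> simp [antisymOf] <;> ring

theorem antisymOf_sub (a b c d e f a' b' c' d' e' f' : ℝ) :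
    antisymOf a b c d e f - antisymOf a' b' c' d' e' f'
      = antisymOf (a - a') (b - b') (c - c') (d - d') (e - e') (f - f') := by
  funext i j
  fin_cases i <;> fin_cases j <;> simp [antisymOf] <;> ring

theorem antisymOf_smul (r a b c d e f : ℝ) : r • antisymOf a b c d e f
    = antisymOf (r * a) (r * b) (r * c) (r * d) (r * e) (r * f) := by
  funext i j
  fin_cases i <;> fin_cases j <;> simp [antisymOf]

/-- The structure of the Lorentz Lie algebra in six coordinates. With it the curvature of the vector
field can be computed without expanding sums over four-by-four arrays. -/
theorem bracket_antisymOf (a b c d e f a' b' c' d' e' f' : ℝ) :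
    bracket (antisymOf a b c d e f) (antisymOf a' b' c' d' e' f')
      = antisymOf (b * d' - b' * d + c * e' - c' * e) (-a * d' + a' * d + c * f' - c' * f)
          (-a * e' + a' * e - b * f' + b' * f) (-a * b' + a' * b + e * f' - e' * f)
          (-a * c' + a' * c - d * f' + d' * f) (-b * c' + b' * c + d * e' - d' * e) := by
  funext i j
  fin_cases i <;> fin_cases j <;> simp [antisymOf, bracket, Fin.sum_univ_four, sg] <;> ring

theorem minkowski2_antisymOf (a b c d e f a' b' c' d' e' f' : ℝ) :
    minkowski2 (antisymOf a b c d e f) (antisymOf a' b' c' d' e' f')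
      = 2 * (-a * a' - b * b' - c * c' + d * d' + e * e' + f * f') := by
  simp [antisymOf, minkowski2, Fin.sum_univ_four, sg]
  ring

/-- The cosine part is the antisymmetrization of δ_α ⊗ B; the sine part is its Hodge dual, because 𝒥
acts on two-index Θ by duality. -/
noncomputable def vectorComp (ζ : ℝ) : (Fin 4 → ℝ) →ₗ[ℝ] Fin 4 → Fin 4 → Fin 4 → ℝ where
  toFun B α ρ σ := Real.cos ζ * ((1 / 2) * ((if α = ρ then B σ else 0) - if α = σ then B ρ else 0))
    + Real.sin ζ * ((1 / 2) * ∑ β, (sg ρ : ℝ) * sg σ * (eps α β ρ σ : ℝ) * B β)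
  map_add' B C := by
    ext α ρ σ
    simp only [Pi.add_apply, mul_add, Finset.sum_add_distrib]
    split_ifs <;> ring
  map_smul' r B := by
    ext α ρ σ
    simp only [Pi.smul_apply, smul_eq_mul, RingHom.id_apply, Finset.mul_sum, mul_add]
    congr 1
    · split_ifs <;> ring
    · exact Finset.sum_congr rfl fun _ _ => by ring

/-- The components of `vectorComp`, with `c = cos ζ / 2` and `s = sin ζ / 2`. -/
def vectorBlock (c s : ℝ) (B : Fin 4 → ℝ) : Fin 4 → Fin 4 → Fin 4 → ℝ :=
  ![antisymOf (c * B 1) (c * B 2) (c * B 3) (s * B 3) (-s * B 2) (s * B 1),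
    antisymOf (-c * B 0) (s * B 3) (-s * B 2) (c * B 2) (c * B 3) (-s * B 0),
    antisymOf (-s * B 3) (-c * B 0) (s * B 1) (-c * B 1) (s * B 0) (c * B 3),
    antisymOf (s * B 2) (-s * B 1) (-c * B 0) (-s * B 0) (-c * B 1) (-c * B 2)]

theorem vectorComp_apply (ζ : ℝ) (B : Fin 4 → ℝ) :
    vectorComp ζ B = vectorBlock (Real.cos ζ / 2) (Real.sin ζ / 2) B := by
  funext α ρ σ
  change Real.cos ζ * ((1 / 2) * ((if α = ρ then B σ else 0) - if α = σ then B ρ else 0))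
    + Real.sin ζ * ((1 / 2) * ∑ β, (sg ρ : ℝ) * sg σ * (eps α β ρ σ : ℝ) * B β) = _
  fin_cases α <;> fin_cases ρ <;> fin_cases σ <;>
    simp [vectorBlock, antisymOf, Fin.sum_univ_four, eps_cast, sg] <;> ring

theorem vectorDivTerm_jet (P : Fin 4 → Fin 4 → ℝ) :
    ∑ α, ∑ β, ∑ ρ, ∑ σ, (eps α β ρ σ : ℝ) * (sg α * P α β) * (sg ρ * P ρ σ)
      = -2 * ((P 2 3 - P 3 2) * (P 0 1 + P 1 0) - (P 1 3 - P 3 1) * (P 0 2 + P 2 0)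
          + (P 1 2 - P 2 1) * (P 0 3 + P 3 0)) := by
  simp [Fin.sum_univ_four, eps_cast, sg]
  ring

/-- A polynomial identity in independent c and s, without c² + s² = 1. The coefficients are the real
parts of the second, third and fourth powers of c + is, and the imaginary part of the square; for c
= cos ζ, s = sin ζ they become the multiple-angle functions. -/
theorem sum_strength_vectorBlock (c s : ℝ) (Q : Fin 4 → ℝ) (P : Fin 4 → Fin 4 → ℝ) :
    -32 * ∑ α, ∑ β, (sg α : ℝ) * (sg β : ℝ) *
        minkowski2 (strength (vectorBlock (c / 2) (s / 2)) Q P α β)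
          (strength (vectorBlock (c / 2) (s / 2)) Q P α β)
      = -384 * (∑ α, sg α * Q α * Q α) ^ 2 * (c ^ 4 - 6 * c ^ 2 * s ^ 2 + s ^ 4)
    - 256 * (∑ α, ∑ β, (Q α * (sg α * Q α) * P β β - Q α * (sg β * Q β) * P α β))
      * (c ^ 3 - 3 * c * s ^ 2)
    - 32 * (2 * (∑ α, ∑ β, P α β * (sg α * (sg β * P α β))) + (∑ α, P α α) ^ 2) * (c ^ 2 - s ^ 2)
    - 32 * (-2 * ((P 2 3 - P 3 2) * (P 0 1 + P 1 0) - (P 1 3 - P 3 1) * (P 0 2 + P 2 0)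
          + (P 1 2 - P 2 1) * (P 0 3 + P 3 0))) * (2 * s * c) := by
  simp only [Fin.sum_univ_four, strength, vectorBlock, Matrix.cons_val, bracket_antisymOf,
    antisymOf_add, antisymOf_sub, antisymOf_smul, minkowski2_antisymOf, sg_zero, sg_one, sg_two,
    sg_three, Int.cast_one, Int.cast_neg]
  ring

/-- Symmetry of the second derivatives removes the coefficient 2cs: the sin 2ζ part of the
Lagrangian is a divergence and leaves no trace in the field equation. -/
theorem sum_dstrength_vectorBlock (c s : ℝ) (Q : Fin 4 → ℝ) (P : Fin 4 → Fin 4 → ℝ)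
    {H : Fin 4 → Fin 4 → Fin 4 → ℝ} (hs : ∀ γ α, H γ α = H α γ) (v : Fin 4 → ℝ) :
    -32 * ∑ α, ∑ β, (sg α : ℝ) * (sg β : ℝ) *
        minkowski2 (dstrength (vectorBlock (c / 2) (s / 2)) Q P H α β)
          (vectorBlock (c / 2) (s / 2) v β)
      = -32 * ∑ a, v a * ((c ^ 2 - s ^ 2) * (∑ α, sg α * (sg a * H α α a) + (1 / 2) * ∑ β, H a β β)
        + 6 * (c ^ 3 - 3 * c * s ^ 2) * (∑ β, (sg β * Q β * P a β - sg a * Q a * P β β))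
        - 12 * (c ^ 4 - 6 * c ^ 2 * s ^ 2 + s ^ 4) * (∑ β, sg β * Q β * Q β) * (sg a * Q a)) := by
  simp only [Fin.sum_univ_four, dstrength, strength, vectorBlock, Matrix.cons_val,
    bracket_antisymOf, antisymOf_add, antisymOf_sub, antisymOf_smul, minkowski2_antisymOf, sg_zero,
    sg_one, sg_two, sg_three, Int.cast_one, Int.cast_neg, hs 1 0, hs 2 0, hs 3 0, hs 2 1, hs 3 1,
    hs 3 2]
  ring

/-! ### The divergence term of the vector Lagrangian -/

/-- The bilinear form `ε_{αβρσ} (∂^α A^β) (∂^ρ B^σ)`. -/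
noncomputable def curlPair (A B : Spacetime → Fin 4 → ℝ) (x : Spacetime) : ℝ :=
  ∑ α, ∑ β, ∑ ρ, ∑ σ, (eps α β ρ σ : ℝ) * pdU α (up1 A β) x * pdU ρ (up1 B σ) x

/-- The current `ε_{αβρσ} A^β ∂^ρ B^σ`. -/
noncomputable def curlCurrent (A B : Spacetime → Fin 4 → ℝ) (α : Fin 4) (y : Spacetime) : ℝ :=
  ∑ β, ∑ ρ, ∑ σ, (eps α β ρ σ : ℝ) * up1 A β y * pdU ρ (up1 B σ) y

theorem eps_swap (α β ρ σ : Fin 4) : eps ρ β α σ = -eps α β ρ σ := by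
  have e1 := eps_eq ρ β α σ
  have e2 := eps_eq α β ρ σ
  have e3 : 12 * eps ρ β α σ + 12 * eps α β ρ σ = 0 := by
    rw [e1, e2]
    ring
  linarith

theorem eps_swap_pairs (α β ρ σ : Fin 4) : eps ρ σ α β = eps α β ρ σ := by
  have e1 := eps_eq ρ σ α β
  have e2 := eps_eq α β ρ σ
  have e3 : 12 * eps ρ σ α β - 12 * eps α β ρ σ = 0 := by
    rw [e1, e2]
    ring
  linarith

/-- Exchanging the two index pairs is an even permutation of the arguments of ε. -/
theorem curlPair_comm (A B : Spacetime → Fin 4 → ℝ) (x : Spacetime) :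
    curlPair A B x = curlPair B A x := by
  have h : ∀ f : Fin 4 → Fin 4 → Fin 4 → Fin 4 → ℝ,
      ∑ α, ∑ β, ∑ ρ, ∑ σ, f α β ρ σ = ∑ α, ∑ β, ∑ ρ, ∑ σ, f ρ σ α β := by
    intro f
    have h1 : ∀ g : Fin 4 → Fin 4 → Fin 4 → Fin 4 → ℝ,
        ∑ α, ∑ β, ∑ ρ, ∑ σ, g α β ρ σ = ∑ p : Fin 4 × Fin 4, ∑ q : Fin 4 × Fin 4,
          g p.1 p.2 q.1 q.2 := by
      intro g
      simp only [Fintype.sum_prod_type]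
    rw [h1, h1, Finset.sum_comm]
  rw [curlPair, h]
  refine Finset.sum_congr rfl fun α _ => Finset.sum_congr rfl fun β _ =>
    Finset.sum_congr rfl fun ρ _ => Finset.sum_congr rfl fun σ _ => ?_
  rw [eps_swap_pairs]
  ring

theorem contDiff_pdU {f : Spacetime → ℝ} (hf : ContDiff ℝ ∞ f) (α : Fin 4) :
    ContDiff ℝ ∞ (pdU α f) := contDiff_const.mul (contDiff_pd hf α)

theorem contDiff_curlCurrent {A B : Spacetime → Fin 4 → ℝ} (hA : ContDiff ℝ ∞ A)
    (hB : ContDiff ℝ ∞ B) (α : Fin 4) : ContDiff ℝ ∞ (curlCurrent A B α) :=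
  ContDiff.sum fun β _ => ContDiff.sum fun ρ _ => ContDiff.sum fun σ _ =>
    (contDiff_const.mul (contDiff_up1 hA β)).mul (contDiff_pdU (contDiff_up1 hB σ) ρ)

theorem contDiff_curlPair {A B : Spacetime → Fin 4 → ℝ} (hA : ContDiff ℝ ∞ A)
    (hB : ContDiff ℝ ∞ B) : ContDiff ℝ ∞ (curlPair A B) :=
  ContDiff.sum fun α _ => ContDiff.sum fun β _ => ContDiff.sum fun ρ _ => ContDiff.sum fun σ _ =>
    (contDiff_const.mul (contDiff_pdU (contDiff_up1 hA β) α)).mul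
      (contDiff_pdU (contDiff_up1 hB σ) ρ)

theorem curlPair_eq_divergence {A B : Spacetime → Fin 4 → ℝ} (hA : ContDiff ℝ ∞ A)
    (hB : ContDiff ℝ ∞ B) (x : Spacetime) :
    curlPair A B x = ∑ α, pdU α (curlCurrent A B α) x := by
  have h1 : ∀ α, pdU α (curlCurrent A B α) x = (∑ β, ∑ ρ, ∑ σ, (eps α β ρ σ : ℝ) *
        pdU α (up1 A β) x * pdU ρ (up1 B σ) x)
      + ∑ β, ∑ ρ, ∑ σ, (eps α β ρ σ : ℝ) * up1 A β x * pdU α (pdU ρ (up1 B σ)) x := by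
    intro α
    have hs := fun β ρ σ => (contDiff_const (c := (eps α β ρ σ : ℝ))).mul (contDiff_up1 hA β)
    have hd := fun ρ σ => contDiff_pdU (contDiff_up1 hB σ) ρ
    have ht := fun β ρ σ => (hs β ρ σ).mul (hd ρ σ)
    have e : pd α (curlCurrent A B α) x = ∑ β, ∑ ρ, ∑ σ, ((eps α β ρ σ : ℝ) *
        pd α (up1 A β) x * pdU ρ (up1 B σ) x
        + (eps α β ρ σ : ℝ) * up1 A β x * pd α (pdU ρ (up1 B σ)) x) := by
      unfold curlCurrent
      rw [pd_sum α fun β _ => differentiable_of_smooth (ContDiff.sum fun ρ _ =>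
        ContDiff.sum fun σ _ => ht β ρ σ) x]
      refine Finset.sum_congr rfl fun β _ => ?_
      rw [pd_sum α fun ρ _ => differentiable_of_smooth (ContDiff.sum fun σ _ => ht β ρ σ) x]
      refine Finset.sum_congr rfl fun ρ _ => ?_
      rw [pd_sum α fun σ _ => differentiable_of_smooth (ht β ρ σ) x]
      refine Finset.sum_congr rfl fun σ _ => ?_
      rw [pd_mul α (differentiable_of_smooth (hs β ρ σ) x) (differentiable_of_smooth (hd ρ σ) x),
        pd_const_mul α (differentiable_of_smooth (contDiff_up1 hA β) x)]
    rw [pdU, e]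
    simp only [Finset.mul_sum, ← Finset.sum_add_distrib]
    refine Finset.sum_congr rfl fun β _ => Finset.sum_congr rfl fun ρ _ =>
      Finset.sum_congr rfl fun σ _ => ?_
    simp only [pdU_eq α]
    ring
  -- Mixed second derivatives are symmetric in α and ρ while ε is antisymmetric, so the sum equals
  -- its own negative.
  have h2 : ∑ α, ∑ β, ∑ ρ, ∑ σ, (eps α β ρ σ : ℝ) * up1 A β x * pdU α (pdU ρ (up1 B σ)) x = 0 := by
    have h3 : ∑ α, ∑ β, ∑ ρ, ∑ σ, (eps α β ρ σ : ℝ) * up1 A β x * pdU α (pdU ρ (up1 B σ)) x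
        = -∑ α, ∑ β, ∑ ρ, ∑ σ, (eps α β ρ σ : ℝ) * up1 A β x * pdU α (pdU ρ (up1 B σ)) x := by
      conv_lhs => rw [Finset.sum_comm]
      conv_rhs => rw [Finset.sum_comm]
      rw [← Finset.sum_neg_distrib]
      refine Finset.sum_congr rfl fun β _ => ?_
      conv_lhs => rw [Finset.sum_comm]
      simp only [← Finset.sum_neg_distrib]
      refine Finset.sum_congr rfl fun α _ => Finset.sum_congr rfl fun ρ _ =>
        Finset.sum_congr rfl fun σ _ => ?_
      have h4 := pd_pd_comm (contDiff_up1 hB σ) α ρ x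
      have h5 : ∀ α ρ, pdU α (pdU ρ (up1 B σ)) x = sg α * (sg ρ * pd α (pd ρ (up1 B σ)) x) :=
        fun α ρ => congrArg _ (pd_pdU (contDiff_up1 hB σ) α ρ x)
      rw [eps_swap, h5, h5]
      have h6 : pd α (pd ρ (up1 B σ)) x = pd ρ (pd α (up1 B σ)) x := h4
      rw [h6]
      push_cast
      ring
    linarith
  simp only [h1, Finset.sum_add_distrib, h2, add_zero]
  rfl

theorem pd_ofReal {f : Spacetime → ℝ} (hf : ContDiff ℝ ∞ f) (α : Fin 4) (x : Spacetime) :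
    pd α (fun y => (f y : ℂ)) x = ((pd α f x : ℝ) : ℂ) :=
  pd_linear (Complex.ofRealCLM : ℝ →ₗ[ℝ] ℂ) (differentiable_of_smooth hf x) α

/-- The undifferentiated factor of the current is δ, so the current has compact support even though
B need not. -/
theorem setIntegral_curlPair {δ B : Spacetime → Fin 4 → ℝ} (hδ : ContDiff ℝ ∞ δ)
    (hs : HasCompactSupport δ) (hB : ContDiff ℝ ∞ B) {K : Set Spacetime} (hK : tsupport δ ⊆ K) :
    ∫ x in K, (curlPair δ B x : ℂ) = 0 := by
  have hJ := fun α => (contDiff_const (c := (sg α : ℝ))).mul (contDiff_curlCurrent hδ hB α)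
  have hJ' : ∀ α, ContDiff ℝ ∞ fun y => ((sg α * curlCurrent δ B α y : ℝ) : ℂ) := fun α =>
    Complex.ofRealCLM.contDiff.comp (hJ α)
  have hJs : ∀ α, HasCompactSupport fun y => ((sg α * curlCurrent δ B α y : ℝ) : ℂ) := fun α =>
    HasCompactSupport.intro hs fun x hx => by
      simp [curlCurrent, up1, image_eq_zero_of_notMem_tsupport hx]
  have h1 : (fun x => (curlPair δ B x : ℂ))
      = fun x => ∑ α, pd α (fun y => ((sg α * curlCurrent δ B α y : ℝ) : ℂ)) x := by
    funext x
    rw [curlPair_eq_divergence hδ hB]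
    push_cast
    refine Finset.sum_congr rfl fun α _ => ?_
    rw [← Complex.ofReal_intCast]
    simp only [← Complex.ofReal_mul]
    rw [pd_ofReal (hJ α), pdU,
      pd_const_mul α (differentiable_of_smooth (contDiff_curlCurrent hδ hB α) x)]
  rw [setIntegral_eq_integral_of_forall_compl_eq_zero, h1, integral_finsetSum]
  · simp only [fun α => integral_pd_eq_zero (hJ' α) (hJs α) α, Finset.sum_const_zero]
  · exact fun α _ => (contDiff_pd (hJ' α) α).continuous.integrable_of_hasCompactSupport
      (hasCompactSupport_pd (hJs α) α)
  · intro x hx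
    have h2 : ∀ α β, pdU α (up1 δ β) x = 0 := by
      intro α β
      have : fderiv ℝ δ x = 0 := by
        by_contra hne
        exact hx (hK (support_fderiv_subset ℝ hne))
      rw [pdU, pd_up1 hδ, up1, pd, this]
      simp
    simp [curlPair, h2]

theorem curlPair_add_smul {B δ : Spacetime → Fin 4 → ℝ} (hB : ContDiff ℝ ∞ B)
    (hδ : ContDiff ℝ ∞ δ) (ε : ℝ) (x : Spacetime) :
    curlPair (fun y => B y + ε • δ y) (fun y => B y + ε • δ y) x
      = curlPair B B x + ε * (2 * curlPair δ B x) + ε ^ 2 * curlPair δ δ x := by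
  have h : ∀ α β, pdU α (up1 (fun y => B y + ε • δ y) β) x
      = pdU α (up1 B β) x + ε * pdU α (up1 δ β) x := by
    intro α β
    have hd := differentiable_of_smooth (contDiff_up1 hδ β) x
    have : up1 (fun y => B y + ε • δ y) β = fun y => up1 B β y + ε • up1 δ β y := rfl
    rw [pdU, this, pd_add α (differentiable_of_smooth (contDiff_up1 hB β) x)
      (hd.fun_const_smul ε), pd_const_smul α hd, pdU, pdU, smul_eq_mul]
    ring
  have h2 : ε * (2 * curlPair δ B x) = ε * curlPair δ B x + ε * curlPair B δ x := by
    rw [curlPair_comm B δ]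
    ring
  rw [h2]
  simp only [curlPair, h, Finset.mul_sum, ← Finset.sum_add_distrib]
  refine Finset.sum_congr rfl fun α _ => Finset.sum_congr rfl fun β _ =>
    Finset.sum_congr rfl fun ρ _ => Finset.sum_congr rfl fun σ _ => ?_
  ring

theorem isStationaryAt_vectorDivTerm {B : Spacetime → Fin 4 → ℝ} (hB : ContDiff ℝ ∞ B) :
    IsStationaryAt Set.univ (fun q x => (vectorDivTerm q x : ℂ)) B := by
  intro δ hδ hs _ K hK hsub
  have hc : ∀ {f : Spacetime → ℝ}, ContDiff ℝ ∞ f → Continuous fun x => (f x : ℂ) :=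
    fun hf => Complex.continuous_ofReal.comp hf.continuous
  have h := hasDerivAt_integral_of_polynomial hK
    -- The term is quadratic in ε, so the five coefficients are padded with zeros. The 2 comes from
    -- the symmetry of the form.
    (c := ![fun x => (curlPair B B x : ℂ), fun x => ((2 * curlPair δ B x : ℝ) : ℂ),
      fun x => (curlPair δ δ x : ℂ), 0, 0])
    (fun k => by
      fin_cases k
      exacts [hc (contDiff_curlPair hB hB), hc (contDiff_const.mul (contDiff_curlPair hδ hB)),
        hc (contDiff_curlPair hδ hδ), continuous_const, continuous_const])
    (f := fun ε x => (vectorDivTerm (fun y => B y + ε • δ y) x : ℂ)) (fun ε x => by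
      have : vectorDivTerm (fun y => B y + ε • δ y) x = _ := curlPair_add_smul hB hδ ε x
      rw [this]
      simp [Fin.sum_univ_five])
  refine h.congr_deriv ?_
  have : ∫ x in K, ((2 * curlPair δ B x : ℝ) : ℂ) = 2 * ∫ x in K, (curlPair δ B x : ℂ) := by
    rw [← integral_const_mul]
    simp
  exact this.trans (by rw [setIntegral_curlPair hδ hs hB hsub, mul_zero])

/-! ### The force field and field equation of the first vector type -/

theorem vTensor_apply (α κ : Fin 4) : vTensor α κ = theta [κ, α] := by
  simp [vTensor, basisTensor, Finset.sum_apply]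

/-- The cosine parts agree by antisymmetry of Θ_{ρσ}, each half of the antisymmetrization giving the
same sum; the sine parts agree by `calJ_mul_theta_pair`. -/
theorem vectorForce_eq (ζ : ℝ) (B : Fin 4 → ℝ) :
    vectorForce ζ B = forceOf thetaTensor (vectorComp ζ) B := by
  funext κ
  have h1 : forceOf thetaTensor (vectorComp ζ) B κ = ∑ ρ, ∑ σ,
      (Real.cos ζ * ((1 / 2) * ((if κ = ρ then B σ else 0) - if κ = σ then B ρ else 0))
        + Real.sin ζ * ((1 / 2) * ∑ β, (sg ρ : ℝ) * sg σ * (eps κ β ρ σ : ℝ) * B β))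
        • theta [ρ, σ] := rfl
  have h2 : ∑ ρ, ∑ σ, (Real.cos ζ * ((1 / 2) *
      ((if κ = ρ then B σ else 0) - if κ = σ then B ρ else 0))) • theta [ρ, σ]
      = ∑ β, B β • Real.cos ζ • theta [κ, β] := by
    have e1 : ∑ ρ, ∑ σ, (Real.cos ζ * ((1 / 2) * (if κ = ρ then B σ else 0))) • theta [ρ, σ]
        = ∑ β, (Real.cos ζ * ((1 / 2) * B β)) • theta [κ, β] := by
      rw [Finset.sum_eq_single κ]
      · simp
      · intro ρ _ hρ
        simp [hρ.symm]
      · simp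
    have e2 : ∑ ρ, ∑ σ, (Real.cos ζ * ((1 / 2) * (if κ = σ then B ρ else 0))) • theta [ρ, σ]
        = -∑ β, (Real.cos ζ * ((1 / 2) * B β)) • theta [κ, β] := by
      rw [← Finset.sum_neg_distrib]
      refine Finset.sum_congr rfl fun ρ _ => ?_
      rw [Finset.sum_eq_single κ]
      · rw [theta_swap κ ρ]
        simp
      · intro σ _ hσ
        simp [hσ.symm]
      · simp
    simp only [mul_sub, sub_smul, Finset.sum_sub_distrib, e1, e2, sub_neg_eq_add]
    rw [← Finset.sum_add_distrib]
    refine Finset.sum_congr rfl fun β _ => ?_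
    rw [← add_smul, smul_smul]
    congr 1
    ring
  have h3 : ∑ ρ, ∑ σ, (Real.sin ζ * ((1 / 2) *
      ∑ β, (sg ρ : ℝ) * sg σ * (eps κ β ρ σ : ℝ) * B β)) • theta [ρ, σ]
      = ∑ β, B β • Real.sin ζ • (calJ * theta [κ, β]) := by
    have e : ∀ β, calJ * theta [κ, β]
        = ∑ ρ, ∑ σ, ((1 / 2 : ℝ) * (sg ρ * sg σ * eps κ β ρ σ)) • theta [ρ, σ] := by
      intro β
      rw [calJ_mul_theta_pair]
      refine Finset.sum_congr rfl fun ρ _ => Finset.sum_congr rfl fun σ _ => ?_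
      rw [← Complex.coe_smul]
      push_cast
      rfl
    simp only [e, Finset.smul_sum, Finset.mul_sum, Finset.sum_smul]
    have h4 : ∀ f : Fin 4 → Fin 4 → Fin 4 → Mat,
        ∑ ρ, ∑ σ, ∑ β, f ρ σ β = ∑ β, ∑ ρ, ∑ σ, f ρ σ β := by
      intro f
      rw [Finset.sum_comm]
      rw [Finset.sum_congr rfl fun _ _ => Finset.sum_comm, Finset.sum_comm]
      exact Finset.sum_congr rfl fun _ _ => Finset.sum_comm
    refine (h4 _).trans ?_
    refine Finset.sum_congr rfl fun β _ => Finset.sum_congr rfl fun ρ _ =>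
      Finset.sum_congr rfl fun σ _ => ?_
    rw [smul_smul, smul_smul]
    congr 1
    ring
  rw [h1]
  simp only [add_smul, Finset.sum_add_distrib]
  rw [h2, h3, ← Finset.sum_add_distrib, vectorForce, Finset.sum_apply]
  refine Finset.sum_congr rfl fun β _ => ?_
  rw [Pi.smul_apply, matAct, vTensor_apply, expJ_mul, Complex.coe_smul, smul_add]

theorem source_vectorForce (ζ : ℝ) (B : Fin 4 → ℝ) (ψ : Spinor) :
    source ψ (vectorForce ζ B)
      = ∑ α, (B α : ℂ) * herm ψ ((∑ β, gammaUp β * expJ ζ * theta [β, α]) *ᵥ ψ) := by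
  rw [vectorForce, source_sum]
  refine Finset.sum_congr rfl fun α _ => ?_
  rw [source_smul, source]
  simp only [matAct, vTensor_apply, mul_assoc]

theorem antisymOf_mem (a b c d e f : ℝ) : antisymOf a b c d e f ∈ Antisym := by
  intro i j
  fin_cases i <;> fin_cases j <;> simp [antisymOf]

theorem vectorComp_mem (ζ : ℝ) (B : Fin 4 → ℝ) (α : Fin 4) : vectorComp ζ B α ∈ Antisym := by
  rw [vectorComp_apply]
  fin_cases α <;> exact antisymOf_mem _ _ _ _ _ _

theorem cos_two_mul_eq (ζ : ℝ) : Real.cos (2 * ζ) = Real.cos ζ ^ 2 - Real.sin ζ ^ 2 := by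
  rw [two_mul, Real.cos_add]
  ring

theorem cos_three_mul_eq (ζ : ℝ) :
    Real.cos (3 * ζ) = Real.cos ζ ^ 3 - 3 * Real.cos ζ * Real.sin ζ ^ 2 := by
  rw [show 3 * ζ = 2 * ζ + ζ by ring, Real.cos_add, cos_two_mul_eq, Real.sin_two_mul]
  ring

theorem cos_four_mul_eq (ζ : ℝ) : Real.cos (4 * ζ)
    = Real.cos ζ ^ 4 - 6 * Real.cos ζ ^ 2 * Real.sin ζ ^ 2 + Real.sin ζ ^ 4 := by
  rw [show 4 * ζ = 2 * (2 * ζ) by ring, cos_two_mul_eq, cos_two_mul_eq, Real.sin_two_mul]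
  ring

theorem vectorPotential_eq {ζ : ℝ} {B : Spacetime → Fin 4 → ℝ} (hB : ContDiff ℝ ∞ B)
    (x : Spacetime) : -32 * ∑ α, ∑ β, (sg α : ℝ) * (sg β : ℝ) *
        minkowski2 (strength (vectorComp ζ) (B x) (fun γ => pd γ B x) α β)
          (strength (vectorComp ζ) (B x) (fun γ => pd γ B x) α β)
      = vectorPotential ζ B x := by
  have h : ⇑(vectorComp ζ) = vectorBlock (Real.cos ζ / 2) (Real.sin ζ / 2) :=
    funext (vectorComp_apply ζ)
  have hd : vectorDivTerm B x = ∑ α, ∑ β, ∑ ρ, ∑ σ, (eps α β ρ σ : ℝ) *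
      (sg α * pd α B x β) * (sg ρ * pd ρ B x σ) := by
    simp only [vectorDivTerm, pdU, pd_up1 hB, up1]
  rw [h, sum_strength_vectorBlock, vectorPotential, hd, vectorDivTerm_jet, cos_two_mul_eq,
    cos_three_mul_eq, cos_four_mul_eq, Real.sin_two_mul]
  simp only [pdU, pd_up1 hB, pd_low1 hB, up1, low1]

theorem vector_case (m τ ζ : ℝ) {ψ : Spacetime → Spinor} (hψ : ContDiff ℝ ∞ ψ)
    {B : Spacetime → Fin 4 → ℝ} (hB : ContDiff ℝ ∞ B) :
    (∀ x, IsForceTensor (vectorForce ζ (B x))) ∧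
      (∀ x, LV (fun y => vectorForce ζ (B y)) x = (vectorPotential ζ B x : ℂ)) ∧
      (∀ x, vectorDivTerm B x = ∑ α, pdU α (fun y =>
        ∑ β, ∑ ρ, ∑ σ, (eps α β ρ σ : ℝ) * up1 B β y * pdU ρ (up1 B σ) y) x) ∧
      IsStationaryAt Set.univ (fun q x => (vectorDivTerm q x : ℂ)) B ∧
      (τ ≠ 0 → Real.cos (2 * ζ) ≠ 0 →
        (IsStationaryAt Set.univ (fun q => Ltot m τ ψ (fun y => vectorForce ζ (q y))) B ↔
          ∀ x, VectorEquation ζ τ ψ B x)) := by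
  set T := forceOf thetaTensor (vectorComp ζ) with hTdef
  have hF : ∀ v, IsForceTensor (T v) := fun v =>
    isForceTensor_iff.2 fun α => thetaTensor_mem _
  have hT : ∀ v α, T v α = thetaTensor (vectorComp ζ v α) := fun _ _ => rfl
  have hTf : ∀ v, vectorForce ζ v = T v := vectorForce_eq ζ
  refine ⟨fun x => hTf (B x) ▸ hF _, fun x => ?_, curlPair_eq_divergence hB hB,
    isStationaryAt_vectorDivTerm hB, fun hτ hc => ?_⟩
  · simp only [hTf]
    rw [LV_eq_tracePair _ hB, tracePair_of_thetaTensor (vectorComp_mem ζ) hT,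
      vectorPotential_eq hB]
  · have hk : 128 * τ * Real.cos (2 * ζ) ≠ 0 := by positivity
    simp only [hTf]
    rw [isStationaryAt_iff hF (fun _ _ _ => Set.mem_univ _) m τ hψ hB]
    refine forall_congr' fun x => ?_
    rw [VectorEquation]
    set E : Fin 4 → ℝ := fun α => box (low1 B α) x + (1 / 2) * ∑ β, pd α (pd β (up1 B β)) x
      + 6 * Real.cos (3 * ζ) / Real.cos (2 * ζ) *
        ∑ β, (low1 B β x * pd α (up1 B β) x - low1 B α x * pd β (up1 B β) x)
      - 12 * Real.cos (4 * ζ) / Real.cos (2 * ζ) *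
        (∑ β, low1 B β x * up1 B β x) * low1 B α x with hE
    have hEq : ∀ a, Real.cos (2 * ζ) * E a = Real.cos (2 * ζ) *
          (∑ α, sg α * (sg a * pd α (pd α B) x a) + (1 / 2) * ∑ β, pd a (pd β B) x β)
        + 6 * Real.cos (3 * ζ) * (∑ β, (sg β * B x β * pd a B x β - sg a * B x a * pd β B x β))
        - 12 * Real.cos (4 * ζ) * (∑ β, sg β * B x β * B x β) * (sg a * B x a) := by
      intro a
      -- Clearing the denominator cos 2ζ is done once, with opaque variables in place of the long
      -- sums.
      have aux : ∀ b g d e f c₃ c₄ : ℝ, Real.cos (2 * ζ) * (b + (1 / 2) * g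
          + 6 * c₃ / Real.cos (2 * ζ) * d - 12 * c₄ / Real.cos (2 * ζ) * e * f)
          = Real.cos (2 * ζ) * (b + (1 / 2) * g) + 6 * c₃ * d - 12 * c₄ * e * f := by
        intros
        field_simp
      simp only [hE, box_eq (contDiff_low1 hB _), pd_low1 hB, pd_up1 hB,
        pd_low1 (contDiff_pd hB _), pd_up1 (contDiff_pd hB _), up1, low1]
      exact aux _ _ _ _ _ _ _
    have h1 : ∀ v, eulerLagrange T τ (ψ x) (B x)
        (fun γ => pd γ B x) (fun γ α => pd γ (fun y => pd α B y) x) v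
        = ∑ α, (v α : ℂ) *
          (herm (ψ x) ((∑ β, gammaUp β * expJ ζ * theta [β, α]) *ᵥ ψ x)
            - (128 * τ * Real.cos (2 * ζ) : ℝ) * E α) := by
      intro v
      have h : ⇑(vectorComp ζ) = vectorBlock (Real.cos ζ / 2) (Real.sin ζ / 2) :=
        funext (vectorComp_apply ζ)
      have h2 := sum_dstrength_vectorBlock (Real.cos ζ) (Real.sin ζ) (B x) (fun γ => pd γ B x)
        (H := fun γ α => pd γ (pd α B) x) (fun γ α => pd_pd_comm hB γ α x) v
      simp only [← h, ← cos_two_mul_eq, ← cos_three_mul_eq, ← cos_four_mul_eq, ← hEq] at h2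
      rw [eulerLagrange_of_real (yangMills_of_thetaTensor (vectorComp_mem ζ) hT _ _ _ _), ← hTf,
        source_vectorForce]
      refine (congrArg (fun r : ℝ => _ + 4 * (τ : ℂ) * (r : ℂ)) h2).trans ?_
      simp only [mul_sub, Finset.sum_sub_distrib]
      rw [sub_eq_add_neg]
      congr 1
      push_cast
      simp only [Finset.mul_sum, ← Finset.sum_neg_distrib]
      refine Finset.sum_congr rfl fun a _ => ?_
      ring
    simp only [h1]
    rw [forall_sum_mul_eq_zero_iff]
    exact forall_congr' fun α => sub_eq_zero_iff_eq_one_div_mul hk _ _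

/-! The Fierz tensor field -/

/-- Antisymmetrization in the last two indices makes the map linear on all arrays without changing
the force, since Θ_{ρσ} is antisymmetric. The two contraction conditions restrict only the
admissible variations. -/
noncomputable def fierzComp :
    (Fin 4 → Fin 4 → Fin 4 → ℝ) →ₗ[ℝ] Fin 4 → Fin 4 → Fin 4 → ℝ where
  toFun F α ρ σ := (sg α : ℝ) * ((1 / 2) * (F α ρ σ - F α σ ρ))
  map_add' F G := by
    ext α ρ σ
    simp only [Pi.add_apply]
    ring
  map_smul' r F := by
    ext α ρ σ
    simp only [Pi.smul_apply, smul_eq_mul, RingHom.id_apply]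
    ring

theorem fierzComp_mem (F : Fin 4 → Fin 4 → Fin 4 → ℝ) (α : Fin 4) : fierzComp F α ∈ Antisym := by
  intro ρ σ
  change (sg α : ℝ) * ((1 / 2) * (F α ρ σ - F α σ ρ)) = -(sg α * ((1 / 2) * (F α σ ρ - F α ρ σ)))
  ring

theorem fierzComp_of_antisym {F : Fin 4 → Fin 4 → Fin 4 → ℝ} {α : Fin 4} (h : F α ∈ Antisym) :
    fierzComp F α = (sg α : ℝ) • F α := by
  funext ρ σ
  change (sg α : ℝ) * ((1 / 2) * (F α ρ σ - F α σ ρ)) = sg α * F α ρ σ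
  rw [h σ ρ]
  ring

/-- Lowering both indices. -/
def lower2 (f : Fin 4 → Fin 4 → ℝ) (ρ σ : Fin 4) : ℝ := (sg ρ : ℝ) * sg σ * f ρ σ

/-- Lowering the contracted index in both factors gives the square of a sign, so indices may be
lowered throughout and compared with `low3`. -/
theorem lower2_bracket (f g : Fin 4 → Fin 4 → ℝ) :
    lower2 (bracket f g) = bracket (lower2 f) (lower2 g) := by
  funext ρ σ
  rw [lower2, bracket, bracket, Finset.mul_sum]
  refine Finset.sum_congr rfl fun κ _ => ?_
  simp only [lower2]
  linear_combination (-sg ρ * sg σ * sg κ * (f ρ κ * g κ σ - g ρ κ * f κ σ) : ℝ) * sg_cast_sq κ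

theorem lower2_add (f g : Fin 4 → Fin 4 → ℝ) : lower2 (f + g) = lower2 f + lower2 g := by
  funext ρ σ
  simp only [lower2, Pi.add_apply]
  ring

theorem lower2_sub (f g : Fin 4 → Fin 4 → ℝ) : lower2 (f - g) = lower2 f - lower2 g := by
  funext ρ σ
  simp only [lower2, Pi.sub_apply]
  ring

theorem lower2_smul (r : ℝ) (f : Fin 4 → Fin 4 → ℝ) : lower2 (r • f) = r • lower2 f := by
  funext ρ σ
  simp only [lower2, Pi.smul_apply, smul_eq_mul]
  ring

theorem minkowski2_eq_lower2 (f g : Fin 4 → Fin 4 → ℝ) :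
    minkowski2 f g = ∑ ρ, ∑ σ, lower2 f ρ σ * g ρ σ := rfl

theorem lower2_fierzComp {F : Spacetime → Fin 4 → Fin 4 → Fin 4 → ℝ} {x : Spacetime} {α : Fin 4}
    (h : F x α ∈ Antisym) : lower2 (fierzComp (F x) α) = fun ρ σ => low3 F α ρ σ x := by
  funext ρ σ
  rw [lower2, fierzComp_of_antisym h, low3, Pi.smul_apply, Pi.smul_apply, smul_eq_mul]
  ring

theorem fierz_pd {F : Spacetime → Fin 4 → Fin 4 → Fin 4 → ℝ} (hF : ContDiff ℝ ∞ F)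
    (h : ∀ x α, F x α ∈ Antisym) (γ : Fin 4) (x : Spacetime) (α : Fin 4) :
    pd γ F x α ∈ Antisym := by
  have h1 : pd γ F x α = pd γ (fun y => F y α) x :=
    (pd_linear (LinearMap.proj α : (Fin 4 → Fin 4 → Fin 4 → ℝ) →ₗ[ℝ] (Fin 4 → Fin 4 → ℝ))
      (differentiable_of_smooth hF x) γ).symm
  rw [h1]
  exact antisym_pd (contDiff_pi.1 hF α) (fun x => h x α) γ x

theorem fierzPotential_eq {F : Spacetime → Fin 4 → Fin 4 → Fin 4 → ℝ} (hF : ContDiff ℝ ∞ F)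
    (h : ∀ x α, F x α ∈ Antisym) (x : Spacetime) :
    -32 * ∑ α, ∑ β, (sg α : ℝ) * (sg β : ℝ) *
        minkowski2 (strength fierzComp (F x) (fun γ => pd γ F x) α β)
          (strength fierzComp (F x) (fun γ => pd γ F x) α β)
      = fierzPotential F x := by
  have h1 : ∀ α β ρ σ, fierzStrength F α β ρ σ x
      = sg ρ * sg σ * strength fierzComp (F x) (fun γ => pd γ F x) α β ρ σ := by
    intro α β ρ σ
    change _ = lower2 (strength fierzComp (F x) (fun γ => pd γ F x) α β) ρ σ
    rw [strength, lower2_add, lower2_sub, lower2_smul, lower2_bracket, lower2_fierzComp (h x _),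
      lower2_fierzComp (h x _), lower2_fierzComp (fierz_pd hF h _ x _),
      lower2_fierzComp (fierz_pd hF h _ x _), fierzStrength, pd_low3 hF, pd_low3 hF]
    rfl
  rw [fierzPotential]
  congr 1
  refine Finset.sum_congr rfl fun α _ => Finset.sum_congr rfl fun β _ => ?_
  rw [minkowski2, Finset.mul_sum]
  refine Finset.sum_congr rfl fun ρ _ => ?_
  rw [Finset.mul_sum]
  refine Finset.sum_congr rfl fun σ _ => ?_
  rw [h1]
  generalize strength fierzComp (F x) (fun γ => pd γ F x) α β ρ σ = y
  linear_combination (-sg α * sg β * sg ρ * sg σ * y * y * sg ρ ^ 2 : ℝ) * sg_cast_sq σ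
    - (sg α * sg β * sg ρ * sg σ * y * y : ℝ) * sg_cast_sq ρ

/-- Writing out the brackets gives ξ̃ with ρ and σ antisymmetrized. L, P and H stand for lowered
values and first and second derivatives, related only by their antisymmetry. -/
theorem sum_dstrength_low {L : Fin 4 → Fin 4 → Fin 4 → ℝ}
    {P : Fin 4 → Fin 4 → Fin 4 → Fin 4 → ℝ} {H : Fin 4 → Fin 4 → Fin 4 → Fin 4 → Fin 4 → ℝ}
    (hL : ∀ β, L β ∈ Antisym) (hP : ∀ γ β, P γ β ∈ Antisym) (hH : ∀ γ δ β, H γ δ β ∈ Antisym)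
    {X : Fin 4 → Fin 4 → Fin 4 → ℝ} (hX : ∀ α ρ σ, X α ρ σ =
      8 * (2 * (∑ β, ∑ ν, ((sg β : ℝ) * (sg ν : ℝ) * L β ν ρ) * P β α σ ν)
      + (∑ β, ∑ ν, ((sg β : ℝ) * (sg ν : ℝ) * L β ν ρ) * P α β ν σ)
      + ∑ β, ∑ ν, ((sg ν : ℝ) * L α ρ ν) * ((sg β : ℝ) * P β β σ ν))
    - 32 * ((∑ β, ∑ μ, ∑ ν, L β ρ μ * ((sg μ : ℝ) * (sg ν : ℝ) * L α μ ν) *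
          ((sg β : ℝ) * L β ν σ))
      - ∑ β, ∑ μ, ∑ ν, L β ρ μ * ((sg β : ℝ) * (sg μ : ℝ) * (sg ν : ℝ) * L β μ ν) * L α ν σ)
    + (∑ β, (sg β : ℝ) * H β β α ρ σ) - ∑ β, (sg β : ℝ) * H β α β ρ σ) (α ρ σ : Fin 4) :
    ∑ β, (sg β : ℝ) * (H β β α - H β α β + (4 : ℝ) • bracket (P β β) (L α)
        + (4 : ℝ) • bracket (L β) (P β α)
        + (4 : ℝ) • bracket (L β) (P β α - P α β + (4 : ℝ) • bracket (L β) (L α))) ρ σ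
      = (1 / 2) * (X α ρ σ - X α σ ρ) := by
  -- The identity already holds for each β. Antisymmetry is used as a rewrite rule to give the
  -- entries a uniform orientation, after which it is polynomial.
  have key : ∀ β, (sg β : ℝ) * (H β β α - H β α β + (4 : ℝ) • bracket (P β β) (L α)
        + (4 : ℝ) • bracket (L β) (P β α)
        + (4 : ℝ) • bracket (L β) (P β α - P α β + (4 : ℝ) • bracket (L β) (L α))) ρ σ
      = (1 / 2) * ((8 * (2 * (∑ ν, ((sg β : ℝ) * (sg ν : ℝ) * L β ν ρ) * P β α σ ν)
      + (∑ ν, ((sg β : ℝ) * (sg ν : ℝ) * L β ν ρ) * P α β ν σ)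
      + ∑ ν, ((sg ν : ℝ) * L α ρ ν) * ((sg β : ℝ) * P β β σ ν))
    - 32 * ((∑ μ, ∑ ν, L β ρ μ * ((sg μ : ℝ) * (sg ν : ℝ) * L α μ ν) *
          ((sg β : ℝ) * L β ν σ))
      - ∑ μ, ∑ ν, L β ρ μ * ((sg β : ℝ) * (sg μ : ℝ) * (sg ν : ℝ) * L β μ ν) * L α ν σ)
    + (sg β : ℝ) * H β β α ρ σ - (sg β : ℝ) * H β α β ρ σ)
    - (8 * (2 * (∑ ν, ((sg β : ℝ) * (sg ν : ℝ) * L β ν σ) * P β α ρ ν)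
      + (∑ ν, ((sg β : ℝ) * (sg ν : ℝ) * L β ν σ) * P α β ν ρ)
      + ∑ ν, ((sg ν : ℝ) * L α σ ν) * ((sg β : ℝ) * P β β ρ ν))
    - 32 * ((∑ μ, ∑ ν, L β σ μ * ((sg μ : ℝ) * (sg ν : ℝ) * L α μ ν) *
          ((sg β : ℝ) * L β ν ρ))
      - ∑ μ, ∑ ν, L β σ μ * ((sg β : ℝ) * (sg μ : ℝ) * (sg ν : ℝ) * L β μ ν) * L α ν ρ)
    + (sg β : ℝ) * H β β α σ ρ - (sg β : ℝ) * H β α β σ ρ)) := by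
    intro β
    simp only [Pi.add_apply, Pi.sub_apply, Pi.smul_apply, smul_eq_mul, bracket, Fin.sum_univ_four]
    have f1 := fun b => antisym_self (hL b)
    simp only [sg_zero, sg_one, sg_two, sg_three, Int.cast_one, Int.cast_neg,
      fun b => hL b 0 ρ, fun b => hL b 1 ρ, fun b => hL b 2 ρ, fun b => hL b 3 ρ,
      fun b => hL b 0 σ, fun b => hL b 1 σ, fun b => hL b 2 σ, fun b => hL b 3 σ,
      fun c b => hP c b 0 ρ, fun c b => hP c b 1 ρ, fun c b => hP c b 2 ρ, fun c b => hP c b 3 ρ,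
      fun c b => hP c b 0 σ, fun c b => hP c b 1 σ, fun c b => hP c b 2 σ, fun c b => hP c b 3 σ,
      fun b => hL b 1 0, fun b => hL b 2 0, fun b => hL b 3 0, fun b => hL b 2 1,
      fun b => hL b 3 1, fun b => hL b 3 2, f1, fun c d b => hH c d b σ ρ]
    ring
  rw [Finset.sum_congr rfl fun β _ => key β, hX, hX, ← Finset.mul_sum]
  simp only [Finset.sum_add_distrib, Finset.sum_sub_distrib, ← Finset.mul_sum]

/-! ### The projection onto Fierz tensors -/

theorem sum_eps_mul_eps (w t : Fin 4) :
    ∑ α, ∑ ρ, ∑ σ, eps α ρ σ w * eps α ρ σ t = if w = t then 6 else 0 := by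
  have h : ∀ w t : Fin 4, ∑ α : Fin 4, ∑ ρ : Fin 4, ∑ σ : Fin 4,
      (((ρ : ℤ) - α) * (σ - α) * (w - α) * (σ - ρ) * (w - ρ) * (w - σ)) *
      (((ρ : ℤ) - α) * (σ - α) * (t - α) * (σ - ρ) * (t - ρ) * (t - σ))
      = 144 * if w = t then 6 else 0 := by
    decide +kernel
  have h1 := h w t
  simp only [← eps_eq] at h1
  have h2 : ∀ α ρ σ, 12 * eps α ρ σ w * (12 * eps α ρ σ t)
      = 144 * (eps α ρ σ w * eps α ρ σ t) := fun _ _ _ => by ring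
  simp only [h2, ← Finset.mul_sum] at h1
  exact mul_left_cancel₀ (by norm_num) h1

theorem eps_swap_mid (α ρ σ w : Fin 4) : eps α σ ρ w = -eps α ρ σ w := by
  have e1 := eps_eq α ρ σ w
  have e2 := eps_eq α σ ρ w
  have e3 : 12 * eps α σ ρ w + 12 * eps α ρ σ w = 0 := by
    rw [e1, e2]
    ring
  linarith

/-- Six times the kernel of the projection onto Fierz tensors. -/
def fierzKernel (a r s α ρ σ : Fin 4) : ℤ :=
  3 * ((if α = a ∧ ρ = r ∧ σ = s then 1 else 0) - if α = a ∧ ρ = s ∧ σ = r then 1 else 0)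
    - eta a r * (eta α ρ * (if σ = s then 1 else 0) - eta α σ * if ρ = s then 1 else 0)
    + eta a s * (eta α ρ * (if σ = r then 1 else 0) - eta α σ * if ρ = r then 1 else 0)
    - ∑ w, eps a r s w * eps α ρ σ w

section Pairing

variable {R : Type*} [CommRing R] (X : Fin 4 → Fin 4 → Fin 4 → R)

theorem sum_delta_mul (a r s : Fin 4) : ∑ α, ∑ ρ, ∑ σ,
    ((if α = a ∧ ρ = r ∧ σ = s then 1 else 0 : ℤ) : R) * X α ρ σ = X a r s := by
  simp [ite_and]

theorem sum_eta_delta_mul (s : Fin 4) : ∑ α, ∑ ρ, ∑ σ,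
    ((eta α ρ * if σ = s then 1 else 0 : ℤ) : R) * X α ρ σ = ∑ β, (sg β : R) * X β β s := by
  refine Finset.sum_congr rfl fun α _ => ?_
  rw [Finset.sum_eq_single α]
  · simp [eta]
  · intro ρ _ hρ
    simp [eta, Matrix.diagonal_apply_ne _ hρ.symm]
  · simp

theorem sum_eta_delta_mul' (s : Fin 4) : ∑ α, ∑ ρ, ∑ σ,
    ((eta α σ * if ρ = s then 1 else 0 : ℤ) : R) * X α ρ σ = ∑ β, (sg β : R) * X β s β := by
  refine Finset.sum_congr rfl fun α _ => ?_
  rw [Finset.sum_comm, Finset.sum_eq_single α]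
  · simp [eta]
  · intro ρ _ hρ
    simp [eta, Matrix.diagonal_apply_ne _ hρ.symm]
  · simp

theorem sum_eps_eps_mul (a r s : Fin 4) : ∑ α, ∑ ρ, ∑ σ,
    ((∑ w, eps a r s w * eps α ρ σ w : ℤ) : R) * X α ρ σ
      = ∑ l, ∑ μ, ∑ ν, ∑ w, (eps a r s w : R) * (eps l μ ν w : R) * X l μ ν := by
  simp [Finset.sum_mul]

/-- Antisymmetry of X merges the paired terms of the kernel, turning 3 into 6 and each coefficient 1
of η into 2. Over ℂ the right side is six times `fierzProj`. -/
theorem sum_fierzKernel_mul (hX : ∀ α ρ σ, X α ρ σ = -X α σ ρ) (a r s : Fin 4) :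
    ∑ α, ∑ ρ, ∑ σ, (fierzKernel a r s α ρ σ : R) * X α ρ σ
      = 6 * X a r s - 2 * (eta a r : R) * (∑ β, (sg β : R) * X β β s)
        + 2 * (eta a s : R) * (∑ β, (sg β : R) * X β β r)
        - ∑ l, ∑ μ, ∑ ν, ∑ w, (eps a r s w : R) * (eps l μ ν w : R) * X l μ ν := by
  have h1 : ∀ s, ∑ β, (sg β : R) * X β s β = -∑ β, (sg β : R) * X β β s := by
    intro s
    rw [← Finset.sum_neg_distrib]
    refine Finset.sum_congr rfl fun β _ => ?_
    rw [hX β s β, mul_neg]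
  have h2 : ∀ α ρ σ, (fierzKernel a r s α ρ σ : R) * X α ρ σ =
      3 * (((if α = a ∧ ρ = r ∧ σ = s then 1 else 0 : ℤ) : R) * X α ρ σ)
      - 3 * (((if α = a ∧ ρ = s ∧ σ = r then 1 else 0 : ℤ) : R) * X α ρ σ)
      - eta a r * (((eta α ρ * if σ = s then 1 else 0 : ℤ) : R) * X α ρ σ)
      + eta a r * (((eta α σ * if ρ = s then 1 else 0 : ℤ) : R) * X α ρ σ)
      + eta a s * (((eta α ρ * if σ = r then 1 else 0 : ℤ) : R) * X α ρ σ)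
      - eta a s * (((eta α σ * if ρ = r then 1 else 0 : ℤ) : R) * X α ρ σ)
      - ((∑ w, eps a r s w * eps α ρ σ w : ℤ) : R) * X α ρ σ := by
    intro α ρ σ
    rw [fierzKernel]
    generalize (∑ w, eps a r s w * eps α ρ σ w) = z
    push_cast
    ring
  simp only [h2, Finset.sum_add_distrib, Finset.sum_sub_distrib, ← Finset.mul_sum]
  rw [sum_delta_mul, sum_delta_mul, sum_eta_delta_mul, sum_eta_delta_mul, sum_eta_delta_mul',
    sum_eta_delta_mul', sum_eps_eps_mul, h1, h1, hX a s r]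
  ring

end Pairing

theorem fierzKernel_antisymm (a r s α ρ σ : Fin 4) :
    fierzKernel a r s α ρ σ = -fierzKernel a r s α σ ρ := by
  have h : ∑ w, eps a r s w * eps α ρ σ w = -∑ w, eps a r s w * eps α σ ρ w := by
    rw [← Finset.sum_neg_distrib]
    refine Finset.sum_congr rfl fun w _ => ?_
    rw [eps_swap_mid α ρ σ w]
    ring
  rw [fierzKernel, fierzKernel, h]
  simp only [and_comm (a := ρ = r), and_comm (a := ρ = s)]
  ring

/-- The ε part drops out because η is diagonal. In the remainder the leading coefficient 3 is
balanced by 4 - 1 from contracting the trace terms. -/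
theorem sum_eta_fierzKernel (a r s t : Fin 4) :
    ∑ α, ∑ ρ, eta α ρ * fierzKernel a r s α ρ t = 0 := by
  have h1 : ∀ a r s t : Fin 4, ∑ α : Fin 4, ∑ ρ : Fin 4, eta α ρ *
      (3 * ((if α = a ∧ ρ = r ∧ t = s then 1 else 0) - if α = a ∧ ρ = s ∧ t = r then 1 else 0)
    - eta a r * (eta α ρ * (if t = s then 1 else 0) - eta α t * if ρ = s then 1 else 0)
    + eta a s * (eta α ρ * (if t = r then 1 else 0) - eta α t * if ρ = r then 1 else 0)) = 0 := by
    decide +kernel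
  have h2 : ∑ α, ∑ ρ, eta α ρ * ∑ w, eps a r s w * eps α ρ t w = 0 := by
    refine Finset.sum_eq_zero fun α _ => Finset.sum_eq_zero fun ρ _ => ?_
    by_cases h : α = ρ
    · subst h
      simp [eps_eq_zero]
    · simp [eta, Matrix.diagonal_apply_ne _ h]
  simp only [fierzKernel, mul_sub _ _ (∑ w, _), Finset.sum_sub_distrib, h2, sub_zero]
  exact h1 a r s t

/-- Each row of the kernel is an admissible test tensor. For the last condition the kernel is paired
with ε itself: the leading part gives 6ε, and ε contracted with ε over three indices gives 6δ, which
cancels it. -/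
theorem fierzKernel_mem (a r s : Fin 4) :
    (fun α ρ σ => (fierzKernel a r s α ρ σ : ℝ) / 6) ∈ Fierz := by
  refine ⟨fun α ρ σ => ?_, fun t => ?_, fun t => ?_⟩
  · change (fierzKernel a r s α ρ σ : ℝ) / 6 = -((fierzKernel a r s α σ ρ : ℝ) / 6)
    rw [fierzKernel_antisymm]
    push_cast
    ring
  · have h1 := sum_eta_fierzKernel a r s t
    have h2 : ∀ α ρ, (eta α ρ : ℝ) * ((fierzKernel a r s α ρ t : ℝ) / 6)
        = (1 / 6) * ((eta α ρ * fierzKernel a r s α ρ t : ℤ) : ℝ) := by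
      intro α ρ
      push_cast
      ring
    simp only [h2, ← Finset.mul_sum]
    norm_cast
    rw [h1]
    simp
  · have h1 := sum_fierzKernel_mul (fun α ρ σ => (eps α ρ σ t : ℝ)) (fun α ρ σ => by
      rw [eps_swap_mid α σ ρ t]
      simp) a r s
    have h2 : ∀ α ρ σ, (eps α ρ σ t : ℝ) * ((fierzKernel a r s α ρ σ : ℝ) / 6)
        = (1 / 6) * ((fierzKernel a r s α ρ σ : ℝ) * eps α ρ σ t) := by
      intro α ρ σ
      ring
    have h3 : ∀ s, ∑ β, (sg β : ℝ) * (eps β β s t : ℝ) = 0 := fun s =>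
      Finset.sum_eq_zero fun β _ => by rw [eps_eq_zero (Or.inl rfl)]; simp
    have h4 : ∑ l, ∑ μ, ∑ ν, ∑ w, (eps a r s w : ℝ) * (eps l μ ν w : ℝ) * (eps l μ ν t : ℝ)
        = 6 * eps a r s t := by
      have e : ∑ l, ∑ μ, ∑ ν, ∑ w, (eps a r s w : ℝ) * (eps l μ ν w : ℝ) * (eps l μ ν t : ℝ)
          = ∑ w, (eps a r s w : ℝ) * ((∑ l, ∑ μ, ∑ ν, eps l μ ν w * eps l μ ν t : ℤ) : ℝ) := by
        push_cast
        simp only [Finset.mul_sum]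
        conv_rhs => rw [Finset.sum_comm]
        refine Finset.sum_congr rfl fun l _ => ?_
        conv_rhs => rw [Finset.sum_comm]
        refine Finset.sum_congr rfl fun μ _ => ?_
        conv_rhs => rw [Finset.sum_comm]
        exact Finset.sum_congr rfl fun ν _ => Finset.sum_congr rfl fun w _ => by ring
      rw [e]
      simp only [sum_eps_mul_eps]
      simp [mul_comm]
    simp only [h2, ← Finset.mul_sum]
    rw [h1, h3, h3, h4]
    ring

/-- The correction terms pair with v through its two contractions with η or through its contraction
with ε, all of which vanish for a Fierz tensor. -/
theorem fierzProj_pairing (X : Fin 4 → Fin 4 → Fin 4 → ℂ) {v : Fin 4 → Fin 4 → Fin 4 → ℝ}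
    (hv : v ∈ Fierz) : ∑ α, ∑ ρ, ∑ σ, (v α ρ σ : ℂ) * fierzProj X α ρ σ
      = ∑ α, ∑ ρ, ∑ σ, (v α ρ σ : ℂ) * X α ρ σ := by
  obtain ⟨h1, h2, h3⟩ := hv
  have t1 : ∀ Z : Fin 4 → ℂ, ∑ α, ∑ ρ, ∑ σ, (v α ρ σ : ℂ) * ((eta α ρ : ℂ) * Z σ) = 0 := by
    intro Z
    have e : ∀ σ, ∑ α, ∑ ρ, (eta α ρ : ℂ) * (v α ρ σ : ℂ) = 0 := fun σ => by
      exact_mod_cast congrArg Complex.ofReal (h2 σ)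
    have e2 : ∑ σ, (∑ α, ∑ ρ, (eta α ρ : ℂ) * (v α ρ σ : ℂ)) * Z σ = 0 := by
      simp only [e, zero_mul, Finset.sum_const_zero]
    rw [← e2]
    simp only [Finset.sum_mul]
    conv_rhs => rw [Finset.sum_comm]
    refine Finset.sum_congr rfl fun α _ => ?_
    conv_rhs => rw [Finset.sum_comm]
    exact Finset.sum_congr rfl fun ρ _ => Finset.sum_congr rfl fun σ _ => by ring
  have t2 : ∀ Z : Fin 4 → ℂ, ∑ α, ∑ ρ, ∑ σ, (v α ρ σ : ℂ) * ((eta α σ : ℂ) * Z ρ) = 0 := by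
    intro Z
    rw [← neg_zero, ← t1 Z, ← Finset.sum_neg_distrib]
    refine Finset.sum_congr rfl fun α _ => ?_
    rw [Finset.sum_comm]
    simp only [← Finset.sum_neg_distrib]
    refine Finset.sum_congr rfl fun ρ _ => Finset.sum_congr rfl fun σ _ => ?_
    rw [h1 α σ ρ]
    push_cast
    ring
  have t3 : ∑ α, ∑ ρ, ∑ σ, (v α ρ σ : ℂ) *
      ∑ l, ∑ μ, ∑ ν, ∑ w, (eps α ρ σ w : ℂ) * (eps l μ ν w : ℂ) * X l μ ν = 0 := by
    have e : ∀ w, ∑ α, ∑ ρ, ∑ σ, (eps α ρ σ w : ℂ) * (v α ρ σ : ℂ) = 0 := fun w => by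
      exact_mod_cast congrArg Complex.ofReal (h3 w)
    have e3 : ∀ α ρ σ, ∑ l, ∑ μ, ∑ ν, ∑ w, (eps α ρ σ w : ℂ) * (eps l μ ν w : ℂ) * X l μ ν
        = ∑ w, (eps α ρ σ w : ℂ) * ∑ l, ∑ μ, ∑ ν, (eps l μ ν w : ℂ) * X l μ ν := by
      intro α ρ σ
      simp only [Finset.mul_sum]
      conv_rhs => rw [Finset.sum_comm]
      refine Finset.sum_congr rfl fun l _ => ?_
      conv_rhs => rw [Finset.sum_comm]
      refine Finset.sum_congr rfl fun μ _ => ?_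
      conv_rhs => rw [Finset.sum_comm]
      exact Finset.sum_congr rfl fun ν _ => Finset.sum_congr rfl fun w _ => by ring
    have e2 : ∑ w, (∑ α, ∑ ρ, ∑ σ, (eps α ρ σ w : ℂ) * (v α ρ σ : ℂ)) *
        (∑ l, ∑ μ, ∑ ν, (eps l μ ν w : ℂ) * X l μ ν) = 0 := by
      simp only [e, zero_mul, Finset.sum_const_zero]
    rw [← e2]
    simp only [e3]
    obtain ⟨Z, hZ⟩ : ∃ Z : Fin 4 → ℂ, ∀ w, ∑ l, ∑ μ, ∑ ν, (eps l μ ν w : ℂ) * X l μ ν = Z w :=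
      ⟨_, fun _ => rfl⟩
    simp only [hZ, Finset.sum_mul, Finset.mul_sum]
    conv_rhs => rw [Finset.sum_comm]
    refine Finset.sum_congr rfl fun α _ => ?_
    conv_rhs => rw [Finset.sum_comm]
    refine Finset.sum_congr rfl fun ρ _ => ?_
    conv_rhs => rw [Finset.sum_comm]
    refine Finset.sum_congr rfl fun σ _ => Finset.sum_congr rfl fun w _ => ?_
    ring
  have h4 : ∀ α ρ σ, (v α ρ σ : ℂ) * fierzProj X α ρ σ = (v α ρ σ : ℂ) * X α ρ σ
      - (1 / 3) * ((v α ρ σ : ℂ) * ((eta α ρ : ℂ) * ∑ β, (sg β : ℂ) * X β β σ))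
      + (1 / 3) * ((v α ρ σ : ℂ) * ((eta α σ : ℂ) * ∑ β, (sg β : ℂ) * X β β ρ))
      - (1 / 6) * ((v α ρ σ : ℂ) *
        ∑ l, ∑ μ, ∑ ν, ∑ w, (eps α ρ σ w : ℂ) * (eps l μ ν w : ℂ) * X l μ ν) := by
    intro α ρ σ
    rw [fierzProj]
    ring
  simp only [h4, Finset.sum_add_distrib, Finset.sum_sub_distrib, ← Finset.mul_sum]
  rw [t1 fun σ => ∑ β, (sg β : ℂ) * X β β σ, t2 fun ρ => ∑ β, (sg β : ℂ) * X β β ρ, t3]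
  ring

/-- Pairing with all Fierz tensors detects the projection onto Fierz tensors. -/
theorem forall_fierz_iff {X : Fin 4 → Fin 4 → Fin 4 → ℂ} (hX : ∀ α ρ σ, X α ρ σ = -X α σ ρ) :
    (∀ v ∈ Fierz, ∑ α, ∑ ρ, ∑ σ, (v α ρ σ : ℂ) * X α ρ σ = 0) ↔
      ∀ α ρ σ, fierzProj X α ρ σ = 0 := by
  constructor
  · intro h a r s
    -- Testing with the kernel row (a, r, s) evaluates the projection at that entry.
    have h1 := h _ (fierzKernel_mem a r s)
    have h2 : ∀ α ρ σ, (((fierzKernel a r s α ρ σ : ℝ) / 6 : ℝ) : ℂ) * X α ρ σ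
        = (1 / 6) * ((fierzKernel a r s α ρ σ : ℂ) * X α ρ σ) := by
      intro α ρ σ
      push_cast
      ring
    simp only [h2, ← Finset.mul_sum, sum_fierzKernel_mul X hX] at h1
    rw [fierzProj, ← h1]
    ring
  · intro h v hv
    rw [← fierzProj_pairing X hv]
    simp only [h, mul_zero, Finset.sum_const_zero]

/-! ### The Fierz force field and its field equation -/

theorem uTensor3_apply (α ρ σ κ : Fin 4) :
    uTensor3 α ρ σ κ = (eta α κ : ℂ) • theta [ρ, σ] := by
  simp [uTensor3, basisTensor, Finset.sum_apply]

theorem fierzForce_eq (F : Fin 4 → Fin 4 → Fin 4 → ℝ) :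
    fierzForce F = forceOf thetaTensor fierzComp F := by
  funext κ
  have h1 : forceOf thetaTensor fierzComp F κ = ∑ ρ, ∑ σ,
      ((sg κ : ℝ) * ((1 / 2) * (F κ ρ σ - F κ σ ρ))) • theta [ρ, σ] := rfl
  have h2 : ∑ ρ, ∑ σ, ((sg κ : ℝ) * ((1 / 2) * F κ σ ρ)) • theta [ρ, σ]
      = -∑ ρ, ∑ σ, ((sg κ : ℝ) * ((1 / 2) * F κ ρ σ)) • theta [ρ, σ] := by
    rw [Finset.sum_comm]
    simp only [← Finset.sum_neg_distrib]
    refine Finset.sum_congr rfl fun ρ _ => Finset.sum_congr rfl fun σ _ => ?_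
    rw [theta_swap ρ σ, smul_neg]
  rw [h1]
  simp only [mul_sub, sub_smul, Finset.sum_sub_distrib, h2, sub_neg_eq_add]
  simp only [fierzForce, Finset.sum_apply, Pi.smul_apply, uTensor3_apply,
    ← Finset.sum_add_distrib]
  rw [Finset.sum_eq_single κ]
  · refine Finset.sum_congr rfl fun ρ _ => Finset.sum_congr rfl fun σ _ => ?_
    rw [eta, Matrix.diagonal_apply_eq, ← add_smul, smul_smul, ← Complex.coe_smul]
    congr 1
    push_cast
    ring
  · intro α _ hα
    simp [eta, Matrix.diagonal_apply_ne _ hα]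
  · simp

theorem source_fierzForce (F : Fin 4 → Fin 4 → Fin 4 → ℝ) (ψ : Spinor) :
    source ψ (fierzForce F) = ∑ α, ∑ ρ, ∑ σ, (F α ρ σ : ℂ) *
      herm ψ ((gamma α * theta [ρ, σ]) *ᵥ ψ) := by
  have h1 : ∀ α ρ σ, ∑ κ, gammaUp κ * uTensor3 α ρ σ κ = gamma α * theta [ρ, σ] := by
    intro α ρ σ
    rw [Finset.sum_eq_single α]
    · rw [uTensor3_apply, eta, Matrix.diagonal_apply_eq, gammaUp, mul_smul_comm, smul_mul_assoc,
        smul_smul, sg_mul_sg_complex, one_smul]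
    · intro κ _ hκ
      simp [uTensor3_apply, eta, Matrix.diagonal_apply_ne _ hκ.symm]
    · simp
  rw [fierzForce, source_sum]
  refine Finset.sum_congr rfl fun α _ => ?_
  rw [source_sum]
  refine Finset.sum_congr rfl fun ρ _ => ?_
  rw [source_sum]
  refine Finset.sum_congr rfl fun σ _ => ?_
  rw [source_smul, source, h1]

theorem lower2_dstrength {V : Type*} (u : V → Fin 4 → Fin 4 → Fin 4 → ℝ) (q : V) (p : Fin 4 → V)
    (h : Fin 4 → Fin 4 → V) (α β : Fin 4) : lower2 (dstrength u q p h α β)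
      = dstrength (fun v γ => lower2 (u v γ)) q p h α β := by
  simp only [dstrength, strength, lower2_add, lower2_sub, lower2_smul, lower2_bracket]

/-- This identifies ξ: it is the covariant divergence of the curvature with all indices lowered.
Only antisymmetry of F in its last two indices enters. -/
theorem xi_eq {F : Spacetime → Fin 4 → Fin 4 → Fin 4 → ℝ} (hF : ContDiff ℝ ∞ F)
    (h : ∀ x α, F x α ∈ Antisym) (x : Spacetime) (α ρ σ : Fin 4) :
    ∑ β, (sg β : ℝ) * lower2 (dstrength fierzComp (F x) (fun γ => pd γ F x)
      (fun γ δ => pd γ (fun y => pd δ F y) x) β α) ρ σ = xi F α ρ σ x := by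
  have hp := fun γ x α => fierz_pd hF h γ x α
  have hh := fun γ δ α => fierz_pd (contDiff_pd hF δ) (hp δ) γ x α
  have hl : ∀ {f : Fin 4 → Fin 4 → ℝ}, f ∈ Antisym → lower2 f ∈ Antisym := by
    intro f hf ρ σ
    rw [lower2, lower2, hf ρ σ]
    ring
  have e := sum_dstrength_low (fun β => hl (fierzComp_mem (F x) β))
    (fun γ β => hl (fierzComp_mem (pd γ F x) β))
    (fun γ δ β => hl (fierzComp_mem (pd γ (fun y => pd δ F y) x) β))
    (X := fun α ρ σ => xiTilde F α ρ σ x) (fun α ρ σ => by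
      simp only [lower2_fierzComp (h x _), lower2_fierzComp (hp _ x _), lower2_fierzComp (hh _ _ _),
        xiTilde, box_eq (contDiff_low3 hF _ _ _), pd_low3 hF, pd_low3 (contDiff_pd hF _)]) α ρ σ
  simp only [lower2_dstrength]
  exact e

theorem sum_dstrength_fierz {F : Spacetime → Fin 4 → Fin 4 → Fin 4 → ℝ} (hF : ContDiff ℝ ∞ F)
    (h : ∀ x α, F x α ∈ Antisym) (x : Spacetime) {v : Fin 4 → Fin 4 → Fin 4 → ℝ}
    (hv : ∀ α, v α ∈ Antisym) :
    -32 * ∑ α, ∑ β, (sg α : ℝ) * (sg β : ℝ) *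
        minkowski2 (dstrength fierzComp (F x) (fun γ => pd γ F x)
          (fun γ δ => pd γ (fun y => pd δ F y) x) α β) (fierzComp v β)
      = -32 * ∑ α, ∑ ρ, ∑ σ, v α ρ σ * xi F α ρ σ x := by
  simp only [← xi_eq hF h]
  generalize hG : (fun α β => dstrength fierzComp (F x) (fun γ => pd γ F x)
          (fun γ δ => pd γ (fun y => pd δ F y) x) α β) = G
  simp only [fun α β => congrFun (congrFun hG α) β]
  congr 1
  rw [Finset.sum_comm]
  refine Finset.sum_congr rfl fun β _ => ?_
  simp only [minkowski2_eq_lower2, fierzComp_of_antisym (hv _), Finset.mul_sum]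
  rw [Finset.sum_comm]
  refine Finset.sum_congr rfl fun ρ _ => ?_
  rw [Finset.sum_comm]
  refine Finset.sum_congr rfl fun σ _ => Finset.sum_congr rfl fun α _ => ?_
  rw [Pi.smul_apply, Pi.smul_apply, smul_eq_mul]
  linear_combination (sg α * lower2 (G α β) ρ σ * v β ρ σ : ℝ) * sg_cast_sq β

theorem fierz_smul {v : Fin 4 → Fin 4 → Fin 4 → ℝ} (hv : v ∈ Fierz) (r : ℝ) : r • v ∈ Fierz := by
  obtain ⟨h1, h2, h3⟩ := hv
  refine ⟨fun α ρ σ => ?_, fun σ => ?_, fun t => ?_⟩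
  · simp [h1 α ρ σ]
  · have := congrArg (r * ·) (h2 σ)
    simpa [Finset.mul_sum, mul_left_comm] using this
  · have := congrArg (r * ·) (h3 t)
    simpa [Finset.mul_sum, mul_left_comm] using this

theorem fierz_case (m τ : ℝ) {ψ : Spacetime → Spinor} (hψ : ContDiff ℝ ∞ ψ)
    {F : Spacetime → Fin 4 → Fin 4 → Fin 4 → ℝ} (hF : ContDiff ℝ ∞ F) (hFA : ∀ x, F x ∈ Fierz) :
    (∀ x, IsForceTensor (fierzForce (F x))) ∧
      (∀ x, LV (fun y => fierzForce (F y)) x = (fierzPotential F x : ℂ)) ∧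
      (τ ≠ 0 →
        (IsStationaryAt Fierz (fun q => Ltot m τ ψ (fun y => fierzForce (q y))) F ↔
          ∀ x, FierzEquation τ ψ F x)) := by
  set T := forceOf thetaTensor fierzComp with hTdef
  have hTF : ∀ v, IsForceTensor (T v) := fun v =>
    isForceTensor_iff.2 fun α => thetaTensor_mem _
  have hT : ∀ v α, T v α = thetaTensor (fierzComp v α) := fun _ _ => rfl
  have hTf : ∀ v, fierzForce v = T v := fierzForce_eq
  have hA : ∀ x α, F x α ∈ Antisym := fun x α => (hFA x).1 α
  refine ⟨fun x => hTf (F x) ▸ hTF _, fun x => ?_, fun hτ => ?_⟩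
  · simp only [hTf]
    rw [LV_eq_tracePair _ hF, tracePair_of_thetaTensor fierzComp_mem hT, fierzPotential_eq hF hA]
  · have hτ' : (τ : ℂ) ≠ 0 := by exact_mod_cast hτ
    simp only [hTf]
    rw [isStationaryAt_iff hTF (fun _ hv r => fierz_smul hv r) m τ hψ hF]
    refine forall_congr' fun x => ?_
    have h1 : ∀ v ∈ Fierz, (eulerLagrange T τ (ψ x) (F x)
        (fun γ => pd γ F x) (fun γ α => pd γ (fun y => pd α F y) x) v = 0 ↔
        ∑ α, ∑ ρ, ∑ σ, (v α ρ σ : ℂ) * (((xi F α ρ σ x : ℝ) : ℂ) - chi τ ψ α ρ σ x) = 0) := by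
      intro v hv
      -- The factor 128 is 4 · 32, from 4τ and the trace form of the Θ_{ρσ}. No angle occurs, so τ ≠
      -- 0 alone allows the division.
      have e : eulerLagrange T τ (ψ x) (F x)
          (fun γ => pd γ F x) (fun γ α => pd γ (fun y => pd α F y) x) v
          = (-128 * τ) * ∑ α, ∑ ρ, ∑ σ,
            (v α ρ σ : ℂ) * (((xi F α ρ σ x : ℝ) : ℂ) - chi τ ψ α ρ σ x) := by
        rw [eulerLagrange_of_real (yangMills_of_thetaTensor fierzComp_mem hT _ _ _ _),
          sum_dstrength_fierz hF hA x hv.1, ← hTf, source_fierzForce]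
        push_cast
        simp only [Finset.mul_sum, ← Finset.sum_add_distrib]
        refine Finset.sum_congr rfl fun α _ => Finset.sum_congr rfl fun ρ _ =>
          Finset.sum_congr rfl fun σ _ => ?_
        rw [chi]
        push_cast
        field_simp
        ring
      rw [e, mul_eq_zero, or_iff_right (mul_ne_zero (by norm_num) hτ')]
    have hX : ∀ α ρ σ, ((xi F α ρ σ x : ℝ) : ℂ) - chi τ ψ α ρ σ x
        = -(((xi F α σ ρ x : ℝ) : ℂ) - chi τ ψ α σ ρ x) := by
      intro α ρ σ
      have e1 : xi F α ρ σ x = -xi F α σ ρ x := by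
        rw [xi, xi]
        ring
      have e2 : chi τ ψ α ρ σ x = -chi τ ψ α σ ρ x := by
        rw [chi, chi, theta_swap ρ σ, mul_neg, ← neg_one_smul ℂ (gamma α * _), Matrix.smul_mulVec,
          herm_smul]
        ring
      rw [e1, e2]
      push_cast
      ring
    rw [forall₂_congr h1, forall_fierz_iff hX, FierzEquation]
    refine forall_congr' fun α => forall_congr' fun ρ => forall_congr' fun σ => ?_
    -- Linearity of the projection turns the vanishing of P(ξ - χ) into P(ξ) = P(χ).
    rw [← sub_eq_zero (b := fierzProj (fun a r s => chi τ ψ a r s x) α ρ σ), iff_iff_eq]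
    congr 1
    simp only [fierzProj, mul_sub, Finset.sum_sub_distrib]
    ring

end ForceField

/-! ### The six types together -/

theorem mainTheorem5 (m τ ζ : ℝ) (ψ : Spacetime → Spinor) (hψ : ContDiff ℝ ∞ ψ) :
    -- scalar field
    (∀ φ : Spacetime → ℝ, ContDiff ℝ ∞ φ →
      (∀ x, IsForceTensor (scalarForce ζ (φ x))) ∧
      (∀ x, LV (fun y => scalarForce ζ (φ y)) x = (scalarPotential ζ φ x : ℂ)) ∧
      (τ ≠ 0 → Real.cos (2 * ζ) ≠ 0 →
        (IsStationaryAt Set.univ (fun q => Ltot m τ ψ (fun y => scalarForce ζ (q y))) φ ↔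
          ∀ x, ScalarEquation ζ τ ψ φ x))) ∧
    -- vector field of the first type
    (∀ B : Spacetime → Fin 4 → ℝ, ContDiff ℝ ∞ B →
      (∀ x, IsForceTensor (vectorForce ζ (B x))) ∧
      (∀ x, LV (fun y => vectorForce ζ (B y)) x = (vectorPotential ζ B x : ℂ)) ∧
      (∀ x, vectorDivTerm B x = ∑ α, pdU α (fun y =>
        ∑ β, ∑ ρ, ∑ σ, (eps α β ρ σ : ℝ) * up1 B β y * pdU ρ (up1 B σ) y) x) ∧
      IsStationaryAt Set.univ (fun q x => (vectorDivTerm q x : ℂ)) B ∧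
      (τ ≠ 0 → Real.cos (2 * ζ) ≠ 0 →
        (IsStationaryAt Set.univ (fun q => Ltot m τ ψ (fun y => vectorForce ζ (q y))) B ↔
          ∀ x, VectorEquation ζ τ ψ B x))) ∧
    -- vector field of the second type
    (∀ A : Spacetime → Fin 4 → ℝ, ContDiff ℝ ∞ A →
      (∀ x, IsForceTensor (imVectorForce ζ (A x))) ∧
      (∀ x, LV (fun y => imVectorForce ζ (A y)) x = (imVectorPotential ζ A x : ℂ)) ∧
      (τ ≠ 0 → Real.cos (2 * ζ) ≠ 0 →
        (IsStationaryAt Set.univ (fun q => Ltot m τ ψ (fun y => imVectorForce ζ (q y))) A ↔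
          ∀ x, ImVectorEquation ζ τ ψ A x))) ∧
    -- antisymmetric tensor field
    (∀ W : Spacetime → Fin 4 → Fin 4 → ℝ, ContDiff ℝ ∞ W → (∀ x, W x ∈ Antisym) →
      (∀ x, IsForceTensor (antisymForce ζ (W x))) ∧
      (∀ x, LV (fun y => antisymForce ζ (W y)) x = (antisymPotential ζ W x : ℂ)) ∧
      (τ ≠ 0 → Real.cos (2 * ζ) ≠ 0 →
        (IsStationaryAt Antisym (fun q => Ltot m τ ψ (fun y => antisymForce ζ (q y))) W ↔
          ∀ x, AntisymEquation ζ τ ψ W x))) ∧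
    -- symmetric contraction-free tensor field
    (∀ S : Spacetime → Fin 4 → Fin 4 → ℝ, ContDiff ℝ ∞ S → (∀ x, S x ∈ SymTraceless) →
      (∀ x, IsForceTensor (symForce ζ (S x))) ∧
      (∀ x, LV (fun y => symForce ζ (S y)) x = (symPotential ζ S x : ℂ)) ∧
      (τ ≠ 0 → Real.cos (2 * ζ) ≠ 0 →
        (IsStationaryAt SymTraceless (fun q => Ltot m τ ψ (fun y => symForce ζ (q y))) S ↔
          ∀ x, SymEquation ζ τ ψ S x))) ∧
    -- Fierz tensor field
    (∀ F : Spacetime → Fin 4 → Fin 4 → Fin 4 → ℝ, ContDiff ℝ ∞ F → (∀ x, F x ∈ Fierz) →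
      (∀ x, IsForceTensor (fierzForce (F x))) ∧
      (∀ x, LV (fun y => fierzForce (F y)) x = (fierzPotential F x : ℂ)) ∧
      (τ ≠ 0 →
        (IsStationaryAt Fierz (fun q => Ltot m τ ψ (fun y => fierzForce (q y))) F ↔
          ∀ x, FierzEquation τ ψ F x))) := by
  exact ⟨fun _ hφ => scalar_case m τ ζ hψ hφ, fun _ hB => vector_case m τ ζ hψ hB,
    fun _ hA => imVector_case m τ ζ hψ hA, fun _ hW hWA => antisym_case m τ ζ hψ hW hWA,
    fun _ hS hSA => sym_case m τ ζ hψ hS hSA, fun _ hF hFA => fierz_case m τ hψ hF hFA⟩
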